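/- Setting. Let $U\subset\mathbb{R}^d$ be bounded and convex, and let $L:\mathbb{R}^+\times\mathbb{R}^d\times U\to\mathbb{R}^+$, where $\mathbb{R}^+=[0,\infty)$, be continuous, uniformly continuous in $(t,x)$ uniformly with respect to $u$, and convex in $u$. Put $$H(t,x,z)=\sup_{u\in U}\,[z\cdot u-L(t,x,u)],\qquad \bar H(x,z)=\inf_{t\ge 0}H(t,x,z).$$ Assume that $\bar H$ is uniformly continuous in $x$, uniformly with respect to $z$, and that there are constants $\lambda,\Lambda,c,C>0$ with $$c(|x|+1)\le L(t,x,u)\le C(|x|+1),\qquad \lambda|z|-C(|x|+1)\le H(t,x,z)\le\Lambda|z|-c(|x|+1)$$ for all $t\ge 0$, $x,z\in\mathbb{R}^d$, $u\in U$. Let $V:\mathbb{R}^d\to\mathbb{R}$ be convex with $\int_{\mathbb{R}^d}e^{-V}dx=1$ and $\tfrac12|\nabla V|\le\lambda$, in the sense that $V$ is Lipschitz with constant $2\lambda$ (for example $V$ smooth, or $V(x)=\gamma|x|+m$ with $0<\gamma<2\lambda$). Let $\|f\|_{L^q_V}=(\int|f|^qe^{-V}dx)^{1/q}$ and let $W^{1,q}_V$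 be the space of functions with weak gradient for which $\|f\|_{W^{1,q}_V}=\|f\|_{L^q_V}+\|\nabla f\|_{L^q_V}<\infty$; $H^1_V=W^{1,2}_V$, $(f)_V=\int f e^{-V}dx$ and $\psi\wedge M=\min(\psi,M)$. Consider the inequality $$\tfrac12\Delta\psi(x)+\bar H(x,\nabla\psi(x))\le 0.\qquad(*)$$ A function $\psi:\mathbb{R}^d\to(-\infty,+\infty]$ is a (viscosity) supersolution of $(*)$ if, whenever $\varphi\in C^2(\mathbb{R}^d)$ satisfies $\varphi\le\psi$ near $x$ and $\varphi(x)=\psi(x)$, one has $\tfrac12\Delta\varphi(x)+\bar H(x,\nabla\varphi(x))\le0$. A function $f\in H^1_V$ is a weak supersolution of $(*)$ if for every compactly supported $h\in H^1_V$ with $h\ge0$ the integral below exists and $$\int_{\mathbb{R}^d}\Big[-\tfrac12\nabla f\cdot\nabla h+\bar H(x,\nabla f)\,h\Big]dx\le0.$$ Proposition 5.5. (1) There are a constant $\overline C$ and constants $C(M)$, $M\ge0$, none of which depends on $\psi$, such that every lower semicontinuous supersolution $\psi:\mathbb{R}^d\to(-\infty,+\infty]$ of $(*)$ that is bounded from below,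 is integrable with respect to $e^{-V}dx$ and satisfies $(\psi)_V=0$, also satisfies $$\psi\in W^{1,1}_V,\qquad \|\psi\|_{W^{1,1}_V}\le\overline C,\qquad \psi(x)\ge-\overline C(1+|x|^2)\quad\text{for all }x\in\mathbb{R}^d,$$ and, for every $M\ge0$, $\psi\wedge M\in H^1_V$, $\|\psi\wedge M\|_{H^1_V}\le C(M)$, and $\psi\wedge M$ is a weak supersolution of $(*)$. (2) Conversely, let $\psi:\mathbb{R}^d\to(-\infty,+\infty]$ be such that, for every $M\ge0$, $\psi\wedge M\in H^1_V$ and $\psi\wedge M$ is a weak supersolution of $(*)$. Then $\psi$ is lower semicontinuous, up to modification on a set of Lebesgue measure zero. -/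

import Mathlib

open MeasureTheory Filter Topology
open scoped ENNReal NNReal ContDiff

noncomputable section

/-- `d`-dimensional Euclidean space. -/
abbrev Eucl (d : ℕ) : Type := EuclideanSpace ℝ (Fin d)

/-! ### Lagrangian and Hamiltonian -/

/-- Standing assumptions on a Lagrangian `L (t, x, u)`, `t ≥ 0`, `x ∈ ℝᵈ`, `u ∈ U`, in the case of
a bounded drift: `U` is bounded and convex, `L` is nonnegative and continuous, uniformly continuous
in `(t, x)` uniformly in `u`, and convex in `u`. The values of `L` off `U` play no role. -/
structure IsBoundedDriftLagrangian {d : ℕ} (U : Set (Eucl d))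
    (L : ℝ≥0 → Eucl d → Eucl d → ℝ) : Prop where
  bounded : Bornology.IsBounded U
  convex_drift : Convex ℝ U
  nonneg : ∀ t x, ∀ u ∈ U, 0 ≤ L t x u
  continuousOn : ContinuousOn (fun w : ℝ≥0 × Eucl d × Eucl d => L w.1 w.2.1 w.2.2)
    {w | w.2.2 ∈ U}
  uniform : ∀ ε > 0, ∃ δ > 0, ∀ (s t : ℝ≥0) (x y : Eucl d), dist s t < δ → dist x y < δ →
    ∀ u ∈ U, |L s x u - L t y u| < ε
  convexOn : ∀ t x, ConvexOn ℝ U (L t x)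

/-- The Hamiltonian `H (t, x, z) = sup_{u ∈ U} (z · u - L (t, x, u))`. -/
def hamiltonian {d : ℕ} (U : Set (Eucl d)) (L : ℝ≥0 → Eucl d → Eucl d → ℝ)
    (t : ℝ≥0) (x z : Eucl d) : ℝ :=
  ⨆ u : U, (inner ℝ z (u : Eucl d) - L t x u)

/-- The stationary Hamiltonian `H̄ (x, z) = inf_{t ≥ 0} H (t, x, z)`. -/
def hamiltonianBar {d : ℕ} (U : Set (Eucl d)) (L : ℝ≥0 → Eucl d → Eucl d → ℝ)
    (x z : Eucl d) : ℝ :=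
  ⨅ t : ℝ≥0, hamiltonian U L t x z

/-- The growth (coercivity) conditions, for a bounded drift, on `L` and on its Hamiltonian. -/
structure HasLinearGrowth {d : ℕ} (U : Set (Eucl d)) (L : ℝ≥0 → Eucl d → Eucl d → ℝ)
    (lam Lam c C : ℝ) : Prop where
  lam_pos : 0 < lam
  Lam_pos : 0 < Lam
  c_pos : 0 < c
  C_pos : 0 < C
  le_L : ∀ t x, ∀ u ∈ U, c * (‖x‖ + 1) ≤ L t x u
  L_le : ∀ t x, ∀ u ∈ U, L t x u ≤ C * (‖x‖ + 1)
  le_H : ∀ t x z, lam * ‖z‖ - C * (‖x‖ + 1) ≤ hamiltonian U L t x z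
  H_le : ∀ t x z, hamiltonian U L t x z ≤ Lam * ‖z‖ - c * (‖x‖ + 1)

/-- `K (x, z)` is uniformly continuous in `x`, uniformly with respect to `z`. -/
def UniformlyContinuousInSpace {d : ℕ} (K : Eucl d → Eucl d → ℝ) : Prop :=
  ∀ ε > 0, ∃ δ > 0, ∀ x y z : Eucl d, dist x y < δ → |K x z - K y z| < ε

/-! ### Weights and weighted Sobolev spaces -/

/-- Admissible weight potentials: `V` is convex, `e^{-V}` has total mass one, and
`|∇V| / 2 ≤ lam`, written as the Lipschitz condition `|V x - V y| ≤ 2 lam |x - y|` so that it also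
makes sense for potentials such as `γ |x| + m` which are not differentiable everywhere. -/
structure IsWeight {d : ℕ} (V : Eucl d → ℝ) (lam : ℝ) : Prop where
  convexOn : ConvexOn ℝ Set.univ V
  lipschitz : ∀ x y, |V x - V y| ≤ 2 * lam * ‖x - y‖
  integral_eq_one : ∫ x, Real.exp (-V x) = 1

/-- The measure `e^{-V(x)} dx`. -/
def weightMeasure {d : ℕ} (V : Eucl d → ℝ) : Measure (Eucl d) :=
  volume.withDensity (fun x => ENNReal.ofReal (Real.exp (-V x)))

/-- `g` is the weak (distributional) gradient of `f` on `ℝᵈ`. -/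
structure HasWeakGradient {d : ℕ} (f : Eucl d → ℝ) (g : Eucl d → Eucl d) : Prop where
  locallyIntegrable : LocallyIntegrable f volume
  locallyIntegrable_grad : LocallyIntegrable g volume
  integral_eq : ∀ φ : Eucl d → ℝ, ContDiff ℝ ∞ φ → HasCompactSupport φ →
    ∫ x, f x • gradient φ x = - ∫ x, φ x • g x

open Classical in
/-- The weak gradient of `f`, unique up to null sets when it exists (and `0` otherwise). -/
def weakGradient {d : ℕ} (f : Eucl d → ℝ) : Eucl d → Eucl d :=
  if h : ∃ g, HasWeakGradient f g then h.choose else 0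

/-- Membership in the weighted Sobolev space `W^{1,q}_V`. -/
structure MemSobolevV {d : ℕ} (V : Eucl d → ℝ) (q : ℝ≥0∞) (f : Eucl d → ℝ) : Prop where
  memLp : MemLp f q (weightMeasure V)
  exists_grad : ∃ g, HasWeakGradient f g
  memLp_grad : MemLp (weakGradient f) q (weightMeasure V)

/-- The norm `‖f‖_{L^q_V} + ‖∇f‖_{L^q_V}` of `W^{1,q}_V` (the space `H¹_V` is the case `q = 2`). -/
def sobolevNormV {d : ℕ} (V : Eucl d → ℝ) (q : ℝ≥0∞) (f : Eucl d → ℝ) : ℝ≥0∞ :=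
  eLpNorm f q (weightMeasure V) + eLpNorm (weakGradient f) q (weightMeasure V)

/-! ### Supersolutions of `Δψ / 2 + K (x, ∇ψ) ≤ 0` -/

/-- `ψ : ℝᵈ → (-∞, ∞]` is a viscosity supersolution of `Δψ / 2 + K (x, ∇ψ) ≤ 0`: the inequality
holds for each `C²` function that touches `ψ` from below, at the point of contact. -/
def IsViscositySupersolution {d : ℕ} (K : Eucl d → Eucl d → ℝ) (ψ : Eucl d → EReal) : Prop :=
  ∀ (x : Eucl d) (φ : Eucl d → ℝ), ContDiff ℝ 2 φ → (φ x : EReal) = ψ x →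
    (∀ᶠ y in 𝓝 x, (φ y : EReal) ≤ ψ y) →
    (1 / 2 : ℝ) * Laplacian.laplacian φ x + K x (gradient φ x) ≤ 0

/-- `f ∈ H¹_V` is a weak supersolution of `Δf / 2 + K (x, ∇f) ≤ 0`: it is tested against
nonnegative, compactly supported `h ∈ H¹_V`. -/
def IsWeakSupersolution {d : ℕ} (V : Eucl d → ℝ) (K : Eucl d → Eucl d → ℝ)
    (f : Eucl d → ℝ) : Prop :=
  ∀ h : Eucl d → ℝ, MemSobolevV V 2 h → HasCompactSupport h → (∀ x, 0 ≤ h x) →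
    Integrable (fun x => -(1 / 2 : ℝ) * inner ℝ (weakGradient f x) (weakGradient h x)
      + K x (weakGradient f x) * h x) ∧
    ∫ x, (-(1 / 2 : ℝ) * inner ℝ (weakGradient f x) (weakGradient h x)
      + K x (weakGradient f x) * h x) ≤ 0

/-- The truncation `ψ ∧ M`, as a real function (used only for `ψ` that never takes the
value `-∞`). -/
def truncation {d : ℕ} (ψ : Eucl d → EReal) (M : ℝ) : Eucl d → ℝ :=
  fun x => (min (ψ x) (M : EReal)).toReal

/-- The normalization `(ψ)_V = ∫ ψ e^{-V} dx = 0`: `ψ` is finite almost everywhere, integrable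
with respect to `e^{-V} dx`, and its integral vanishes. -/
structure HasZeroMean {d : ℕ} (V : Eucl d → ℝ) (ψ : Eucl d → EReal) : Prop where
  finite_ae : ∀ᵐ x, ψ x ≠ ⊤ ∧ ψ x ≠ ⊥
  integrable : Integrable (fun x => (ψ x).toReal) (weightMeasure V)
  integral_eq : ∫ x, (ψ x).toReal ∂(weightMeasure V) = 0

end

/-! Only a few features of the stationary Hamiltonian K matter: it is Lipschitz in the gradient,
uniformly continuous in space, bounded above by Λ|z|, and coercive, K ≥ λ|z| - C(|x| + 1). The
condition on the weight is matched to the coercivity. Testing the equation with g e^{-θV} produces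
the extra term ½θ ∇f·∇V, of size at most θλ|∇f|, and the coercive term pays for it. With θ = 1
nothing of the gradient is left beside ½∇f·∇g, and the choices g = b - f and g = f' - f give energy
bounds in L². With θ = ½ and g = 1 what is left over is an L¹ bound for ∇f that does not depend on
any bound for f (`IsApproxSupersolution.weighted_test`).

These tests need weak, not viscosity, inequalities. A truncation ψ ∧ M is a bounded lower
semicontinuous viscosity supersolution, because K(x, 0) ≤ 0. Its inf-convolutions are Lipschitz and
semiconcave, increase to it, and satisfy the viscosity inequality with K evaluated at the minimizing
point. A viscosity inequality Δw/2 ≤ G is turned into a distributional one by comparing w with the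
heat flow and differentiating at time zero (`integral_laplacian_le_of_touching`). The right-hand
side is continuous almost everywhere, since minimizers depend continuously on x wherever the
envelope is differentiable, and uniform continuity of K in space moves the minimizing point back to
x at a vanishing cost (`IsBoundedLSC.exists_laplacian_infConvolution_le`).

The energy inequality for differences shows that the gradients of this increasing sequence are
Cauchy in L² (`IsApproximation.exists_tendsto_gradient`). Strong convergence lets the nonlinear term
pass to the limit, so ψ ∧ M is a weak supersolution.

For bounds independent of ψ, an L¹ Poincaré inequality for the log-concave weight
(`IsWeight.exists_poincare`) combines the gradient bound with the zero mean to control ψ in L¹.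
Since Δψ/2 ≤ C(|x| + 1), a mean value inequality turns the L¹ bound into a pointwise lower bound on
a fixed ball, and a paraboloid barrier extends it to all of space with quadratic loss. Inserted in
the energy estimate, this bounds ψ ∧ M in H¹.

The converse uses the mean value inequality again: a distributional bound from above on the
Laplacian makes corrected radial averages increase as the radius shrinks. They are continuous, so
their supremum is lower semicontinuous, and it equals the function almost everywhere
(`HasLaplacianBound.exists_lowerSemicontinuous`). The supremum over the heights of truncation
finishes the argument. -/

/-- The properties of the stationary Hamiltonian that are used: it is Lipschitz in the gradient
variable, uniformly continuous in space, and has linear growth. -/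
structure IsLinearHamiltonian {d : ℕ} (K : Eucl d → Eucl d → ℝ) (R lam Lam C : ℝ) : Prop where
  R_nonneg : 0 ≤ R
  lam_pos : 0 < lam
  Lam_pos : 0 < Lam
  C_pos : 0 < C
  lipschitz : ∀ x z z', |K x z - K x z'| ≤ R * ‖z - z'‖
  uniform : UniformlyContinuousInSpace K
  lower : ∀ x z, lam * ‖z‖ - C * (‖x‖ + 1) ≤ K x z
  upper : ∀ x z, K x z ≤ Lam * ‖z‖

/-- A supremum of functions affine in z with slopes in the bounded set U is Lipschitz with the
radius of U as constant, and an infimum over t preserves this; the lower bound on H keeps that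
infimum finite. The negative part of the upper bound is dropped: only its consequence K(x, 0) ≤ 0
will be needed. -/
theorem hamiltonianBar_isLinearHamiltonian {d : ℕ} {U : Set (Eucl d)}
    {L : ℝ≥0 → Eucl d → Eucl d → ℝ} {lam Lam c C : ℝ} (hL : IsBoundedDriftLagrangian U L)
    (hg : HasLinearGrowth U L lam Lam c C)
    (hu : UniformlyContinuousInSpace (hamiltonianBar U L)) :
    ∃ R, IsLinearHamiltonian (hamiltonianBar U L) R lam Lam C := by
  obtain ⟨R, hR0, hR⟩ := hL.bounded.exists_pos_norm_le
  have hbdd : ∀ t x z, BddAbove (Set.range fun u : U => (inner ℝ z (u : Eucl d) - L t x u)) := by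
    intro t x z
    refine ⟨‖z‖ * R, ?_⟩
    rintro _ ⟨u, rfl⟩
    have h1 := real_inner_le_norm z (u : Eucl d)
    have h2 := mul_le_mul_of_nonneg_left (hR u u.2) (norm_nonneg z)
    have h3 := hL.nonneg t x u u.2
    simp only
    linarith
  have hH : ∀ t x z z', hamiltonian U L t x z ≤ hamiltonian U L t x z' + R * ‖z - z'‖ := by
    intro t x z z'
    -- An empty real supremum is `0` by convention, so this case is trivial.
    rcases isEmpty_or_nonempty U with h | h
    · simp [hamiltonian, Real.iSup_of_isEmpty]; positivity
    refine ciSup_le fun u => ?_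
    have h1 : inner ℝ z' (u : Eucl d) - L t x u ≤ hamiltonian U L t x z' := le_ciSup (hbdd t x z') u
    have h2 := real_inner_le_norm (z - z') (u : Eucl d)
    rw [inner_sub_left] at h2
    have h3 := mul_le_mul_of_nonneg_left (hR u u.2) (norm_nonneg (z - z'))
    linarith
  have hbb : ∀ x z, BddBelow (Set.range fun t : ℝ≥0 => hamiltonian U L t x z) := by
    intro x z
    exact ⟨lam * ‖z‖ - C * (‖x‖ + 1), by rintro _ ⟨t, rfl⟩; exact hg.le_H t x z⟩
  have hK : ∀ x z z', hamiltonianBar U L x z ≤ hamiltonianBar U L x z' + R * ‖z - z'‖ := by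
    intro x z z'
    rw [← sub_le_iff_le_add]
    refine le_ciInf fun t => ?_
    have h1 : hamiltonianBar U L x z ≤ hamiltonian U L t x z := ciInf_le (hbb x z) t
    have := hH t x z z'
    linarith
  refine ⟨R, hR0.le, hg.lam_pos, hg.Lam_pos, hg.C_pos, ?_, hu, ?_, ?_⟩
  · intro x z z'
    rw [abs_sub_le_iff]
    have h1 := hK x z z'
    have h2 := hK x z' z
    rw [norm_sub_rev z' z] at h2
    constructor <;> linarith
  · intro x z
    exact le_ciInf fun t => hg.le_H t x z
  · intro x z
    refine (ciInf_le (hbb x z) 0).trans ((hg.H_le 0 x z).trans ?_)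
    have := hg.c_pos
    have : 0 ≤ c * (‖x‖ + 1) := by positivity
    linarith

namespace IsLinearHamiltonian

variable {d : ℕ} {K : Eucl d → Eucl d → ℝ} {R lam Lam C : ℝ}

theorem continuous (h : IsLinearHamiltonian K R lam Lam C) :
    Continuous fun p : Eucl d × Eucl d => K p.1 p.2 := by
  rw [Metric.continuous_iff]
  rintro ⟨x, z⟩ ε hε
  obtain ⟨δ, hδ, hK⟩ := h.uniform (ε / 2) (by positivity)
  have hR := h.R_nonneg
  refine ⟨min δ (ε / (2 * (R + 1))), by positivity, ?_⟩
  rintro ⟨x', z'⟩ hd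
  rw [Prod.dist_eq, max_lt_iff] at hd
  have h1 := hK x' x z' (hd.1.trans_le (min_le_left _ _))
  have h2 := h.lipschitz x z' z
  have h3 : ‖z' - z‖ < ε / (2 * (R + 1)) := by
    rw [← dist_eq_norm]; exact hd.2.trans_le (min_le_right _ _)
  have h4 : R * ‖z' - z‖ ≤ ε / 2 := by
    calc R * ‖z' - z‖ ≤ (R + 1) * (ε / (2 * (R + 1))) := by gcongr; linarith
      _ = ε / 2 := by field_simp
  rw [Real.dist_eq]
  calc |K x' z' - K x z| ≤ |K x' z' - K x z'| + |K x z' - K x z| := abs_sub_le _ _ _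
    _ < ε := by linarith

theorem abs_le (h : IsLinearHamiltonian K R lam Lam C) (x z : Eucl d) :
    |K x z| ≤ Lam * ‖z‖ + C * (‖x‖ + 1) := by
  have h1 := h.lower x z
  have h2 := h.upper x z
  have := h.lam_pos
  have := h.C_pos
  have := h.Lam_pos
  have : 0 ≤ lam * ‖z‖ := by positivity
  have : 0 ≤ Lam * ‖z‖ := by positivity
  have : 0 ≤ C * (‖x‖ + 1) := by positivity
  rw [_root_.abs_le]
  constructor <;> linarith

end IsLinearHamiltonian

/-! ### Growth of the weight potential and integrability of its exponentials -/

section Weight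

variable {d : ℕ} {V : Eucl d → ℝ} {lam : ℝ}

theorem IsWeight.continuous (hV : IsWeight V lam) : Continuous V := by
  have h : LipschitzWith (Real.toNNReal (2 * lam)) V := by
    refine LipschitzWith.of_dist_le_mul fun x y => ?_
    rw [Real.dist_eq, dist_eq_norm]
    refine (hV.lipschitz x y).trans ?_
    gcongr
    exact Real.le_coe_toNNReal _
  exact h.continuous

theorem IsWeight.integrable (hV : IsWeight V lam) : Integrable fun x => Real.exp (-V x) := by
  by_contra h
  have := hV.integral_eq_one
  rw [integral_undef h] at this
  exact zero_ne_one this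

/-- A convex potential with integrable exponential grows at least linearly. -/
theorem IsWeight.exists_linear_lower (hV : IsWeight V lam) (hlam : 0 < lam) :
    ∃ a > 0, ∃ b, ∀ x, a * ‖x‖ - b ≤ V x := by
  have htail : Tendsto (fun n : ℕ => ∫ x in {x : Eucl d | (n : ℝ) ≤ ‖x‖}, Real.exp (-V x))
      atTop (𝓝 0) := by
    have h := tendsto_setIntegral_of_antitone (μ := volume) (f := fun x => Real.exp (-V x))
      (s := fun n : ℕ => {x : Eucl d | (n : ℝ) ≤ ‖x‖})
      (fun n => (isClosed_le continuous_const continuous_norm).measurableSet)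
      (fun m n hmn x hx => by
        simp only [Set.mem_ofPred_eq] at hx ⊢
        exact le_trans (by exact_mod_cast hmn) hx) ⟨0, hV.integrable.integrableOn⟩
    have he : (⋂ n : ℕ, {x : Eucl d | (n : ℝ) ≤ ‖x‖}) = ∅ := by
      ext x
      simp only [Set.mem_iInter, Set.mem_ofPred_eq, Set.mem_empty_iff_false, iff_false, not_forall,
        not_le]
      exact exists_nat_gt ‖x‖
    rw [he] at h
    simpa using h
  set v : ℝ := volume.real (Metric.closedBall (0 : Eucl d) 1) with hv
  have hvpos : 0 < v := by
    rw [hv, Measure.real, ENNReal.toReal_pos_iff]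
    exact ⟨Metric.measure_closedBall_pos _ _ one_pos, measure_closedBall_lt_top⟩
  -- The threshold is a lower bound for the mass of a unit ball whose centre satisfies V < V 0 + 1,
  -- because V varies by at most 2λ on it. Far out the tail has less mass than that, so V ≥ V 0 + 1
  -- there.
  have hev := htail.eventually (gt_mem_nhds
    (show (0 : ℝ) < v * Real.exp (-(V 0 + 1) - 2 * lam) by positivity))
  obtain ⟨n, hn⟩ := hev.exists
  -- One more than `n`, so that unit balls centred at norm at least `ρ` stay in the tail.
  set ρ : ℝ := n + 1 with hρ
  have hρ0 : 0 < ρ := by positivity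
  have hfar : ∀ x : Eucl d, ρ ≤ ‖x‖ → V 0 + 1 ≤ V x := by
    intro x hx
    by_contra! hlt
    refine hn.not_ge ?_
    calc v * Real.exp (-(V 0 + 1) - 2 * lam)
        = ∫ y in Metric.closedBall x 1, Real.exp (-(V 0 + 1) - 2 * lam) := by
          rw [setIntegral_const, smul_eq_mul, hv, Measure.real, Measure.real,
            Measure.addHaar_closedBall_center volume x 1]
      _ ≤ ∫ y in Metric.closedBall x 1, Real.exp (-V y) := by
          refine setIntegral_mono_on ?_ hV.integrable.integrableOn
            measurableSet_closedBall ?_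
          · exact integrableOn_const measure_closedBall_lt_top.ne
          · intro y hy
            have h1 := hV.lipschitz y x
            have h2 : ‖y - x‖ ≤ 1 := by rw [← dist_eq_norm]; exact hy
            have h3 := le_abs_self (V y - V x)
            have h4 : 2 * lam * ‖y - x‖ ≤ 2 * lam * 1 := by gcongr
            gcongr
            linarith
      _ ≤ ∫ y in {y : Eucl d | (n : ℝ) ≤ ‖y‖}, Real.exp (-V y) := by
          refine setIntegral_mono_set hV.integrable.integrableOn
            (Eventually.of_forall fun y => (Real.exp_pos _).le) (LE.le.eventuallyLE ?_)
          intro y hy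
          have h2 : ‖y - x‖ ≤ 1 := by rw [← dist_eq_norm]; exact hy
          have h3 := norm_sub_norm_le x y
          rw [norm_sub_rev] at h3
          simp only [Set.mem_ofPred_eq]
          linarith
  -- On each ray V has risen by at least 1 at radius ρ, so convexity gives slope 1/ρ beyond it. The
  -- additive constant absorbs the ball of radius ρ through the Lipschitz bound.
  refine ⟨1 / ρ, by positivity, 2 * lam * ρ + 1 + |V 0|, fun x => ?_⟩
  rcases le_or_gt ρ ‖x‖ with hx | hx
  · have hx0 : 0 < ‖x‖ := hρ0.trans_le hx
    have h1 := hV.convexOn.2 (Set.mem_univ x) (Set.mem_univ 0)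
      (show 0 ≤ ρ / ‖x‖ by positivity)
      (show 0 ≤ 1 - ρ / ‖x‖ by rw [sub_nonneg, div_le_one hx0]; exact hx) (by ring)
    have h2 := hfar ((ρ / ‖x‖) • x) (by
      rw [norm_smul, Real.norm_of_nonneg (by positivity), div_mul_cancel₀ _ hx0.ne'])
    simp only [smul_zero, add_zero, smul_eq_mul] at h1
    have h3 : 1 ≤ ρ / ‖x‖ * (V x - V 0) := by linarith
    have h4 : ‖x‖ / ρ ≤ V x - V 0 := by
      rw [div_mul_eq_mul_div, le_div_iff₀ hx0] at h3
      rw [div_le_iff₀ hρ0]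
      linarith
    have h5 := neg_abs_le (V 0)
    have h6 : 0 < 2 * lam * ρ := by positivity
    have : 1 / ρ * ‖x‖ = ‖x‖ / ρ := by ring
    linarith
  · have h1 := hV.lipschitz x 0
    rw [sub_zero] at h1
    have h2 := neg_abs_le (V x - V 0)
    have h3 : 2 * lam * ‖x‖ ≤ 2 * lam * ρ := by gcongr
    have h5 := neg_abs_le (V 0)
    have h6 : 1 / ρ * ‖x‖ ≤ 1 := by
      rw [one_div_mul_eq_div, div_le_one hρ0]; exact hx.le
    linarith

/-- The exponential decays faster than any power, in particular fast enough for a comparison with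
the integrable function (1 + ‖x‖)^{-(d+1)}. -/
theorem integrable_one_add_norm_pow_mul_exp_neg (k : ℕ) {a : ℝ} (ha : 0 < a) :
    Integrable fun x : Eucl d => (1 + ‖x‖) ^ k * Real.exp (-(a * ‖x‖)) := by
  have hJ := integrable_one_add_norm (E := Eucl d) (μ := volume)
    (r := (Module.finrank ℝ (Eucl d) : ℝ) + 1) (by linarith)
  set m : ℕ := Module.finrank ℝ (Eucl d) + 1 with hm
  have hT : Tendsto (fun s : ℝ => s ^ (k + m) * Real.exp (-a * s)) atTop (𝓝 0) := by
    have := tendsto_rpow_mul_exp_neg_mul_atTop_nhds_zero (k + m : ℕ) a ha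
    simpa only [Real.rpow_natCast] using this
  obtain ⟨B, hB⟩ : ∃ B, ∀ s : ℝ, 0 ≤ s → s ^ (k + m) * Real.exp (-a * s) ≤ B := by
    obtain ⟨s₀, hs₀⟩ := (hT.eventually (gt_mem_nhds one_pos)).exists_forall_of_atTop
    obtain ⟨B, hB⟩ := (isCompact_Icc (a := 0) (b := s₀)).bddAbove_image
      (f := fun s : ℝ => s ^ (k + m) * Real.exp (-a * s)) (by fun_prop)
    refine ⟨max B 1, fun s hs => ?_⟩
    rcases le_total s s₀ with h | h
    · exact (hB ⟨s, ⟨hs, h⟩, rfl⟩).trans (le_max_left _ _)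
    · exact (hs₀ s h).le.trans (le_max_right _ _)
  refine (hJ.const_mul (B * Real.exp a)).mono' (by fun_prop) (Eventually.of_forall fun x => ?_)
  have h0 : (0 : ℝ) < 1 + ‖x‖ := by positivity
  rw [Real.norm_of_nonneg (by positivity), Real.rpow_neg h0.le]
  have h1 := hB (1 + ‖x‖) h0.le
  have h2 : Real.exp (-(a * ‖x‖)) = Real.exp a * Real.exp (-a * (1 + ‖x‖)) := by
    rw [← Real.exp_add]; ring_nf
  have h3 : (1 + ‖x‖) ^ ((Module.finrank ℝ (Eucl d) : ℝ) + 1) = (1 + ‖x‖) ^ m := by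
    rw [← Real.rpow_natCast, hm]; push_cast; rfl
  rw [h3, h2, ← div_eq_mul_inv, le_div_iff₀ (by positivity)]
  calc (1 + ‖x‖) ^ k * (Real.exp a * Real.exp (-a * (1 + ‖x‖))) * (1 + ‖x‖) ^ m
      = Real.exp a * ((1 + ‖x‖) ^ (k + m) * Real.exp (-a * (1 + ‖x‖))) := by rw [pow_add]; ring
    _ ≤ Real.exp a * B := by gcongr
    _ = B * Real.exp a := mul_comm _ _

/-- Powers of `1 + ‖x‖` are integrable against `e^{-θV}`. -/
theorem IsWeight.integrable_pow_mul_exp (hV : IsWeight V lam) (hlam : 0 < lam) (k : ℕ) {θ : ℝ}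
    (hθ : 0 < θ) : Integrable fun x : Eucl d => (1 + ‖x‖) ^ k * Real.exp (-(θ * V x)) := by
  obtain ⟨a, ha, b, hab⟩ := hV.exists_linear_lower hlam
  have hc := hV.continuous
  refine ((integrable_one_add_norm_pow_mul_exp_neg (d := d) k (mul_pos hθ ha)).const_mul
    (Real.exp (θ * b))).mono' (by fun_prop) (Eventually.of_forall fun x => ?_)
  rw [Real.norm_of_nonneg (by positivity), mul_left_comm, ← Real.exp_add]
  gcongr
  have := mul_le_mul_of_nonneg_left (hab x) hθ.le
  linarith

theorem IsWeight.integrable_exp (hV : IsWeight V lam) (hlam : 0 < lam) {θ : ℝ}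
    (hθ : 0 < θ) : Integrable fun x : Eucl d => Real.exp (-(θ * V x)) := by
  simpa using hV.integrable_pow_mul_exp hlam 0 hθ

end Weight

/-! ### The weighted measure and its comparison with Lebesgue measure on compact sets -/

section WeightMeasure

variable {d : ℕ} {V : Eucl d → ℝ}

theorem measurable_weight_density (hV : Continuous V) :
    Measurable fun x : Eucl d => ENNReal.ofReal (Real.exp (-V x)) := by fun_prop

theorem weightMeasure_absolutelyContinuous : weightMeasure V ≪ volume :=
  withDensity_absolutelyContinuous _ _

theorem absolutelyContinuous_weightMeasure (hV : Continuous V) : volume ≪ weightMeasure V := by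
  refine withDensity_absolutelyContinuous' (measurable_weight_density hV).aemeasurable ?_
  exact Eventually.of_forall fun x => by simp [Real.exp_pos]

theorem integral_weightMeasure {F : Type*} [NormedAddCommGroup F] [NormedSpace ℝ F]
    (hV : Continuous V) (f : Eucl d → F) :
    ∫ x, f x ∂(weightMeasure V) = ∫ x, Real.exp (-V x) • f x := by
  rw [weightMeasure, integral_withDensity_eq_integral_toReal_smul (measurable_weight_density hV)
    (Eventually.of_forall fun x => ENNReal.ofReal_lt_top)]
  simp [ENNReal.toReal_ofReal (Real.exp_pos _).le]

theorem integrable_weightMeasure_iff {F : Type*} [NormedAddCommGroup F] [NormedSpace ℝ F]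
    (hV : Continuous V) (f : Eucl d → F) :
    Integrable f (weightMeasure V) ↔ Integrable fun x => Real.exp (-V x) • f x := by
  rw [weightMeasure, integrable_withDensity_iff_integrable_smul' (measurable_weight_density hV)
    (Eventually.of_forall fun x => ENNReal.ofReal_lt_top)]
  simp [ENNReal.toReal_ofReal (Real.exp_pos _).le]

/-- On a compact set V is bounded above, hence its exponential weight is bounded below. Every
passage from weighted to local unweighted integrability goes through this comparison. -/
theorem restrict_le_smul_weightMeasure (hV : Continuous V) {S : Set (Eucl d)} (hS : IsCompact S) :
    ∃ c : ℝ≥0∞, c ≠ ⊤ ∧ volume.restrict S ≤ c • weightMeasure V := by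
  obtain ⟨B, hB⟩ := hS.bddAbove_image hV.continuousOn
  refine ⟨ENNReal.ofReal (Real.exp B), ENNReal.ofReal_ne_top, ?_⟩
  refine Measure.le_iff.2 fun A hA => ?_
  rw [Measure.restrict_apply hA, Measure.smul_apply, smul_eq_mul, weightMeasure,
    withDensity_apply _ hA, ← lintegral_const_mul _ (measurable_weight_density hV)]
  calc volume (A ∩ S) = ∫⁻ x in A ∩ S, 1 := by simp
    _ ≤ ∫⁻ x in A ∩ S, ENNReal.ofReal (Real.exp B) * ENNReal.ofReal (Real.exp (-V x)) := by
        refine setLIntegral_mono' (hA.inter hS.measurableSet) fun x hx => ?_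
        rw [← ENNReal.ofReal_mul (Real.exp_pos _).le, ← Real.exp_add, ← ENNReal.ofReal_one]
        refine ENNReal.ofReal_le_ofReal (Real.one_le_exp ?_)
        have := hB ⟨x, hx.2, rfl⟩
        linarith
    _ ≤ _ := lintegral_mono_set Set.inter_subset_left

theorem MemLp.restrict_of_weightMeasure {F : Type*} [NormedAddCommGroup F] {q : ℝ≥0∞}
    {f : Eucl d → F} (hf : MemLp f q (weightMeasure V)) (hV : Continuous V)
    {S : Set (Eucl d)} (hS : IsCompact S) : MemLp f q (volume.restrict S) := by
  obtain ⟨c, hc, hle⟩ := restrict_le_smul_weightMeasure hV hS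
  exact hf.of_measure_le_smul hc hle

theorem MemLp.locallyIntegrable_of_weightMeasure {F : Type*} [NormedAddCommGroup F] {q : ℝ≥0∞}
    (hq : 1 ≤ q) {f : Eucl d → F} (hf : MemLp f q (weightMeasure V)) (hV : Continuous V) :
    LocallyIntegrable f volume := by
  rw [locallyIntegrable_iff]
  intro S hS
  have : IsFiniteMeasure (volume.restrict S) := ⟨by simpa using hS.measure_lt_top⟩
  exact (MemLp.restrict_of_weightMeasure hf hV hS).integrable hq

end WeightMeasure

/-! ### Weak gradients: uniqueness, Lipschitz functions, stability under limits -/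

section WeakGradient

variable {d : ℕ} {f : Eucl d → ℝ} {g g' : Eucl d → Eucl d}

theorem measurable_gradient (f : Eucl d → ℝ) : Measurable (gradient f) := by
  unfold gradient
  exact (InnerProductSpace.toDual ℝ (Eucl d)).symm.continuous.measurable.comp (measurable_fderiv ℝ f)

theorem LipschitzWith.norm_gradient_le {L : ℝ≥0} (hf : LipschitzWith L f) (x : Eucl d) :
    ‖gradient f x‖ ≤ L := by
  rw [gradient, LinearIsometryEquiv.norm_map]
  exact norm_fderiv_le_of_lipschitz ℝ hf

theorem norm_gradient (f : Eucl d → ℝ) (x : Eucl d) : ‖gradient f x‖ = ‖fderiv ℝ f x‖ := by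
  rw [gradient, LinearIsometryEquiv.norm_map]

theorem ContDiff.continuous_gradient {φ : Eucl d → ℝ} {n : WithTop ℕ∞} (hφ : ContDiff ℝ n φ)
    (hn : n ≠ 0) : Continuous (gradient φ) := by
  unfold gradient
  exact (InnerProductSpace.toDual ℝ (Eucl d)).symm.continuous.comp (hφ.continuous_fderiv hn)

theorem HasCompactSupport.gradient {φ : Eucl d → ℝ} (hφ : HasCompactSupport φ) :
    HasCompactSupport (gradient φ) := by
  have := hφ.fderiv (𝕜 := ℝ)
  exact this.comp_left (g := (InnerProductSpace.toDual ℝ (Eucl d)).symm) (map_zero _)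

theorem HasWeakGradient.ae_eq (h : HasWeakGradient f g) (h' : HasWeakGradient f g') :
    g =ᵐ[volume] g' := by
  refine ae_eq_of_integral_contDiff_smul_eq h.locallyIntegrable_grad h'.locallyIntegrable_grad ?_
  intro φ hφ hc
  have h1 := h.integral_eq φ hφ hc
  rw [h'.integral_eq φ hφ hc] at h1
  exact (neg_injective h1).symm

theorem HasWeakGradient.weakGradient_ae_eq (h : HasWeakGradient f g) :
    weakGradient f =ᵐ[volume] g := by
  have he : ∃ g, HasWeakGradient f g := ⟨g, h⟩
  rw [weakGradient, dif_pos he]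
  exact he.choose_spec.ae_eq h

theorem hasWeakGradient_weakGradient (h : ∃ g, HasWeakGradient f g) :
    HasWeakGradient f (weakGradient f) := by
  rw [weakGradient, dif_pos h]
  exact h.choose_spec

theorem HasWeakGradient.integral_fderiv_mul (h : HasWeakGradient f g) {φ : Eucl d → ℝ}
    (hφ : ContDiff ℝ ∞ φ) (hc : HasCompactSupport φ) (v : Eucl d) :
    ∫ x, f x * fderiv ℝ φ x v = -∫ x, φ x * inner ℝ (g x) v := by
  have h1 := congrArg (fun u => inner ℝ v u) (h.integral_eq φ hφ hc)
  simp only [inner_neg_right] at h1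
  rw [← integral_inner, ← integral_inner] at h1
  · simpa only [real_inner_smul_right, inner_gradient_right, conj_trivial, real_inner_comm v]
      using h1
  · exact h.locallyIntegrable_grad.integrable_smul_left_of_hasCompactSupport hφ.continuous hc
  · exact h.locallyIntegrable.integrable_smul_right_of_hasCompactSupport
      (hφ.continuous_gradient (by simp)) hc.gradient

theorem hasWeakGradient_of_forall (hf : LocallyIntegrable f volume)
    (hg : LocallyIntegrable g volume)
    (h : ∀ φ : Eucl d → ℝ, ContDiff ℝ ∞ φ → HasCompactSupport φ → ∀ v : Eucl d,
      ∫ x, f x * fderiv ℝ φ x v = -∫ x, φ x * inner ℝ (g x) v) : HasWeakGradient f g := by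
  refine ⟨hf, hg, fun φ hφ hc => ext_inner_left ℝ fun v => ?_⟩
  rw [inner_neg_right, ← integral_inner, ← integral_inner]
  · simpa only [real_inner_smul_right, inner_gradient_right, conj_trivial, real_inner_comm v]
      using h φ hφ hc v
  · exact hg.integrable_smul_left_of_hasCompactSupport hφ.continuous hc
  · exact hf.integrable_smul_right_of_hasCompactSupport
      (hφ.continuous_gradient (by simp)) hc.gradient

theorem LipschitzWith.locallyIntegrable_gradient {L : ℝ≥0} (hf : LipschitzWith L f) :
    LocallyIntegrable (gradient f) volume := by
  refine (locallyIntegrable_const (L : ℝ)).mono (measurable_gradient f).aestronglyMeasurable ?_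
  exact Eventually.of_forall fun x => by
    simpa using hf.norm_gradient_le x

/-- By Rademacher's theorem the pointwise gradient exists almost everywhere, and integration by
parts for line derivatives shows that it is the weak gradient. For the Lipschitz approximations the
pointwise `gradient` can therefore be used throughout. -/
theorem LipschitzWith.hasWeakGradient {L : ℝ≥0} (hf : LipschitzWith L f) :
    HasWeakGradient f (_root_.gradient f) := by
  refine hasWeakGradient_of_forall hf.continuous.locallyIntegrable hf.locallyIntegrable_gradient ?_
  intro φ hφ hc v
  obtain ⟨D, hD⟩ := hφ.lipschitzWith_of_hasCompactSupport hc (by simp)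
  have h1 := hf.integral_lineDeriv_mul_eq (μ := volume) hD hc v
  have h2 : ∫ x, lineDeriv ℝ f x v * φ x = ∫ x, φ x * inner ℝ (_root_.gradient f x) v := by
    refine integral_congr_ae ?_
    filter_upwards [hf.ae_differentiableAt (μ := volume)] with x hx
    rw [hx.lineDeriv_eq_fderiv, inner_gradient_left, mul_comm]
  have h3 : ∫ x, lineDeriv ℝ φ x (-v) * f x = -∫ x, f x * fderiv ℝ φ x v := by
    rw [← integral_neg]
    congr 1
    ext x
    rw [((hφ.differentiable (by simp)) x).lineDeriv_eq_fderiv, map_neg]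
    ring
  rw [h2, h3] at h1
  rw [h1, neg_neg]

theorem HasWeakGradient.congr {f' : Eucl d → ℝ} (h : HasWeakGradient f g) (hf : f =ᵐ[volume] f')
    (hg : g =ᵐ[volume] g') : HasWeakGradient f' g' := by
  refine ⟨h.locallyIntegrable.congr hf, h.locallyIntegrable_grad.congr hg, fun φ hφ hc => ?_⟩
  rw [← integral_congr_ae (f := fun x => f x • _root_.gradient φ x)
    (hf.mono fun x hx => by simp [hx]), h.integral_eq φ hφ hc,
    integral_congr_ae (g := fun x => φ x • g' x) (hg.mono fun x hx => by simp [hx])]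

/-- Weak gradients pass to limits in `L¹` on bounded sets. -/
theorem HasWeakGradient.of_tendsto {u : ℕ → Eucl d → ℝ} {G : ℕ → Eucl d → Eucl d}
    (h : ∀ n, HasWeakGradient (u n) (G n)) (hf : LocallyIntegrable f volume)
    (hg : LocallyIntegrable g volume)
    (hfu : ∀ r : ℝ, Tendsto (fun n => ∫ x in Metric.closedBall 0 r, ‖u n x - f x‖) atTop (𝓝 0))
    (hgu : ∀ r : ℝ, Tendsto (fun n => ∫ x in Metric.closedBall 0 r, ‖G n x - g x‖) atTop (𝓝 0)) :
    HasWeakGradient f g := by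
  have key : ∀ {F : Type} [NormedAddCommGroup F] [NormedSpace ℝ F] (w : ℕ → Eucl d → ℝ)
      (w₀ : Eucl d → ℝ) (φ : Eucl d → ℝ), (∀ n, LocallyIntegrable (w n) volume) →
      LocallyIntegrable w₀ volume → Continuous φ → HasCompactSupport φ →
      (∀ r : ℝ, Tendsto (fun n => ∫ x in Metric.closedBall 0 r, ‖w n x - w₀ x‖) atTop (𝓝 0)) →
      Tendsto (fun n => ∫ x, w n x * φ x) atTop (𝓝 (∫ x, w₀ x * φ x)) := by
    intro F _ _ w w₀ φ hw hw₀ hφ hc hlim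
    obtain ⟨B, hB⟩ := hφ.bounded_above_of_compact_support hc
    obtain ⟨r, hr⟩ := hc.isCompact.isBounded.subset_closedBall 0
    rw [tendsto_iff_norm_sub_tendsto_zero]
    refine squeeze_zero (fun _ => norm_nonneg _) (fun n => ?_)
      (by simpa using (hlim r).const_mul B)
    have hi1 : Integrable fun x => w n x * φ x :=
      (hw n).integrable_smul_right_of_hasCompactSupport hφ hc
    have hi2 : Integrable fun x => w₀ x * φ x :=
      hw₀.integrable_smul_right_of_hasCompactSupport hφ hc
    rw [← integral_sub hi1 hi2, ← integral_const_mul]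
    rw [← setIntegral_eq_integral_of_forall_compl_eq_zero (s := Metric.closedBall 0 r)]
    · refine norm_integral_le_of_norm_le ?_ (Eventually.of_forall fun x => ?_)
      · exact (((hw n).integrableOn_isCompact (isCompact_closedBall 0 r)).sub
          (hw₀.integrableOn_isCompact (isCompact_closedBall 0 r))).norm.const_mul B
      · rw [← sub_mul, norm_mul, mul_comm]
        exact mul_le_mul_of_nonneg_right (hB x) (norm_nonneg _)
    · intro x hx
      have : φ x = 0 := by
        by_contra hne
        exact hx (hr (subset_tsupport _ hne))
      simp [this]
  refine hasWeakGradient_of_forall hf hg fun φ hφ hc v => ?_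
  have h1 := key (F := ℝ) u f (fun x => fderiv ℝ φ x v) (fun n => (h n).locallyIntegrable) hf
    ((hφ.continuous_fderiv (by simp)).clm_apply continuous_const)
    (hc.fderiv_apply (𝕜 := ℝ) v) hfu
  have h2 := key (F := ℝ) (fun n x => inner ℝ (G n x) v) (fun x => inner ℝ (g x) v) φ
    (fun n => ?_) ?_ hφ.continuous hc ?_
  · have h3 : Tendsto (fun n => ∫ x, u n x * fderiv ℝ φ x v) atTop
        (𝓝 (-∫ x, inner ℝ (g x) v * φ x)) := by
      refine h2.neg.congr fun n => ?_
      rw [(h n).integral_fderiv_mul hφ hc v]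
      simp only [mul_comm]
    have h4 := tendsto_nhds_unique h1 h3
    rw [h4]
    simp only [mul_comm]
  · intro x
    obtain ⟨s, hs, hi⟩ := (h n).locallyIntegrable_grad x
    exact ⟨s, hs, hi.inner_const v⟩
  · intro x
    obtain ⟨s, hs, hi⟩ := hg x
    exact ⟨s, hs, hi.inner_const v⟩
  · intro r
    refine squeeze_zero (fun n => by positivity) (fun n => ?_)
      (by simpa using (hgu r).mul_const ‖v‖)
    rw [← integral_mul_const]
    refine integral_mono_of_nonneg (Eventually.of_forall fun x => norm_nonneg _) ?_
      (Eventually.of_forall fun x => ?_)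
    · exact (((h n).locallyIntegrable_grad.integrableOn_isCompact (isCompact_closedBall 0 r)).sub
        (hg.integrableOn_isCompact (isCompact_closedBall 0 r))).norm.mul_const _
    · simp only
      rw [← inner_sub_left]
      exact norm_inner_le_norm _ _

theorem HasWeakGradient.memSobolevV {V : Eucl d → ℝ} {q : ℝ≥0∞} (h : HasWeakGradient f g)
    (hf : MemLp f q (weightMeasure V)) (hg : MemLp g q (weightMeasure V)) : MemSobolevV V q f :=
  ⟨hf, ⟨g, h⟩, hg.ae_eq (weightMeasure_absolutelyContinuous.ae_eq h.weakGradient_ae_eq).symm⟩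

theorem HasWeakGradient.sobolevNormV_eq {V : Eucl d → ℝ} {q : ℝ≥0∞} (h : HasWeakGradient f g) :
    sobolevNormV V q f = eLpNorm f q (weightMeasure V) + eLpNorm g q (weightMeasure V) := by
  rw [sobolevNormV,
    eLpNorm_congr_ae (weightMeasure_absolutelyContinuous.ae_eq h.weakGradient_ae_eq)]

/-- A Lipschitz function of compact support belongs to `H¹_V`. -/
theorem LipschitzWith.memSobolevV_of_hasCompactSupport {V : Eucl d → ℝ} (hV : Continuous V)
    {L : ℝ≥0} (hf : LipschitzWith L f) (hc : HasCompactSupport f) : MemSobolevV V 2 f := by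
  have hloc : IsLocallyFiniteMeasure (weightMeasure V) :=
    IsLocallyFiniteMeasure.withDensity_ofReal (by fun_prop)
  refine hf.hasWeakGradient.memSobolevV (hf.continuous.memLp_of_hasCompactSupport hc) ?_
  have hg := hc.gradient
  have h1 : MemLp (Set.indicator (tsupport (_root_.gradient f)) fun _ => (L : ℝ)) 2
      (weightMeasure V) :=
    memLp_indicator_const 2 (isClosed_tsupport _).measurableSet _
      (Or.inr hg.isCompact.measure_lt_top.ne)
  refine h1.mono (measurable_gradient f).aestronglyMeasurable (Eventually.of_forall fun x => ?_)
  by_cases hx : x ∈ tsupport (_root_.gradient f)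
  · rw [Set.indicator_of_mem hx]
    simpa using hf.norm_gradient_le x
  · rw [image_eq_zero_of_notMem_tsupport hx]
    simp

end WeakGradient

/-! ### Mollification and the extension of inequalities to Sobolev test functions -/

section Mollification

variable {d : ℕ}

theorem MeasureTheory.MemLp.integrable_inner_two {α F : Type*} [MeasurableSpace α] {μ : Measure α}
    [NormedAddCommGroup F] [InnerProductSpace ℝ F] {p g : α → F} (hp : MemLp p 2 μ)
    (hg : MemLp g 2 μ) : Integrable (fun x => inner ℝ (p x) (g x)) μ := by
  refine (L2.integrable_inner (𝕜 := ℝ) (hp.toLp p) (hg.toLp g)).congr ?_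
  filter_upwards [hp.coeFn_toLp, hg.coeFn_toLp] with x h1 h2
  rw [h1, h2]

open ContinuousLinearMap in
/-- Mollification converges weakly in `L²`. -/
theorem tendsto_integral_inner_mollify {F : Type*} [NormedAddCommGroup F] [InnerProductSpace ℝ F]
    [CompleteSpace F] {p g : Eucl d → F} (hp : MemLp p 2 volume) (hg : MemLp g 2 volume)
    {φ : ℕ → ContDiffBump (0 : Eucl d)} (hφ : Tendsto (fun n => (φ n).rOut) atTop (𝓝 0)) :
    Tendsto (fun n => ∫ x, inner ℝ (p x)
      ((convolution ((φ n).normed volume) g (lsmul ℝ ℝ) volume : Eucl d → F) x)) atTop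
      (𝓝 (∫ x, inner ℝ (p x) (g x))) := by
  have : Fact ((2 : ℝ≥0∞) ≠ ⊤) := ⟨by simp⟩
  -- Translation is strongly continuous on L², so pairing p with the translates of g gives a
  -- continuous function of the shift. By Fubini the pairing of p with the mollified g is a
  -- mollification of this function at the origin.
  set A : Eucl d → ℝ := fun y => ∫ x, inner ℝ (p x) (g (x - y)) with hA
  have hAc : Continuous fun y => A (-y) := by
    have h1 : Continuous fun y : Eucl d =>
        inner ℝ (hp.toLp p) ((DomAddAct.mk y +ᵥ hg.toLp g : Lp F 2 volume)) := by
      refine continuous_const.inner ?_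
      exact (continuous_vadd (M := (Eucl d)ᵈᵃᵃ) (X := Lp F 2 (volume : Measure (Eucl d)))).comp
        (DomAddAct.continuous_mk.prodMk continuous_const)
    refine h1.congr fun y => ?_
    rw [MeasureTheory.L2.inner_def, DomAddAct.mk_vadd_toLp]
    refine integral_congr_ae ?_
    filter_upwards [hp.coeFn_toLp, (hg.comp_measurePreserving
      (measurePreserving_vadd y volume)).coeFn_toLp] with x h1 h2
    rw [h1, sub_neg_eq_add, add_comm x y]
    exact congrArg _ h2
  have hlim := ContDiffBump.convolution_tendsto_right_of_continuous (μ := volume) hφ hAc 0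
  rw [neg_zero] at hlim
  have hA0 : A 0 = ∫ x, inner ℝ (p x) (g x) := by simp [hA]
  rw [hA0] at hlim
  refine hlim.congr fun n => ?_
  set ρ := (φ n).normed volume with hρ
  have hρc : Continuous ρ := (φ n).continuous_normed
  have hρs : HasCompactSupport ρ := (φ n).hasCompactSupport_normed
  have hρ0 : ∀ y, 0 ≤ ρ y := (φ n).nonneg_normed
  have hρi : Integrable ρ := (φ n).integrable_normed
  have hm : AEStronglyMeasurable (fun z : Eucl d × Eucl d => g (z.1 - z.2))
      (volume.prod volume) :=
    hg.1.comp_quasiMeasurePreserving (quasiMeasurePreserving_sub_of_right_invariant volume volume)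
  have hint : Integrable
      (Function.uncurry fun x y : Eucl d => ρ y * inner ℝ (p x) (g (x - y)))
      (volume.prod volume) := by
    have i1 : Integrable (fun z : Eucl d × Eucl d => ‖p z.1‖ ^ 2 * ρ z.2)
        (volume.prod volume) := ((memLp_two_iff_integrable_sq_norm hp.1).1 hp).mul_prod hρi
    have i2 : Integrable (fun z : Eucl d × Eucl d => ρ z.2 * ‖g (z.1 - z.2)‖ ^ 2)
        (volume.prod volume) :=
      Integrable.convolution_integrand (lsmul ℝ ℝ) hρi
        ((memLp_two_iff_integrable_sq_norm hg.1).1 hg)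
    refine (i1.add i2).mono' ?_ (Eventually.of_forall fun z => ?_)
    · exact (hρc.measurable.comp measurable_snd).aestronglyMeasurable.mul
        (hp.1.comp_fst.inner hm)
    · simp only [Function.uncurry, Pi.add_apply]
      rw [norm_mul, Real.norm_of_nonneg (hρ0 _)]
      have h1 := norm_inner_le_norm (𝕜 := ℝ) (p z.1) (g (z.1 - z.2))
      have h2 : ‖p z.1‖ * ‖g (z.1 - z.2)‖ ≤ ‖p z.1‖ ^ 2 + ‖g (z.1 - z.2)‖ ^ 2 := by
        nlinarith [sq_nonneg (‖p z.1‖ - ‖g (z.1 - z.2)‖), sq_nonneg (‖p z.1‖),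
          sq_nonneg (‖g (z.1 - z.2)‖)]
      have h3 := mul_le_mul_of_nonneg_left (h1.trans h2) (hρ0 z.2)
      linarith
  have hswap := integral_integral_swap hint
  calc (convolution ρ (fun y => A (-y)) (lsmul ℝ ℝ) volume) 0
      = ∫ y, ∫ x, ρ y * inner ℝ (p x) (g (x - y)) := by
        rw [convolution_lsmul]
        congr 1
        ext y
        rw [zero_sub, neg_neg, smul_eq_mul, hA, ← integral_const_mul]
    _ = ∫ x, ∫ y, ρ y * inner ℝ (p x) (g (x - y)) := hswap.symm
    _ = _ := by
        congr 1
        ext x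
        rw [convolution_lsmul, ← integral_inner]
        · simp only [real_inner_smul_right]
        · have : LocallyIntegrable g volume := by
            rw [locallyIntegrable_iff]
            intro S hS
            have : IsFiniteMeasure (volume.restrict S) := ⟨by simpa using hS.measure_lt_top⟩
            exact (hg.restrict S).integrable one_le_two
          exact hρs.convolutionExists_left (lsmul ℝ ℝ) hρc this x

/-- A test function supported off the support of h makes the left side of the weak gradient identity
vanish, so g integrates to zero against all of them. -/
theorem HasWeakGradient.ae_eq_zero_compl_tsupport {h : Eucl d → ℝ} {g : Eucl d → Eucl d}
    (hw : HasWeakGradient h g) : ∀ᵐ x, x ∉ tsupport h → g x = 0 := by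
  refine (isClosed_tsupport h).isOpen_compl.ae_eq_zero_of_integral_contDiff_smul_eq_zero
    (hw.locallyIntegrable_grad.locallyIntegrableOn _) fun φ hφ hc hs => ?_
  have h1 := hw.integral_eq φ hφ hc
  have h2 : ∫ x, h x • gradient φ x = 0 := by
    rw [← integral_zero (Eucl d) (Eucl d)]
    congr 1
    ext1 x
    by_cases hx : x ∈ tsupport h
    · have : x ∉ tsupport φ := fun hx' => hs hx' hx
      have : gradient φ x = 0 := by
        rw [gradient, (image_eq_zero_of_notMem_tsupport
          (fun h => this (tsupport_fderiv_subset ℝ h)) : fderiv ℝ φ x = 0), map_zero]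
      rw [this, smul_zero]
    · rw [image_eq_zero_of_notMem_tsupport hx, zero_smul]
  rw [h2] at h1
  exact neg_eq_zero.1 h1.symm


open ContinuousLinearMap in
theorem fderiv_convolution_apply {f k : Eucl d → ℝ} (hf : LocallyIntegrable f volume)
    (hk : ContDiff ℝ ∞ k) (hc : HasCompactSupport k) (x v : Eucl d) :
    fderiv ℝ (convolution f k (lsmul ℝ ℝ) volume) x v =
      convolution f (fun a => fderiv ℝ k a v) (lsmul ℝ ℝ) volume x := by
  rw [(hc.hasFDerivAt_convolution_right (lsmul ℝ ℝ) hf (hk.of_le (by simp)) x).fderiv,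
    convolution_precompR_apply (lsmul ℝ ℝ) hf (hc.fderiv (𝕜 := ℝ))
      (hk.continuous_fderiv (by simp))]

-- The derivative falls on the kernel, and the reflected translate t ↦ ρ(x - t) is itself an
-- admissible test function for the weak gradient.
open ContinuousLinearMap in
theorem HasWeakGradient.gradient_mollify {h : Eucl d → ℝ} {g : Eucl d → Eucl d}
    (hw : HasWeakGradient h g) (φ : ContDiffBump (0 : Eucl d)) (x : Eucl d) :
    gradient (convolution h (φ.normed volume) (lsmul ℝ ℝ) volume) x =
      convolution (φ.normed volume) g (lsmul ℝ ℝ) volume x := by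
  set ρ := φ.normed volume with hρ
  have hρd : ContDiff ℝ ∞ ρ := φ.contDiff_normed
  have hρs : HasCompactSupport ρ := φ.hasCompactSupport_normed
  refine ext_inner_left ℝ fun v => ?_
  rw [inner_gradient_right, fderiv_convolution_apply hw.locallyIntegrable hρd hρs,
    convolution_lsmul, convolution_lsmul_swap, conj_trivial]
  have hφd : ContDiff ℝ ∞ fun t => ρ (x - t) := hρd.comp (contDiff_const.sub contDiff_id)
  have hφs : HasCompactSupport fun t => ρ (x - t) :=
    hρs.comp_homeomorph (Homeomorph.subLeft x)
  have h1 := hw.integral_fderiv_mul hφd hφs v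
  have h2 : ∀ t, fderiv ℝ (fun t => ρ (x - t)) t v = -fderiv ℝ ρ (x - t) v := by
    intro t
    have hd : HasFDerivAt (fun t => ρ (x - t))
        ((fderiv ℝ ρ (x - t)).comp (-ContinuousLinearMap.id ℝ (Eucl d))) t :=
      ((hρd.differentiable (by simp)) (x - t)).hasFDerivAt.comp t
        ((hasFDerivAt_id t).const_sub x)
    rw [hd.fderiv]
    simp
  simp only [h2, mul_neg, integral_neg, neg_inj] at h1
  simp only [smul_eq_mul]
  rw [h1, ← integral_inner]
  · simp only [real_inner_smul_right, real_inner_comm v]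
  · exact hw.locallyIntegrable_grad.integrable_smul_left_of_hasCompactSupport hφd.continuous hφs

open ContinuousLinearMap in
/-- An inequality tested against smooth functions extends to test functions in `H¹_V`. -/
theorem integral_nonpos_of_forall_contDiff {V : Eucl d → ℝ} (hV : Continuous V)
    {p : Eucl d → Eucl d} {κ : Eucl d → ℝ}
    (hp : ∀ r, MemLp p 2 (volume.restrict (Metric.closedBall 0 r)))
    (hκ : ∀ r, MemLp κ 2 (volume.restrict (Metric.closedBall 0 r)))
    (hs : ∀ h : Eucl d → ℝ, ContDiff ℝ ∞ h → HasCompactSupport h → (∀ x, 0 ≤ h x) →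
      ∫ x, (-(1 / 2 : ℝ) * inner ℝ (p x) (gradient h x) + κ x * h x) ≤ 0)
    {h : Eucl d → ℝ} (hh : MemSobolevV V 2 h) (hc : HasCompactSupport h) (h0 : ∀ x, 0 ≤ h x) :
    Integrable (fun x => -(1 / 2 : ℝ) * inner ℝ (p x) (weakGradient h x) + κ x * h x) ∧
      ∫ x, (-(1 / 2 : ℝ) * inner ℝ (p x) (weakGradient h x) + κ x * h x) ≤ 0 := by
  have hw := hasWeakGradient_weakGradient hh.exists_grad
  set g := weakGradient h with hg
  have hg0 := hw.ae_eq_zero_compl_tsupport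
  obtain ⟨r, hr⟩ := hc.isCompact.isBounded.subset_closedBall 0
  have hmeas : ∀ s : ℝ, MeasurableSet (Metric.closedBall (0 : Eucl d) s) :=
    fun s => measurableSet_closedBall
  have hhL : MemLp h 2 volume := by
    have := (memLp_indicator_iff_restrict (hmeas r)).2
      (MemLp.restrict_of_weightMeasure hh.memLp hV (isCompact_closedBall 0 r))
    refine this.ae_eq (Eventually.of_forall fun x => ?_)
    by_cases hx : x ∈ Metric.closedBall (0 : Eucl d) r
    · rw [Set.indicator_of_mem hx]
    · rw [Set.indicator_of_notMem hx, image_eq_zero_of_notMem_tsupport (fun h' => hx (hr h'))]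
  have hgL : MemLp g 2 volume := by
    have := (memLp_indicator_iff_restrict (hmeas r)).2
      (MemLp.restrict_of_weightMeasure hh.memLp_grad hV (isCompact_closedBall 0 r))
    refine this.ae_eq (hg0.mono fun x hx0 => ?_)
    by_cases hx : x ∈ Metric.closedBall (0 : Eucl d) r
    · rw [Set.indicator_of_mem hx]
    · rw [Set.indicator_of_notMem hx, hx0 (fun h' => hx (hr h'))]
  -- The mollifiers have radius at most 1, so all mollified test functions are supported in this
  -- ball. Cutting p and κ off outside it makes them globally square integrable without changing any
  -- integral.
  set B := Metric.closedBall (0 : Eucl d) (r + 1) with hB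
  have hpL : MemLp (B.indicator p) 2 volume :=
    (memLp_indicator_iff_restrict (hmeas _)).2 (hp (r + 1))
  have hκL : MemLp (B.indicator κ) 2 volume :=
    (memLp_indicator_iff_restrict (hmeas _)).2 (hκ (r + 1))
  have hi1 : Integrable fun x => inner ℝ (B.indicator p x) (g x) := hpL.integrable_inner_two hgL
  have hi2 : Integrable fun x => inner ℝ (B.indicator κ x) (h x) := hκL.integrable_inner_two hhL
  have heq : ∀ (q : Eucl d → Eucl d) (u : Eucl d → ℝ), (∀ᵐ x, x ∉ B → q x = 0) →
      (∀ x, x ∉ B → u x = 0) → (fun x => -(1 / 2 : ℝ) * inner ℝ (B.indicator p x) (q x) +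
        inner ℝ (B.indicator κ x) (u x)) =ᵐ[volume]
        fun x => -(1 / 2 : ℝ) * inner ℝ (p x) (q x) + κ x * u x := by
    intro q u hq hu
    filter_upwards [hq] with x hx
    by_cases hxB : x ∈ B
    · rw [Set.indicator_of_mem hxB, Set.indicator_of_mem hxB]
      simp [mul_comm]
    · rw [hx hxB, hu x hxB]
      simp
  have hrB : ∀ x, x ∉ B → x ∉ tsupport h := fun x hx h' =>
    hx (Metric.closedBall_subset_closedBall (by linarith) (hr h'))
  have heq0 := heq g h (hg0.mono fun x hx hxB => hx (hrB x hxB))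
    (fun x hx => image_eq_zero_of_notMem_tsupport (hrB x hx))
  refine ⟨((hi1.const_mul _).add hi2).congr heq0, ?_⟩
  let φ : ℕ → ContDiffBump (0 : Eucl d) := fun n =>
    ⟨1 / (2 * ((n : ℝ) + 1)), 1 / ((n : ℝ) + 1), by positivity, by
      apply one_div_lt_one_div_of_lt <;> linarith [Nat.cast_nonneg (α := ℝ) n]⟩
  have hφ : Tendsto (fun n => (φ n).rOut) atTop (𝓝 0) := tendsto_one_div_add_atTop_nhds_zero_nat
  have hφ1 : ∀ n, (φ n).rOut ≤ 1 := fun n => by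
    simp only [φ]
    rw [div_le_one (by positivity)]
    linarith [Nat.cast_nonneg (α := ℝ) n]
  have hlim := ((tendsto_integral_inner_mollify hpL hgL hφ).const_mul (-(1 / 2 : ℝ))).add
    (tendsto_integral_inner_mollify hκL hhL hφ)
  rw [← integral_congr_ae heq0, integral_add (hi1.const_mul _) hi2, integral_const_mul]
  refine le_of_tendsto' hlim fun n => ?_
  set ρ := (φ n).normed volume with hρ
  have hρd : ContDiff ℝ ∞ ρ := (φ n).contDiff_normed
  have hρs : HasCompactSupport ρ := (φ n).hasCompactSupport_normed
  have hρ0 : ∀ y, 0 ≤ ρ y := (φ n).nonneg_normed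
  set u : Eucl d → ℝ := convolution h ρ (lsmul ℝ ℝ) volume with hu
  have hu' : ∀ x, convolution ρ h (lsmul ℝ ℝ) volume x = u x := fun x => by
    rw [hu, convolution_lsmul_swap, convolution_lsmul]
    simp [mul_comm]
  have hud : ContDiff ℝ ∞ u := hρs.contDiff_convolution_right _ hw.locallyIntegrable hρd
  have hus : Function.support u ⊆ B := by
    refine (support_convolution_subset _).trans ?_
    rintro _ ⟨y, hy, z, hz, rfl⟩
    have h1 : ‖y‖ ≤ r := by simpa using hr (subset_tsupport _ hy)
    have h2 : ‖z‖ < 1 := by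
      have : z ∈ Metric.ball 0 (φ n).rOut := by
        rw [← (φ n).support_normed_eq (μ := volume)]; exact hz
      exact (by simpa using this : ‖z‖ < (φ n).rOut).trans_le (hφ1 n)
    rw [hB, mem_closedBall_zero_iff]
    exact (norm_add_le _ _).trans (by linarith)
  have husc : HasCompactSupport u := HasCompactSupport.of_support_subset_isCompact
    (isCompact_closedBall 0 (r + 1)) hus
  have hu0 : ∀ x, 0 ≤ u x := fun x => by
    rw [hu, convolution_lsmul]
    exact integral_nonneg fun t => mul_nonneg (h0 t) (hρ0 _)
  have hts : tsupport u ⊆ B := closure_minimal hus Metric.isClosed_closedBall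
  have hgu : ∀ x, gradient u x = convolution ρ g (lsmul ℝ ℝ) volume x :=
    fun x => hw.gradient_mollify (φ n) x
  have h1 := hs u hud husc hu0
  have hcong := heq (gradient u) u (Eventually.of_forall fun x hx => ?_) (fun x hx => ?_)
  · rw [← integral_congr_ae hcong] at h1
    simp only [← hgu, hu']
    have hgc : Continuous (gradient u) := hud.continuous_gradient (by simp)
    rw [integral_add, integral_const_mul] at h1
    · exact h1
    · exact (hpL.integrable_inner_two (hgc.memLp_of_hasCompactSupport husc.gradient)).const_mul _
    · exact hκL.integrable_inner_two (hud.continuous.memLp_of_hasCompactSupport husc)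
  · rw [gradient, (image_eq_zero_of_notMem_tsupport
      (fun h => hx (hts (tsupport_fderiv_subset ℝ h))) : fderiv ℝ u x = 0), map_zero]
  · exact image_eq_zero_of_notMem_tsupport fun h' => hx (hts h')

end Mollification

/-! ### Formulas for the Laplacian -/

section LaplacianFormulas

variable {d : ℕ}

theorem two_le_infty : (2 : WithTop ℕ∞) ≤ ((⊤ : ℕ∞) : WithTop ℕ∞) :=
  WithTop.coe_le_coe.2 (le_top : (2 : ℕ∞) ≤ ⊤)

theorem laplacian_eq_sum_fderiv {φ : Eucl d → ℝ} (hφ : ContDiff ℝ 2 φ) (x : Eucl d) :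
    Laplacian.laplacian φ x = ∑ i, fderiv ℝ (fun y => fderiv ℝ φ y (EuclideanSpace.basisFun (Fin d) ℝ i)) x
      (EuclideanSpace.basisFun (Fin d) ℝ i) := by
  rw [InnerProductSpace.laplacian_eq_iteratedFDeriv_orthonormalBasis φ
    (EuclideanSpace.basisFun (Fin d) ℝ)]
  refine Finset.sum_congr rfl fun i _ => ?_
  have hd : DifferentiableAt ℝ (fderiv ℝ φ) x :=
    (hφ.fderiv_right (m := 1) (by norm_num)).differentiable (by norm_num) x
  rw [iteratedFDeriv_two_apply, fderiv_clm_apply hd (differentiableAt_const _)]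
  simp

/-- Each partial derivative of h is again a test function, so the weak gradient identity applies
coordinate by coordinate. -/
theorem HasWeakGradient.integral_inner_gradient {f : Eucl d → ℝ} {g : Eucl d → Eucl d}
    (hw : HasWeakGradient f g) {h : Eucl d → ℝ} (hh : ContDiff ℝ ∞ h) (hc : HasCompactSupport h) :
    ∫ x, inner ℝ (g x) (gradient h x) = -∫ x, f x * Laplacian.laplacian h x := by
  set e := EuclideanSpace.basisFun (Fin d) ℝ with he
  have hd : ∀ i, ContDiff ℝ ∞ fun y => fderiv ℝ h y (e i) := fun i =>
    (hh.fderiv_right (m := ∞) (by simp)).clm_apply contDiff_const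
  have hcs : ∀ i, HasCompactSupport fun y => fderiv ℝ h y (e i) := fun i =>
    hc.fderiv_apply (𝕜 := ℝ) (e i)
  have h1 : ∀ x, inner ℝ (g x) (gradient h x) =
      ∑ i, fderiv ℝ h x (e i) * inner ℝ (g x) (e i) := by
    intro x
    rw [← OrthonormalBasis.sum_inner_mul_inner e]
    refine Finset.sum_congr rfl fun i _ => ?_
    rw [inner_gradient_right, conj_trivial, mul_comm]
  have h2 : ∀ x, f x * Laplacian.laplacian h x =
      ∑ i, f x * fderiv ℝ (fun y => fderiv ℝ h y (e i)) x (e i) := by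
    intro x
    rw [laplacian_eq_sum_fderiv (hh.of_le two_le_infty), Finset.mul_sum]
  simp only [h1, h2]
  rw [integral_finsetSum, integral_finsetSum, ← Finset.sum_neg_distrib]
  · refine Finset.sum_congr rfl fun i _ => ?_
    rw [hw.integral_fderiv_mul (hd i) (hcs i), neg_neg]
  · intro i _
    exact hw.locallyIntegrable.integrable_smul_right_of_hasCompactSupport
      (((hd i).continuous_fderiv (by simp)).clm_apply continuous_const)
      ((hcs i).fderiv_apply (𝕜 := ℝ) (e i))
  · intro i _
    have hl : LocallyIntegrable (fun x => inner ℝ (g x) (e i)) volume := by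
      intro x
      obtain ⟨s, hs, hi⟩ := hw.locallyIntegrable_grad x
      exact ⟨s, hs, hi.inner_const (e i)⟩
    exact hl.integrable_smul_left_of_hasCompactSupport (hd i).continuous (hcs i)

/-- The Laplacian of a radial function. -/
theorem laplacian_comp_norm_sq {η η' η'' : ℝ → ℝ} (h1 : ∀ s, HasDerivAt η (η' s) s)
    (h2 : ∀ s, HasDerivAt η' (η'' s) s) (hη : ContDiff ℝ ∞ η) (a : ℝ) (x z : Eucl d) :
    Laplacian.laplacian (fun z => η (a * ‖z - x‖ ^ 2)) z =
      4 * a ^ 2 * η'' (a * ‖z - x‖ ^ 2) * ‖z - x‖ ^ 2 + 2 * a * d * η' (a * ‖z - x‖ ^ 2) := by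
  have hn : ∀ z v : Eucl d, HasFDerivAt (fun z : Eucl d => a * ‖z - x‖ ^ 2)
      ((2 * a) • innerSL ℝ (z - x)) z := by
    intro z v
    have := ((hasFDerivAt_id z).sub_const x).norm_sq.const_mul a
    refine this.congr_fderiv ?_
    ext w
    simp
    ring
  have hd1 : ∀ z v : Eucl d, fderiv ℝ (fun z => η (a * ‖z - x‖ ^ 2)) z v =
      η' (a * ‖z - x‖ ^ 2) * (2 * a * inner ℝ (z - x) v) := by
    intro z v
    have h3 : HasFDerivAt (fun z => η (a * ‖z - x‖ ^ 2)) _ z :=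
      (h1 _).comp_hasFDerivAt z (hn z v)
    rw [h3.fderiv]
    simp [inner_sub_left]
  have hd2 : ∀ z v : Eucl d, fderiv ℝ (fun y => fderiv ℝ (fun z => η (a * ‖z - x‖ ^ 2)) y v) z v =
      4 * a ^ 2 * η'' (a * ‖z - x‖ ^ 2) * (inner ℝ (z - x) v) ^ 2 +
        2 * a * η' (a * ‖z - x‖ ^ 2) * ‖v‖ ^ 2 := by
    intro z v
    simp only [hd1]
    have hin : HasFDerivAt (fun z : Eucl d => 2 * a * inner ℝ (z - x) v)
        ((2 * a) • innerSL ℝ v) z := by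
      have := (((hasFDerivAt_id z).sub_const x).inner ℝ (hasFDerivAt_const v z)).const_mul (2 * a)
      refine this.congr_fderiv ?_
      ext w
      simp [real_inner_comm]
    have h3 : HasFDerivAt (fun y => η' (a * ‖y - x‖ ^ 2) * (2 * a * inner ℝ (y - x) v)) _ z :=
      ((h2 _).comp_hasFDerivAt z (hn z v)).mul hin
    rw [h3.fderiv]
    simp only [Function.comp_apply, add_apply, smul_apply,
      innerSL_apply_apply, smul_eq_mul, real_inner_self_eq_norm_sq]
    ring
  rw [laplacian_eq_sum_fderiv]
  · simp only [hd2]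
    rw [Finset.sum_add_distrib, ← Finset.mul_sum, ← Finset.mul_sum]
    have h3 := OrthonormalBasis.sum_sq_inner_left (EuclideanSpace.basisFun (Fin d) ℝ) (z - x)
    rw [h3]
    simp
    ring
  · exact (hη.comp (contDiff_const.mul ((contDiff_id.sub contDiff_const).norm_sq ℝ))).of_le
      two_le_infty

end LaplacianFormulas

/-! ### A radial kernel whose scale derivative is a Laplacian -/

section RadialKernel

/-- A smooth profile on the half line, positive on `[0, 1)` and zero afterwards. -/
noncomputable def bumpProfile (s : ℝ) : ℝ := expNegInvGlue (1 - s)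

/-- The primitive of `-bumpProfile` that vanishes on `[1, ∞)`. -/
noncomputable def bumpPrimitive (s : ℝ) : ℝ := ∫ t in s..1, bumpProfile t

theorem contDiff_bumpProfile : ContDiff ℝ ∞ bumpProfile :=
  expNegInvGlue.contDiff.comp (contDiff_const.sub contDiff_id)

theorem bumpProfile_nonneg (s : ℝ) : 0 ≤ bumpProfile s := expNegInvGlue.nonneg _

theorem bumpProfile_eq_zero {s : ℝ} (hs : 1 ≤ s) : bumpProfile s = 0 :=
  expNegInvGlue.zero_of_nonpos (by linarith)

theorem hasDerivAt_bumpProfile (s : ℝ) : HasDerivAt bumpProfile (deriv bumpProfile s) s :=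
  (contDiff_bumpProfile.differentiable (by simp) s).hasDerivAt

/-- The endpoint s = 1 is included because the profile has a minimum there. -/
theorem deriv_bumpProfile_eq_zero {s : ℝ} (hs : 1 ≤ s) : deriv bumpProfile s = 0 := by
  refine IsLocalMin.deriv_eq_zero (Eventually.of_forall fun t => ?_)
  rw [bumpProfile_eq_zero hs]
  exact bumpProfile_nonneg t

theorem hasDerivAt_bumpPrimitive (s : ℝ) : HasDerivAt bumpPrimitive (-bumpProfile s) s :=
  intervalIntegral.integral_hasDerivAt_left
    (contDiff_bumpProfile.continuous.intervalIntegrable _ _)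
    (contDiff_bumpProfile.continuous.stronglyMeasurableAtFilter _ _)
    contDiff_bumpProfile.continuous.continuousAt

theorem contDiff_bumpPrimitive : ContDiff ℝ ∞ bumpPrimitive := by
  rw [contDiff_infty_iff_deriv]
  refine ⟨fun s => (hasDerivAt_bumpPrimitive s).differentiableAt, ?_⟩
  rw [show deriv bumpPrimitive = fun s => -bumpProfile s from
    funext fun s => (hasDerivAt_bumpPrimitive s).deriv]
  exact contDiff_bumpProfile.neg

theorem bumpPrimitive_eq_zero {s : ℝ} (hs : 1 ≤ s) : bumpPrimitive s = 0 := by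
  rw [bumpPrimitive, intervalIntegral.integral_symm, neg_eq_zero]
  refine (intervalIntegral.integral_congr (g := fun _ => (0 : ℝ)) fun t ht => ?_).trans (by simp)
  rw [Set.uIcc_of_le hs] at ht
  exact bumpProfile_eq_zero ht.1

theorem bumpPrimitive_nonneg (s : ℝ) : 0 ≤ bumpPrimitive s := by
  rcases le_total s 1 with h | h
  · exact intervalIntegral.integral_nonneg h fun t _ => bumpProfile_nonneg t
  · rw [bumpPrimitive_eq_zero h]

variable {d : ℕ}

/-- The rescaled radial bump `τ^d r(τ² |ξ|²)`. -/
noncomputable def radialKernel (τ : ℝ) (ξ : Eucl d) : ℝ := τ ^ d * bumpProfile (τ ^ 2 * ‖ξ‖ ^ 2)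

theorem radialKernel_nonneg {τ : ℝ} (hτ : 0 ≤ τ) (ξ : Eucl d) : 0 ≤ radialKernel τ ξ :=
  mul_nonneg (by positivity) (bumpProfile_nonneg _)

theorem hasCompactSupport_comp_norm_sq {η : ℝ → ℝ} (hη : ∀ s, 1 ≤ s → η s = 0) {τ : ℝ}
    (hτ : 0 < τ) (x : Eucl d) : HasCompactSupport fun z : Eucl d => η (τ ^ 2 * ‖z - x‖ ^ 2) := by
  refine HasCompactSupport.intro (isCompact_closedBall x (1 / τ)) fun z hz => hη _ ?_
  have h1 : 1 / τ < ‖z - x‖ := by simpa [dist_eq_norm] using hz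
  rw [div_lt_iff₀ hτ] at h1
  nlinarith

theorem contDiff_comp_norm_sq {η : ℝ → ℝ} (hη : ContDiff ℝ ∞ η) (a : ℝ) (x : Eucl d) :
    ContDiff ℝ ∞ fun z : Eucl d => η (a * ‖z - x‖ ^ 2) :=
  hη.comp (contDiff_const.mul ((contDiff_id.sub contDiff_const).norm_sq ℝ))

theorem contDiff_radialKernel (τ : ℝ) : ContDiff ℝ ∞ (radialKernel τ : Eucl d → ℝ) := by
  have := contDiff_comp_norm_sq (d := d) contDiff_bumpProfile (τ ^ 2) 0
  simp only [sub_zero] at this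
  exact contDiff_const.mul this

theorem hasCompactSupport_radialKernel {τ : ℝ} (hτ : 0 < τ) :
    HasCompactSupport (radialKernel τ : Eucl d → ℝ) := by
  have := hasCompactSupport_comp_norm_sq (d := d) (fun s hs => bumpProfile_eq_zero hs) hτ 0
  simp only [sub_zero] at this
  exact this.mul_left

theorem radialKernel_eq_zero {τ : ℝ} {ξ : Eucl d} (h : 1 ≤ τ * ‖ξ‖) : radialKernel τ ξ = 0 := by
  rw [radialKernel, bumpProfile_eq_zero, mul_zero]
  nlinarith

theorem bumpProfile_le_one (s : ℝ) : bumpProfile s ≤ 1 := by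
  rw [bumpProfile, expNegInvGlue]
  split_ifs with h
  · exact zero_le_one
  · push Not at h
    exact Real.exp_le_one_iff.2 (neg_nonpos.2 (inv_nonneg.2 h.le))

theorem exists_abs_deriv_bumpProfile_le : ∃ B, 0 ≤ B ∧ ∀ s, 0 ≤ s → |deriv bumpProfile s| ≤ B := by
  obtain ⟨B, hB⟩ := (isCompact_Icc (a := (0 : ℝ)) (b := 1)).exists_bound_of_continuousOn
    (contDiff_bumpProfile.continuous_deriv (by simp)).continuousOn
  refine ⟨max B 0, le_max_right _ _, fun s hs => ?_⟩
  rcases le_total s 1 with h | h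
  · exact (hB s ⟨hs, h⟩).trans (le_max_left _ _)
  · rw [deriv_bumpProfile_eq_zero h]
    simp

/-- The scale derivative of the radial kernel is minus a Laplacian. -/
theorem hasDerivAt_radialKernel {τ : ℝ} (hτ : 0 < τ) (x z : Eucl d) :
    HasDerivAt (fun τ => radialKernel τ (x - z)) (-(τ ^ d / (2 * τ ^ 3)) *
      Laplacian.laplacian (fun z => bumpPrimitive (τ ^ 2 * ‖z - x‖ ^ 2)) z) τ := by
  -- With r the profile, s = τ²|x - z|², and a potential whose derivative is -r, both sides equal
  -- τ^{d-1}(d r(s) + 2 s r'(s)).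
  rw [laplacian_comp_norm_sq (η'' := fun s => -deriv bumpProfile s) hasDerivAt_bumpPrimitive
    (fun s => (hasDerivAt_bumpProfile s).neg) contDiff_bumpPrimitive, norm_sub_rev]
  have h1 : HasDerivAt (fun τ : ℝ => τ ^ 2 * ‖z - x‖ ^ 2) (2 * τ * ‖z - x‖ ^ 2) τ := by
    simpa using (hasDerivAt_pow 2 τ).mul_const (‖z - x‖ ^ 2)
  have h2 := (hasDerivAt_pow d τ).mul ((hasDerivAt_bumpProfile (τ ^ 2 * ‖z - x‖ ^ 2)).comp τ h1)
  simp only [radialKernel, norm_sub_rev x z]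
  refine h2.congr_deriv ?_
  -- The exponent is a truncated subtraction; for d = 0 the factor d makes both sides vanish.
  have h3 : (d : ℝ) * τ ^ (d - 1) = d * τ ^ d / τ := by
    rcases Nat.eq_zero_or_pos d with h | h
    · simp [h]
    · obtain ⟨m, rfl⟩ : ∃ m, d = m + 1 := ⟨d - 1, by omega⟩
      rw [Nat.add_sub_cancel, pow_succ]
      field_simp
  rw [h3]
  simp only [Function.comp_apply]
  field_simp
  ring

end RadialKernel

/-! ### Mean value inequality and lower semicontinuous representatives -/

section MeanValue

variable {d : ℕ} {f : Eucl d → ℝ}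

/-- The radial average of `f` around `x` at scale `1 / τ`. -/
noncomputable def radialAverage (f : Eucl d → ℝ) (τ : ℝ) (x : Eucl d) : ℝ :=
  ∫ y, f y * radialKernel τ (x - y)

/-- The total mass of the radial kernel. -/
noncomputable def radialMass (d : ℕ) : ℝ := ∫ ξ : Eucl d, bumpProfile (‖ξ‖ ^ 2)

/-- The integral of the radial potential. -/
noncomputable def potentialMass (d : ℕ) : ℝ := ∫ ξ : Eucl d, bumpPrimitive (‖ξ‖ ^ 2)

theorem integrable_comp_norm_sq {η : ℝ → ℝ} (hη : Continuous η) (h0 : ∀ s, 1 ≤ s → η s = 0) {τ : ℝ}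
    (hτ : 0 < τ) (x : Eucl d) : Integrable fun z : Eucl d => η (τ ^ 2 * ‖z - x‖ ^ 2) :=
  Continuous.integrable_of_hasCompactSupport (by fun_prop) (hasCompactSupport_comp_norm_sq h0 hτ x)

theorem integral_comp_norm_sq (η : ℝ → ℝ) {τ : ℝ} (hτ : 0 < τ) (x : Eucl d) :
    τ ^ d * ∫ z : Eucl d, η (τ ^ 2 * ‖z - x‖ ^ 2) = ∫ ξ : Eucl d, η (‖ξ‖ ^ 2) := by
  rw [integral_sub_right_eq_self (fun z : Eucl d => η (τ ^ 2 * ‖z‖ ^ 2)) x]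
  have h := Measure.integral_comp_smul (volume : Measure (Eucl d)) (fun z => η (‖z‖ ^ 2)) τ
  simp only [norm_smul, Real.norm_of_nonneg hτ.le, mul_pow, finrank_euclideanSpace,
    Fintype.card_fin, smul_eq_mul] at h
  rw [h, abs_of_nonneg (by positivity), ← mul_assoc, mul_inv_cancel₀ (by positivity), one_mul]

theorem radialMass_pos : 0 < radialMass d := by
  have hc : Continuous fun ξ : Eucl d => bumpProfile (‖ξ‖ ^ 2) :=
    contDiff_bumpProfile.continuous.comp (by fun_prop)
  have hi : Integrable fun ξ : Eucl d => bumpProfile (‖ξ‖ ^ 2) := by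
    simpa using integrable_comp_norm_sq (d := d) contDiff_bumpProfile.continuous
      (fun s hs => bumpProfile_eq_zero hs) one_pos 0
  refine hc.integral_pos_of_hasCompactSupport_nonneg_nonzero ?_ (fun ξ => bumpProfile_nonneg _)
    (x := 0) ?_
  · simpa using hasCompactSupport_comp_norm_sq (d := d) (fun s hs => bumpProfile_eq_zero hs) one_pos 0
  · simp only [norm_zero, bumpProfile]
    exact (expNegInvGlue.pos_of_pos (by norm_num)).ne'

theorem potentialMass_nonneg : 0 ≤ potentialMass d :=
  integral_nonneg fun _ => bumpPrimitive_nonneg _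

theorem integral_radialKernel {τ : ℝ} (hτ : 0 < τ) (x : Eucl d) :
    ∫ y, radialKernel τ (x - y) = radialMass d := by
  simp only [radialKernel, norm_sub_rev x]
  rw [integral_const_mul, integral_comp_norm_sq _ hτ, radialMass]

theorem radialAverage_eq_convolution (f : Eucl d → ℝ) (τ : ℝ) (x : Eucl d) :
    radialAverage f τ x =
      convolution f (radialKernel τ) (ContinuousLinearMap.lsmul ℝ ℝ) volume x := by
  rw [convolution_lsmul]; rfl

theorem continuous_radialAverage (hf : LocallyIntegrable f volume) {τ : ℝ} (hτ : 0 < τ) :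
    Continuous (radialAverage f τ) := by
  rw [show radialAverage f τ = _ from funext (radialAverage_eq_convolution f τ)]
  exact (hasCompactSupport_radialKernel hτ).continuous_convolution_right _ hf
    (contDiff_radialKernel τ).continuous

/-- Differentiation under the integral: for scales between τ/2 and 2τ all kernels are supported in
the ball of radius 2/τ about x, so a constant times |f| on that ball dominates. -/
theorem hasDerivAt_radialAverage (hf : LocallyIntegrable f volume) {τ : ℝ} (hτ : 0 < τ)
    (x : Eucl d) : HasDerivAt (fun τ => radialAverage f τ x) (-(τ ^ d / (2 * τ ^ 3)) *
      ∫ z, f z * Laplacian.laplacian (fun z => bumpPrimitive (τ ^ 2 * ‖z - x‖ ^ 2)) z) τ := by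
  obtain ⟨B, hB0, hB⟩ := exists_abs_deriv_bumpProfile_le
  set F' : ℝ → Eucl d → ℝ := fun τ z => f z * (-(τ ^ d / (2 * τ ^ 3)) *
    Laplacian.laplacian (fun z => bumpPrimitive (τ ^ 2 * ‖z - x‖ ^ 2)) z) with hF'
  set D : ℝ := (2 * τ) ^ d / (2 * (τ / 2) ^ 3) * (4 * (2 * τ) ^ 2 * B + 2 * (2 * τ) ^ 2 * d)
  have hbd : ∀ σ ∈ Set.Ioo (τ / 2) (2 * τ), ∀ z, ‖F' σ z‖ ≤
      D * ‖(Metric.closedBall x (2 / τ)).indicator f z‖ := by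
    intro σ hσ z
    have hσ0 : 0 < σ := by linarith [hσ.1]
    simp only [hF']
    rw [laplacian_comp_norm_sq (η'' := fun s => -deriv bumpProfile s) hasDerivAt_bumpPrimitive
      (fun s => (hasDerivAt_bumpProfile s).neg) contDiff_bumpPrimitive]
    by_cases hz : σ * ‖z - x‖ < 1
    · have hzm : z ∈ Metric.closedBall x (2 / τ) := by
        rw [Metric.mem_closedBall, dist_eq_norm, le_div_iff₀ hτ]
        nlinarith [norm_nonneg (z - x), hσ.1]
      rw [Set.indicator_of_mem hzm, norm_mul, mul_comm]
      gcongr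
      rw [norm_mul, norm_neg, Real.norm_of_nonneg (by positivity)]
      have hs : σ ^ 2 * ‖z - x‖ ^ 2 ≤ 1 := by
        rw [← mul_pow]; exact pow_le_one₀ (by positivity) hz.le
      refine mul_le_mul ?_ ?_ (norm_nonneg _) (by positivity)
      · gcongr
        · exact hσ.2.le
        · exact hσ.1.le
      · refine (norm_add_le _ _).trans (add_le_add ?_ ?_)
        · have e : 4 * (σ ^ 2) ^ 2 * -deriv bumpProfile (σ ^ 2 * ‖z - x‖ ^ 2) * ‖z - x‖ ^ 2 =
            4 * σ ^ 2 * (σ ^ 2 * ‖z - x‖ ^ 2) * -deriv bumpProfile (σ ^ 2 * ‖z - x‖ ^ 2) := by ring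
          rw [e, norm_mul, norm_neg, Real.norm_of_nonneg (by positivity)]
          refine mul_le_mul ?_ (hB _ (by positivity)) (norm_nonneg _) (by positivity)
          calc 4 * σ ^ 2 * (σ ^ 2 * ‖z - x‖ ^ 2) ≤ 4 * σ ^ 2 * 1 := by gcongr
            _ ≤ 4 * (2 * τ) ^ 2 := by
              rw [mul_one]
              gcongr
              exact hσ.2.le
        · rw [norm_mul, norm_neg, Real.norm_of_nonneg (by positivity),
            Real.norm_of_nonneg (bumpProfile_nonneg _)]
          calc 2 * σ ^ 2 * d * bumpProfile _ ≤ 2 * σ ^ 2 * d * 1 := by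
                gcongr
                exact bumpProfile_le_one _
            _ ≤ 2 * (2 * τ) ^ 2 * d := by
              rw [mul_one]
              gcongr
              exact hσ.2.le
    · have hs : 1 ≤ σ ^ 2 * ‖z - x‖ ^ 2 := by
        rw [← mul_pow]; exact one_le_pow₀ (not_lt.1 hz)
      rw [deriv_bumpProfile_eq_zero hs, bumpProfile_eq_zero hs]
      simp only [neg_zero, mul_zero, zero_mul, add_zero, norm_zero]
      positivity
  have hk : ∀ σ > 0, Continuous fun z => radialKernel σ (x - z) := fun σ _ =>
    (contDiff_radialKernel σ).continuous.comp (by fun_prop)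
  have h := hasDerivAt_integral_of_dominated_loc_of_deriv_le (μ := (volume : Measure (Eucl d)))
    (F := fun τ z => f z * radialKernel τ (x - z)) (F' := F') (x₀ := τ)
    (bound := fun z => D * ‖(Metric.closedBall x (2 / τ)).indicator f z‖)
    (Ioo_mem_nhds (show τ / 2 < τ by linarith) (show τ < 2 * τ by linarith)) ?_ ?_ ?_
    (Eventually.of_forall fun z σ hσ => hbd σ hσ z) ?_
    (Eventually.of_forall fun z σ hσ => (hasDerivAt_radialKernel (by linarith [hσ.1]) x z).const_mul _)
  · refine h.2.congr_deriv ?_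
    simp only [hF']
    rw [← integral_const_mul]
    congr 1
    ext z
    ring
  · filter_upwards [lt_mem_nhds hτ] with σ hσ
    exact hf.aestronglyMeasurable.mul (hk σ hσ).aestronglyMeasurable
  · exact hf.integrable_smul_right_of_hasCompactSupport (hk τ hτ)
      ((hasCompactSupport_radialKernel hτ).comp_homeomorph (Homeomorph.subLeft x))
  · refine hf.aestronglyMeasurable.mul (Continuous.aestronglyMeasurable ?_)
    have : ∀ z, Laplacian.laplacian (fun z => bumpPrimitive (τ ^ 2 * ‖z - x‖ ^ 2)) z = _ :=
      laplacian_comp_norm_sq (η'' := fun s => -deriv bumpProfile s) hasDerivAt_bumpPrimitive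
      (fun s => (hasDerivAt_bumpProfile s).neg) contDiff_bumpPrimitive _ _
    simp only [this]
    have c1 := contDiff_bumpProfile.continuous
    have c2 : Continuous (deriv bumpProfile) := contDiff_bumpProfile.continuous_deriv (by simp)
    fun_prop
  · refine Integrable.const_mul (Integrable.norm ?_) _
    exact (hf.integrableOn_isCompact (isCompact_closedBall _ _)).integrable_indicator
      measurableSet_closedBall

/-- `f` satisfies `Δf / 2 ≤ A (1 + |x|)` in the sense of distributions. -/
def HasLaplacianBound (f : Eucl d → ℝ) (A : ℝ) : Prop :=
  ∀ h : Eucl d → ℝ, ContDiff ℝ ∞ h → HasCompactSupport h → (∀ x, 0 ≤ h x) →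
    (1 / 2 : ℝ) * ∫ x, f x * Laplacian.laplacian h x ≤ ∫ x, A * (‖x‖ + 1) * h x

/-- The τ-derivative of the average is a negative multiple of the pairing of f with the Laplacian of
a nonnegative test function. The Laplacian bound therefore keeps it above -b/τ³, and the correction
term contributes exactly b/τ³. For τ ≥ 1 the test function lives in the unit ball about x, where ‖z‖
+ 1 ≤ ‖x‖ + 2. -/
theorem monotoneOn_radialAverage (hf : LocallyIntegrable f volume) {A : ℝ} (hA : 0 ≤ A)
    (h : HasLaplacianBound f A) (x : Eucl d) :
    MonotoneOn (fun τ => radialAverage f τ x - A * (‖x‖ + 2) * potentialMass d / (2 * τ ^ 2))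
      (Set.Ici 1) := by
  set b := A * (‖x‖ + 2) * potentialMass d with hb
  have hder : ∀ τ : ℝ, 0 < τ → HasDerivAt (fun τ => radialAverage f τ x - b / (2 * τ ^ 2))
      (-(τ ^ d / (2 * τ ^ 3)) * (∫ z, f z *
        Laplacian.laplacian (fun z => bumpPrimitive (τ ^ 2 * ‖z - x‖ ^ 2)) z) + b / τ ^ 3) τ := by
    intro τ hτ
    have h1 : HasDerivAt (fun τ : ℝ => b / (2 * τ ^ 2)) (-(b / τ ^ 3)) τ := by
      have := ((hasDerivAt_pow 2 τ).const_mul 2).fun_inv (by positivity) |>.const_mul b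
      simp only [← div_eq_mul_inv] at this
      refine this.congr_deriv ?_
      simp only [Nat.cast_ofNat, Nat.add_one_sub_one, pow_one]
      field_simp
    refine ((hasDerivAt_radialAverage hf hτ x).sub h1).congr_deriv ?_
    ring
  refine monotoneOn_of_deriv_nonneg (convex_Ici 1) ?_ ?_ ?_
  · exact fun τ hτ => (hder τ (by linarith [Set.mem_Ici.1 hτ])).continuousAt.continuousWithinAt
  · rw [interior_Ici]
    exact fun τ hτ =>
      (hder τ (by linarith [Set.mem_Ioi.1 hτ])).differentiableAt.differentiableWithinAt
  · rw [interior_Ici]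
    intro τ hτ
    have hτ1 : 1 < τ := hτ
    have hτ0 : 0 < τ := by linarith
    rw [(hder τ hτ0).deriv]
    have h1 := h _ (contDiff_comp_norm_sq contDiff_bumpPrimitive (τ ^ 2) x)
      (hasCompactSupport_comp_norm_sq (fun s hs => bumpPrimitive_eq_zero hs) hτ0 x)
      (fun z => bumpPrimitive_nonneg _)
    have h2 : ∫ z, A * (‖z‖ + 1) * bumpPrimitive (τ ^ 2 * ‖z - x‖ ^ 2) ≤
        A * (‖x‖ + 2) * ∫ z, bumpPrimitive (τ ^ 2 * ‖z - x‖ ^ 2) := by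
      rw [← integral_const_mul]
      have c1 := contDiff_bumpPrimitive.continuous
      refine integral_mono ?_ ((integrable_comp_norm_sq c1
        (fun s hs => bumpPrimitive_eq_zero hs) hτ0 x).const_mul _) fun z => ?_
      · exact Continuous.integrable_of_hasCompactSupport (by fun_prop)
          (hasCompactSupport_comp_norm_sq (fun s hs => bumpPrimitive_eq_zero hs) hτ0 x).mul_left
      · by_cases hz : τ * ‖z - x‖ < 1
        · have : ‖z - x‖ ≤ 1 := by nlinarith [norm_nonneg (z - x)]
          have h3 := norm_sub_norm_le z x
          have h4 := bumpPrimitive_nonneg (τ ^ 2 * ‖z - x‖ ^ 2)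
          simp only
          exact mul_le_mul_of_nonneg_right
            (mul_le_mul_of_nonneg_left (by linarith) hA) h4
        · have hs : 1 ≤ τ ^ 2 * ‖z - x‖ ^ 2 := by
            rw [← mul_pow]; exact one_le_pow₀ (not_lt.1 hz)
          simp [bumpPrimitive_eq_zero hs]
    have h3 : τ ^ d * ∫ z, bumpPrimitive (τ ^ 2 * ‖z - x‖ ^ 2) = potentialMass d :=
      integral_comp_norm_sq _ hτ0 x
    have h4 : τ ^ d * (1 / 2 * ∫ z, f z *
        Laplacian.laplacian (fun z => bumpPrimitive (τ ^ 2 * ‖z - x‖ ^ 2)) z) ≤ b := by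
      calc _ ≤ τ ^ d * (A * (‖x‖ + 2) * ∫ z, bumpPrimitive (τ ^ 2 * ‖z - x‖ ^ 2)) := by
            exact mul_le_mul_of_nonneg_left (h1.trans h2) (by positivity)
        _ = b := by rw [hb, ← h3]; ring
    have h5 : -(τ ^ d / (2 * τ ^ 3)) * (∫ z, f z *
        Laplacian.laplacian (fun z => bumpPrimitive (τ ^ 2 * ‖z - x‖ ^ 2)) z) + b / τ ^ 3 =
        (b - τ ^ d * (1 / 2 * ∫ z, f z *
        Laplacian.laplacian (fun z => bumpPrimitive (τ ^ 2 * ‖z - x‖ ^ 2)) z)) / τ ^ 3 := by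
      field_simp
      ring
    rw [h5]
    exact div_nonneg (sub_nonneg.2 h4) (by positivity)

/-- Lebesgue differentiation: the kernel at scale τ = n + 1 is bounded by a constant multiple of the
uniform density on the ball of radius 1/τ. -/
theorem ae_tendsto_radialAverage (hf : LocallyIntegrable f volume) :
    ∀ᵐ x, Tendsto (fun n : ℕ => radialAverage f (n + 1) x) atTop (𝓝 (radialMass d * f x)) := by
  filter_upwards [(Besicovitch.vitaliFamily volume).ae_tendsto_average_norm_sub hf] with x h₀
  have hr : Tendsto (fun n : ℕ => 1 / ((n : ℝ) + 1)) atTop (𝓝[>] 0) :=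
    tendsto_nhdsWithin_iff.2 ⟨tendsto_one_div_add_atTop_nhds_zero_nat,
      Eventually.of_forall fun n => by simp only [Set.mem_Ioi]; positivity⟩
  have h1 := (h₀.comp (Besicovitch.tendsto_filterAt volume x)).comp hr
  have hm := radialMass_pos (d := d)
  set v := volume.real (Metric.closedBall (0 : Eucl d) 1) with hv
  have h2 := tendsto_integral_smul_of_tendsto_average_norm_sub
    (g := fun (n : ℕ) y => (radialMass d)⁻¹ * radialKernel ((n : ℝ) + 1) (x - y))
    ((radialMass d)⁻¹ * v) h1 ?_ ?_ ?_ ?_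
  · have := h2.const_mul (radialMass d)
    refine this.congr fun n => ?_
    rw [← integral_const_mul, radialAverage]
    congr 1
    ext y
    rw [smul_eq_mul]
    field_simp
  · exact Eventually.of_forall fun n => hf.integrableOn_isCompact (isCompact_closedBall _ _)
  · refine tendsto_const_nhds.congr fun n => ?_
    rw [integral_const_mul, integral_radialKernel (by positivity), inv_mul_cancel₀ hm.ne']
  · refine Eventually.of_forall fun n y hy => ?_
    change y ∈ Metric.closedBall x (1 / ((n : ℝ) + 1))
    rw [Metric.mem_closedBall]
    by_contra! hlt
    refine hy ?_
    simp only
    rw [radialKernel_eq_zero, mul_zero]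
    rw [dist_comm, dist_eq_norm, div_lt_iff₀ (by positivity)] at hlt
    linarith
  · refine Eventually.of_forall fun n y => ?_
    have hn : (0 : ℝ) < n + 1 := by positivity
    change _ ≤ _ / volume.real (Metric.closedBall x (1 / ((n : ℝ) + 1)))
    rw [Measure.real, Measure.addHaar_closedBall' _ _ (by positivity),
      ENNReal.toReal_mul, ENNReal.toReal_ofReal (by positivity), ← Measure.real, ← hv,
      finrank_euclideanSpace, Fintype.card_fin]
    have hvpos : 0 < v := by
      rw [hv, Measure.real, ENNReal.toReal_pos_iff]
      exact ⟨Metric.measure_closedBall_pos _ _ one_pos, measure_closedBall_lt_top⟩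
    rw [abs_of_nonneg (mul_nonneg (by positivity) (radialKernel_nonneg hn.le _)), one_div, inv_pow,
      mul_div_mul_right _ _ hvpos.ne', div_inv_eq_mul]
    gcongr
    rw [radialKernel]
    exact mul_le_of_le_one_right (by positivity) (bumpProfile_le_one _)

theorem tendsto_radialAverage (hf : Continuous f) (x : Eucl d) :
    Tendsto (fun n : ℕ => radialAverage f (n + 1) x) atTop (𝓝 (radialMass d * f x)) := by
  have hm := radialMass_pos (d := d)
  rw [Metric.tendsto_atTop]
  intro ε hε
  obtain ⟨δ, hδ, hfd⟩ := Metric.continuous_iff.1 hf x (ε / (2 * radialMass d)) (by positivity)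
  obtain ⟨N, hN⟩ := exists_nat_gt (1 / δ)
  refine ⟨N, fun n hn => ?_⟩
  have hn1 : (0 : ℝ) < n + 1 := by positivity
  have hnN : 1 / δ < n + 1 := hN.trans_le (by exact_mod_cast hn.trans (Nat.le_succ n))
  rw [dist_eq_norm, ← integral_radialKernel hn1 x, radialAverage, ← integral_mul_const]
  have hk : Integrable fun y => radialKernel ((n : ℝ) + 1) (x - y) := by
    refine Continuous.integrable_of_hasCompactSupport
      ((contDiff_radialKernel _).continuous.comp (by fun_prop))
      ((hasCompactSupport_radialKernel hn1).comp_homeomorph (Homeomorph.subLeft x))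
  rw [← integral_sub]
  · refine (norm_integral_le_of_norm_le (hk.mul_const (ε / (2 * radialMass d)))
      (Eventually.of_forall fun y => ?_)).trans_lt ?_
    · rw [mul_comm (f y), ← mul_sub, norm_mul, Real.norm_of_nonneg (radialKernel_nonneg hn1.le _)]
      by_cases hy : 1 ≤ ((n : ℝ) + 1) * ‖x - y‖
      · rw [radialKernel_eq_zero hy]; simp
      · have : dist y x < δ := by
          rw [dist_comm, dist_eq_norm]
          rw [div_lt_iff₀ hδ] at hnN
          nlinarith
        exact mul_le_mul_of_nonneg_left (hfd y this).le (radialKernel_nonneg hn1.le _)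
    · rw [integral_mul_const, integral_radialKernel hn1]
      field_simp
      linarith
  · exact hf.locallyIntegrable.integrable_smul_right_of_hasCompactSupport
      ((contDiff_radialKernel _).continuous.comp (by fun_prop))
      ((hasCompactSupport_radialKernel hn1).comp_homeomorph (Homeomorph.subLeft x))
  · exact hk.mul_const _

/-- The correction term of the mean value inequality vanishes at small scales. -/
theorem tendsto_correction (b : ℝ) :
    Tendsto (fun n : ℕ => b / (2 * ((n : ℝ) + 1) ^ 2)) atTop (𝓝 0) := by
  have h1 : Tendsto (fun n : ℕ => 1 / ((n : ℝ) + 1)) atTop (𝓝 0) :=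
    tendsto_one_div_add_atTop_nhds_zero_nat
  have h2 := (h1.pow 2).const_mul (b / 2)
  simp only [ne_eq, OfNat.ofNat_ne_zero, not_false_eq_true, zero_pow, mul_zero] at h2
  refine h2.congr fun n => ?_
  field_simp

/-- Mean value inequality at unit scale. -/
theorem HasLaplacianBound.radialAverage_le (hf : Continuous f) {A : ℝ} (hA : 0 ≤ A)
    (h : HasLaplacianBound f A) (x : Eucl d) :
    radialAverage f 1 x - A * (‖x‖ + 2) * potentialMass d / 2 ≤ radialMass d * f x := by
  have hmono := monotoneOn_radialAverage hf.locallyIntegrable hA h x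
  have hlim := (tendsto_radialAverage hf x).sub
    (tendsto_correction (A * (‖x‖ + 2) * potentialMass d))
  rw [sub_zero] at hlim
  refine ge_of_tendsto' hlim fun n => ?_
  have := hmono (Set.mem_Ici.2 le_rfl) (Set.mem_Ici.2 (by linarith [Nat.cast_nonneg (α := ℝ) n] :
    (1 : ℝ) ≤ n + 1)) (by linarith [Nat.cast_nonneg (α := ℝ) n])
  simpa using this

/-- A function whose Laplacian is bounded above has a lower semicontinuous representative. -/
theorem HasLaplacianBound.exists_lowerSemicontinuous (hf : LocallyIntegrable f volume) {A : ℝ}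
    (hA : 0 ≤ A) (h : HasLaplacianBound f A) :
    ∃ f' : Eucl d → EReal, LowerSemicontinuous f' ∧ ∀ᵐ x, f' x = (f x : EReal) := by
  have hm := radialMass_pos (d := d)
  -- Each of these functions is continuous and the sequence increases in n. Its supremum is thus
  -- lower semicontinuous, and it coincides with the limit f almost everywhere.
  set u : ℕ → Eucl d → ℝ := fun n x => (radialMass d)⁻¹ * (radialAverage f (n + 1) x -
    A * (‖x‖ + 2) * potentialMass d / (2 * ((n : ℝ) + 1) ^ 2)) with hu
  refine ⟨fun x => ⨆ n, (u n x : EReal), lowerSemicontinuous_iSup fun n => ?_, ?_⟩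
  · have hc := continuous_radialAverage hf (τ := (n : ℝ) + 1) (by positivity)
    refine Continuous.lowerSemicontinuous (continuous_coe_real_ereal.comp ?_)
    simp only [hu]
    have : Continuous fun x => radialAverage f (n + 1) x := hc
    fun_prop
  · filter_upwards [ae_tendsto_radialAverage hf] with x hx
    have hlim := (hx.sub (tendsto_correction (A * (‖x‖ + 2) * potentialMass d))).const_mul
      (radialMass d)⁻¹
    rw [sub_zero, inv_mul_cancel_left₀ hm.ne'] at hlim
    have hmono : Monotone fun n => (u n x : EReal) := by
      intro m n hmn
      simp only [hu, EReal.coe_le_coe_iff]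
      gcongr ?_ * ?_
      exact monotoneOn_radialAverage hf hA h x
        (Set.mem_Ici.2 (by linarith [Nat.cast_nonneg (α := ℝ) m]))
        (Set.mem_Ici.2 (by linarith [Nat.cast_nonneg (α := ℝ) n]))
        (by gcongr)
    exact tendsto_nhds_unique (tendsto_atTop_iSup hmono)
      ((continuous_coe_real_ereal.tendsto _).comp hlim)

end MeanValue

/-! ### Gaussian averages and the heat equation -/

section Gaussian

variable {d : ℕ}

/-- The density of the standard Gaussian. -/
noncomputable def gaussianDensity (z : Eucl d) : ℝ :=
  (∫ z : Eucl d, Real.exp (-(1 / 2 * ‖z‖ ^ 2)))⁻¹ * Real.exp (-(1 / 2 * ‖z‖ ^ 2))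

theorem integrable_pow_mul_exp_neg_sq (k : ℕ) :
    Integrable fun z : Eucl d => (1 + ‖z‖) ^ k * Real.exp (-(1 / 2 * ‖z‖ ^ 2)) := by
  refine ((integrable_one_add_norm_pow_mul_exp_neg (d := d) k one_pos).const_mul
    (Real.exp (1 / 2))).mono' (by fun_prop) (Eventually.of_forall fun z => ?_)
  rw [Real.norm_of_nonneg (by positivity), mul_left_comm, ← Real.exp_add]
  gcongr
  nlinarith [sq_nonneg (‖z‖ - 1)]

theorem integral_exp_neg_sq_pos : 0 < ∫ z : Eucl d, Real.exp (-(1 / 2 * ‖z‖ ^ 2)) := by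
  have h := integrable_pow_mul_exp_neg_sq (d := d) 0
  simp only [pow_zero, one_mul] at h
  exact integral_exp_pos h

theorem gaussianDensity_nonneg (z : Eucl d) : 0 ≤ gaussianDensity z :=
  mul_nonneg (inv_nonneg.2 integral_exp_neg_sq_pos.le) (Real.exp_pos _).le

theorem continuous_gaussianDensity : Continuous (gaussianDensity : Eucl d → ℝ) := by
  unfold gaussianDensity; fun_prop

theorem integrable_gaussianDensity : Integrable (gaussianDensity : Eucl d → ℝ) := by
  have h := integrable_pow_mul_exp_neg_sq (d := d) 0
  simp only [pow_zero, one_mul] at h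
  exact h.const_mul _

theorem integral_gaussianDensity : ∫ z : Eucl d, gaussianDensity z = 1 := by
  unfold gaussianDensity
  rw [integral_const_mul, inv_mul_cancel₀ integral_exp_neg_sq_pos.ne']

theorem integrable_norm_mul_gaussianDensity :
    Integrable fun z : Eucl d => ‖z‖ * gaussianDensity z := by
  have h := (integrable_pow_mul_exp_neg_sq (d := d) 1).const_mul
    (∫ z : Eucl d, Real.exp (-(1 / 2 * ‖z‖ ^ 2)))⁻¹
  refine h.mono' (continuous_norm.mul continuous_gaussianDensity).aestronglyMeasurable
    (Eventually.of_forall fun z => ?_)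
  rw [norm_mul, norm_norm, Real.norm_of_nonneg (gaussianDensity_nonneg z), gaussianDensity,
    mul_left_comm, pow_one]
  have := integral_exp_neg_sq_pos (d := d)
  gcongr
  linarith

theorem hasFDerivAt_gaussianDensity (z : Eucl d) :
    HasFDerivAt gaussianDensity (-(gaussianDensity z) • innerSL ℝ z) z := by
  have h1 : HasFDerivAt (fun z : Eucl d => -(1 / 2 * ‖z‖ ^ 2)) (-(innerSL ℝ z)) z := by
    refine (((hasFDerivAt_id z).norm_sq.const_mul (1 / 2)).neg).congr_fderiv ?_
    ext v
    simp
  refine (h1.exp.const_mul _).congr_fderiv ?_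
  ext v
  simp [gaussianDensity]
  ring

/-- Gaussian averages `E [Φ (x + s Z)]`. -/
noncomputable def gaussianAverage {F : Type*} [NormedAddCommGroup F] [NormedSpace ℝ F]
    (Φ : Eucl d → F) (s : ℝ) (x : Eucl d) : F :=
  ∫ z, gaussianDensity z • Φ (x + s • z)

variable {F : Type*} [NormedAddCommGroup F] [NormedSpace ℝ F]

theorem integrable_gaussianAverage {Φ : Eucl d → F} (hΦ : Continuous Φ) {B : ℝ}
    (hB : ∀ x, ‖Φ x‖ ≤ B) (s : ℝ) (x : Eucl d) :
    Integrable fun z => gaussianDensity z • Φ (x + s • z) := by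
  refine (integrable_gaussianDensity.mul_const B).mono'
    (continuous_gaussianDensity.smul (hΦ.comp (by fun_prop))).aestronglyMeasurable
    (Eventually.of_forall fun z => ?_)
  rw [norm_smul, Real.norm_of_nonneg (gaussianDensity_nonneg z)]
  exact mul_le_mul_of_nonneg_left (hB _) (gaussianDensity_nonneg z)

theorem gaussianAverage_zero [CompleteSpace F] (Φ : Eucl d → F) (x : Eucl d) :
    gaussianAverage Φ 0 x = Φ x := by
  simp [gaussianAverage, integral_smul_const, integral_gaussianDensity]

theorem continuous_gaussianAverage {Φ : Eucl d → F} (hΦ : Continuous Φ) {B : ℝ}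
    (hB : ∀ x, ‖Φ x‖ ≤ B) : Continuous fun p : ℝ × Eucl d => gaussianAverage Φ p.1 p.2 := by
  refine continuous_of_dominated (bound := fun z => gaussianDensity z * B) (fun p => ?_)
    (fun p => Eventually.of_forall fun z => ?_) (integrable_gaussianDensity.mul_const B)
    (Eventually.of_forall fun z => ?_)
  · exact (integrable_gaussianAverage hΦ hB p.1 p.2).aestronglyMeasurable
  · rw [norm_smul, Real.norm_of_nonneg (gaussianDensity_nonneg z)]
    exact mul_le_mul_of_nonneg_left (hB _) (gaussianDensity_nonneg z)
  · exact continuous_const.smul (hΦ.comp (by fun_prop))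

theorem norm_gaussianAverage_le {Φ : Eucl d → F} {B : ℝ} (hB : ∀ x, ‖Φ x‖ ≤ B) (s : ℝ)
    (x : Eucl d) : ‖gaussianAverage Φ s x‖ ≤ B := by
  refine (norm_integral_le_of_norm_le (integrable_gaussianDensity.mul_const B)
    (Eventually.of_forall fun z => ?_)).trans ?_
  · rw [norm_smul, Real.norm_of_nonneg (gaussianDensity_nonneg z)]
    exact mul_le_mul_of_nonneg_left (hB _) (gaussianDensity_nonneg z)
  · rw [integral_mul_const, integral_gaussianDensity, one_mul]

theorem hasFDerivAt_gaussianAverage {Φ : Eucl d → F} (hΦ : ContDiff ℝ 1 Φ) {B B₁ : ℝ}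
    (hB : ∀ x, ‖Φ x‖ ≤ B) (hB₁ : ∀ x, ‖fderiv ℝ Φ x‖ ≤ B₁) (s : ℝ) (x : Eucl d) :
    HasFDerivAt (gaussianAverage Φ s) (gaussianAverage (fderiv ℝ Φ) s x) x := by
  refine hasFDerivAt_integral_of_dominated_of_fderiv_le
    (bound := fun z => gaussianDensity z * B₁)
    (F' := fun x z => gaussianDensity z • fderiv ℝ Φ (x + s • z)) univ_mem
    (Eventually.of_forall fun y => (integrable_gaussianAverage hΦ.continuous hB s
      y).aestronglyMeasurable)
    (integrable_gaussianAverage hΦ.continuous hB s x)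
    (integrable_gaussianAverage (hΦ.continuous_fderiv (by simp)) hB₁ s x).aestronglyMeasurable
    (Eventually.of_forall fun z y _ => ?_) (integrable_gaussianDensity.mul_const B₁)
    (Eventually.of_forall fun z y _ => ?_)
  · rw [norm_smul, Real.norm_of_nonneg (gaussianDensity_nonneg z)]
    exact mul_le_mul_of_nonneg_left (hB₁ _) (gaussianDensity_nonneg z)
  · have h1 : HasFDerivAt (fun y : Eucl d => y + s • z) (ContinuousLinearMap.id ℝ (Eucl d)) y :=
      (hasFDerivAt_id y).add_const _
    have h2 := ((hΦ.differentiable (by simp)) (y + s • z)).hasFDerivAt.comp y h1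
    exact (h2.congr_fderiv (by ext; simp)).const_smul (gaussianDensity z)

/-- A function with two bounded continuous derivatives. -/
structure IsBoundedC2 (φ : Eucl d → ℝ) : Prop where
  contDiff : ContDiff ℝ 2 φ
  bdd : ∃ B, ∀ x, ‖φ x‖ ≤ B
  bdd_fderiv : ∃ B, ∀ x, ‖fderiv ℝ φ x‖ ≤ B
  bdd_fderiv_fderiv : ∃ B, ∀ x, ‖fderiv ℝ (fderiv ℝ φ) x‖ ≤ B

theorem IsBoundedC2.contDiff_fderiv {φ : Eucl d → ℝ} (hφ : IsBoundedC2 φ) :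
    ContDiff ℝ 1 (fderiv ℝ φ) := hφ.contDiff.fderiv_right (by norm_num)

theorem laplacian_eq_sum_fderiv_fderiv (φ : Eucl d → ℝ) (x : Eucl d) :
    Laplacian.laplacian φ x = ∑ i, fderiv ℝ (fderiv ℝ φ) x (EuclideanSpace.basisFun (Fin d) ℝ i)
      (EuclideanSpace.basisFun (Fin d) ℝ i) := by
  rw [InnerProductSpace.laplacian_eq_iteratedFDeriv_orthonormalBasis φ
    (EuclideanSpace.basisFun (Fin d) ℝ)]
  refine Finset.sum_congr rfl fun i _ => ?_
  rw [iteratedFDeriv_two_apply]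
  simp

theorem ContDiff.continuous_laplacian {φ : Eucl d → ℝ} (hφ : ContDiff ℝ 2 φ) :
    Continuous (Laplacian.laplacian φ) := by
  rw [show Laplacian.laplacian φ = _ from funext (laplacian_eq_sum_fderiv_fderiv φ)]
  have : Continuous (fderiv ℝ (fderiv ℝ φ)) :=
    (hφ.fderiv_right (m := 1) (by norm_num)).continuous_fderiv (by simp)
  fun_prop

theorem IsBoundedC2.bdd_laplacian {φ : Eucl d → ℝ} (hφ : IsBoundedC2 φ) :
    ∃ B, ∀ x, ‖Laplacian.laplacian φ x‖ ≤ B := by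
  obtain ⟨B, hB⟩ := hφ.bdd_fderiv_fderiv
  refine ⟨∑ _i : Fin d, B, fun x => ?_⟩
  rw [laplacian_eq_sum_fderiv_fderiv]
  refine (norm_sum_le _ _).trans (Finset.sum_le_sum fun i _ => ?_)
  refine (ContinuousLinearMap.le_opNorm _ _).trans ?_
  rw [OrthonormalBasis.norm_eq_one, mul_one]
  refine (ContinuousLinearMap.le_opNorm _ _).trans ?_
  rw [OrthonormalBasis.norm_eq_one, mul_one]
  exact hB x

theorem IsBoundedC2.contDiff_gaussianAverage {φ : Eucl d → ℝ} (hφ : IsBoundedC2 φ) (s : ℝ) :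
    ContDiff ℝ 2 (gaussianAverage φ s) ∧
      ∀ x, Laplacian.laplacian (gaussianAverage φ s) x =
        gaussianAverage (Laplacian.laplacian φ) s x := by
  obtain ⟨B₀, hB₀⟩ := hφ.bdd
  obtain ⟨B₁, hB₁⟩ := hφ.bdd_fderiv
  obtain ⟨B₂, hB₂⟩ := hφ.bdd_fderiv_fderiv
  have h1 := fun x => hasFDerivAt_gaussianAverage (hφ.contDiff.of_le (by norm_num)) hB₀ hB₁ s x
  have h2 := fun x => hasFDerivAt_gaussianAverage hφ.contDiff_fderiv hB₁ hB₂ s x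
  have e1 : fderiv ℝ (gaussianAverage φ s) = gaussianAverage (fderiv ℝ φ) s :=
    funext fun x => (h1 x).fderiv
  have e2 : fderiv ℝ (gaussianAverage (fderiv ℝ φ) s) =
    gaussianAverage (fderiv ℝ (fderiv ℝ φ)) s := funext fun x => (h2 x).fderiv
  have c2 : Continuous (fderiv ℝ (fderiv ℝ φ)) := hφ.contDiff_fderiv.continuous_fderiv (by simp)
  have hC : ContDiff ℝ 2 (gaussianAverage φ s) := by
    rw [show (2 : WithTop ℕ∞) = 1 + 1 by norm_num, contDiff_succ_iff_fderiv]
    refine ⟨fun x => (h1 x).differentiableAt, by simp, ?_⟩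
    rw [e1, contDiff_one_iff_fderiv]
    refine ⟨fun x => (h2 x).differentiableAt, ?_⟩
    rw [e2]
    exact (continuous_gaussianAverage c2 hB₂).comp (Continuous.prodMk_right s)
  refine ⟨hC, fun x => ?_⟩
  rw [laplacian_eq_sum_fderiv_fderiv, e1, e2]
  simp only [gaussianAverage, laplacian_eq_sum_fderiv_fderiv, Finset.smul_sum]
  have hi := integrable_gaussianAverage (Φ := fderiv ℝ (fderiv ℝ φ)) c2 hB₂ s x
  rw [integral_finsetSum]
  · refine Finset.sum_congr rfl fun i _ => ?_
    rw [ContinuousLinearMap.integral_apply hi,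
      ContinuousLinearMap.integral_apply (hi.apply_continuousLinearMap _)]
    simp
  · intro i _
    exact (hi.apply_continuousLinearMap _).apply_continuousLinearMap _

/-- Gaussian averages solve the heat equation. -/
theorem IsBoundedC2.hasDerivAt_gaussianAverage_sqrt {φ : Eucl d → ℝ} (hφ : IsBoundedC2 φ)
    {t : ℝ} (ht : 0 < t) (x : Eucl d) :
    HasDerivAt (fun t => gaussianAverage φ (√t) x)
      (1 / 2 * gaussianAverage (Laplacian.laplacian φ) (√t) x) t := by
  obtain ⟨B₀, hB₀⟩ := hφ.bdd
  obtain ⟨B₁, hB₁⟩ := hφ.bdd_fderiv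
  obtain ⟨B₂, hB₂⟩ := hφ.bdd_fderiv_fderiv
  set e := EuclideanSpace.basisFun (Fin d) ℝ with he
  have hB₁0 : 0 ≤ B₁ := (norm_nonneg _).trans (hB₁ 0)
  have c1 : Continuous (fderiv ℝ φ) := hφ.contDiff.continuous_fderiv (by norm_num)
  have c2 : Continuous (fderiv ℝ (fderiv ℝ φ)) := hφ.contDiff_fderiv.continuous_fderiv (by simp)
  have hd := hasDerivAt_integral_of_dominated_loc_of_deriv_le (μ := (volume : Measure (Eucl d)))
    (F := fun t z => gaussianDensity z • φ (x + √t • z))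
    (F' := fun t z => gaussianDensity z • (fderiv ℝ φ (x + √t • z) ((1 / (2 * √t)) • z)))
    (x₀ := t) (bound := fun z => B₁ * (1 / (2 * √(t / 2))) * (‖z‖ * gaussianDensity z))
    (Ioi_mem_nhds (show t / 2 < t by linarith))
    (Eventually.of_forall fun t => (integrable_gaussianAverage hφ.contDiff.continuous hB₀ (√t)
      x).aestronglyMeasurable)
    (integrable_gaussianAverage hφ.contDiff.continuous hB₀ (√t) x)
    (Continuous.aestronglyMeasurable (continuous_gaussianDensity.smul (by fun_prop)))
    (Eventually.of_forall fun z s hs => ?_)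
    (integrable_norm_mul_gaussianDensity.const_mul _)
    (Eventually.of_forall fun z s hs => ?_)
  · refine hd.2.congr_deriv ?_
    have hst : 0 < √t := Real.sqrt_pos.2 ht
    -- Gaussian integration by parts: zᵢ times the density is minus its i-th derivative, so the
    -- factor z created by differentiating √t z becomes one more derivative on φ. The √t gained here
    -- cancels the one in 1/(2√t).
    have hpart : ∀ i, ∫ z, fderiv ℝ φ (x + √t • z) (e i) * (inner ℝ z (e i) * gaussianDensity z) =
        √t * ∫ z, gaussianDensity z * fderiv ℝ (fderiv ℝ φ) (x + √t • z) (e i) (e i) := by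
      intro i
      have hdf : ∀ z, HasFDerivAt (fun z => fderiv ℝ φ (x + √t • z) (e i))
          ((ContinuousLinearMap.apply ℝ ℝ (e i)).comp
            ((fderiv ℝ (fderiv ℝ φ) (x + √t • z)).comp (√t • ContinuousLinearMap.id ℝ _))) z := by
        intro z
        have h1 : HasFDerivAt (fun z : Eucl d => x + √t • z)
          (√t • ContinuousLinearMap.id ℝ (Eucl d)) z :=
          ((hasFDerivAt_id (𝕜 := ℝ) z).const_smul (√t)).const_add x
        exact (ContinuousLinearMap.apply ℝ ℝ (e i)).hasFDerivAt.comp z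
          (((hφ.contDiff_fderiv.differentiable (by simp)) (x + √t • z)).hasFDerivAt.comp z h1)
      have b1 : ∀ z, ‖fderiv ℝ φ (x + √t • z) (e i)‖ ≤ B₁ := fun z => by
        refine (ContinuousLinearMap.le_opNorm _ _).trans ?_
        rw [OrthonormalBasis.norm_eq_one, mul_one]
        exact hB₁ _
      have b2 : ∀ z, ‖fderiv ℝ (fderiv ℝ φ) (x + √t • z) (e i) (e i)‖ ≤ B₂ := fun z => by
        refine (ContinuousLinearMap.le_opNorm _ _).trans ?_
        rw [OrthonormalBasis.norm_eq_one, mul_one]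
        refine (ContinuousLinearMap.le_opNorm _ _).trans ?_
        rw [OrthonormalBasis.norm_eq_one, mul_one]
        exact hB₂ _
      have hG : ∀ z : Eucl d, fderiv ℝ gaussianDensity z (e i) =
          -(inner ℝ z (e i) * gaussianDensity z) := fun z => by
        rw [(hasFDerivAt_gaussianDensity z).fderiv]
        simp
        ring
      have hF : ∀ z, fderiv ℝ (fun z => fderiv ℝ φ (x + √t • z) (e i)) z (e i) =
          √t * fderiv ℝ (fderiv ℝ φ) (x + √t • z) (e i) (e i) := fun z => by
        rw [(hdf z).fderiv]
        simp
      have cG := continuous_gaussianDensity (d := d)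
      have hibp := integral_mul_fderiv_eq_neg_fderiv_mul_of_integrable (𝕜 := ℝ)
        (μ := (volume : Measure (Eucl d)))
        (f := fun z => fderiv ℝ φ (x + √t • z) (e i)) (g := gaussianDensity) (v := e i)
        ?_ ?_ ?_ (fun z _ => (hdf z).differentiableAt)
        (fun z _ => (hasFDerivAt_gaussianDensity z).differentiableAt)
      · simp only [hG, hF, mul_neg, integral_neg, neg_inj] at hibp
        rw [hibp, ← integral_const_mul]
        congr 1
        ext z
        ring
      · simp only [hF]
        refine (integrable_gaussianDensity.const_mul (√t * B₂)).mono'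
          (Continuous.aestronglyMeasurable (by fun_prop)) (Eventually.of_forall fun z => ?_)
        rw [norm_mul, norm_mul, Real.norm_of_nonneg hst.le,
          Real.norm_of_nonneg (gaussianDensity_nonneg z)]
        have := b2 z
        have := gaussianDensity_nonneg z
        gcongr
      · simp only [hG]
        refine (integrable_norm_mul_gaussianDensity.const_mul B₁).mono'
          (Continuous.aestronglyMeasurable (by fun_prop)) (Eventually.of_forall fun z => ?_)
        rw [norm_mul, norm_neg, norm_mul, Real.norm_of_nonneg (gaussianDensity_nonneg z)]
        have h1 := b1 z
        have h2 := gaussianDensity_nonneg z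
        have h3 : ‖inner ℝ z (e i)‖ ≤ ‖z‖ := by
          simpa using norm_inner_le_norm (𝕜 := ℝ) z (e i)
        gcongr
      · refine (integrable_gaussianDensity.const_mul B₁).mono'
          (Continuous.aestronglyMeasurable (by fun_prop)) (Eventually.of_forall fun z => ?_)
        rw [norm_mul, Real.norm_of_nonneg (gaussianDensity_nonneg z)]
        have := b1 z
        have := gaussianDensity_nonneg z
        gcongr
    have hexp : ∀ z, gaussianDensity z • (fderiv ℝ φ (x + √t • z) ((1 / (2 * √t)) • z)) =
        ∑ i, 1 / (2 * √t) * (fderiv ℝ φ (x + √t • z) (e i) *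
          (inner ℝ z (e i) * gaussianDensity z)) := by
      intro z
      rw [← Finset.mul_sum, map_smul]
      have : fderiv ℝ φ (x + √t • z) z = ∑ i, inner ℝ z (e i) * fderiv ℝ φ (x + √t • z) (e i) := by
        have h1 := congrArg (fderiv ℝ φ (x + √t • z)) (e.sum_repr' z)
        rw [← h1, map_sum]
        simp only [map_smul, smul_eq_mul, real_inner_comm]
      rw [this, smul_eq_mul, smul_eq_mul, mul_left_comm, Finset.mul_sum]
      congr 1
      refine Finset.sum_congr rfl fun i _ => ?_
      ring
    have hlap : gaussianAverage (Laplacian.laplacian φ) (√t) x =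
        ∑ i, ∫ z, gaussianDensity z * fderiv ℝ (fderiv ℝ φ) (x + √t • z) (e i) (e i) := by
      simp only [gaussianAverage, laplacian_eq_sum_fderiv_fderiv, smul_eq_mul,
        Finset.mul_sum]
      rw [integral_finsetSum]
      intro i _
      have hi := integrable_gaussianAverage (Φ := fderiv ℝ (fderiv ℝ φ)) c2 hB₂ (√t) x
      exact (hi.apply_continuousLinearMap _).apply_continuousLinearMap _
    simp only [hexp]
    rw [integral_finsetSum, hlap, Finset.mul_sum]
    · refine Finset.sum_congr rfl fun i _ => ?_
      rw [integral_const_mul, hpart]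
      field_simp
    · intro i _
      refine Integrable.const_mul ?_ _
      have cG := continuous_gaussianDensity (d := d)
      refine (integrable_norm_mul_gaussianDensity.const_mul B₁).mono'
        (Continuous.aestronglyMeasurable (by fun_prop)) (Eventually.of_forall fun z => ?_)
      rw [norm_mul, norm_mul, Real.norm_of_nonneg (gaussianDensity_nonneg z)]
      have h2 := gaussianDensity_nonneg z
      have h3 : ‖inner ℝ z (e i)‖ ≤ ‖z‖ := by
        simpa using norm_inner_le_norm (𝕜 := ℝ) z (e i)
      gcongr
      refine (ContinuousLinearMap.le_opNorm _ _).trans ?_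
      rw [OrthonormalBasis.norm_eq_one, mul_one]
      exact hB₁ _
  · have hs2 : t / 2 < s := hs
    have hG := gaussianDensity_nonneg z
    rw [norm_smul, Real.norm_of_nonneg hG]
    have h1 : ‖fderiv ℝ φ (x + √s • z) ((1 / (2 * √s)) • z)‖ ≤ B₁ * (1 / (2 * √(t / 2)) * ‖z‖) := by
      refine (ContinuousLinearMap.le_opNorm _ _).trans ?_
      rw [norm_smul, Real.norm_of_nonneg (by positivity)]
      have : 0 < √(t / 2) := Real.sqrt_pos.2 (by linarith)
      gcongr
      exact hB₁ _
    calc _ ≤ gaussianDensity z * (B₁ * (1 / (2 * √(t / 2)) * ‖z‖)) := by gcongr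
      _ = _ := by ring
  · have hs0 : 0 < s := by linarith [show t / 2 < s from hs]
    have h1 : HasDerivAt (fun s : ℝ => x + √s • z) ((1 / (2 * √s)) • z) s :=
      ((Real.hasDerivAt_sqrt hs0.ne').smul_const z).const_add x
    exact (((hφ.contDiff.differentiable (by norm_num)) _).hasFDerivAt.comp_hasDerivAt s
      h1).const_smul (gaussianDensity z)

end Gaussian

/-! ### From viscosity to distributional inequalities by comparison with the heat flow -/

section Comparison

variable {d : ℕ}

/-- Only left difference quotients enter, because in the comparison argument the minimum may sit at
the final time. -/
theorem HasDerivAt.nonpos_of_isMinOn_Icc {f : ℝ → ℝ} {f' s : ℝ} (hf : HasDerivAt f f' s)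
    (hs : 0 < s) (h : ∀ t ∈ Set.Icc 0 s, f s ≤ f t) : f' ≤ 0 := by
  have h1 := (hasDerivWithinAt_iff_tendsto_slope' (s := Set.Iio s) (by simp)).1
    hf.hasDerivWithinAt
  refine le_of_tendsto h1 ?_
  filter_upwards [Ioo_mem_nhdsLT hs] with t ht
  rw [slope_def_field]
  have := h t ⟨ht.1.le, ht.2.le⟩
  exact div_nonpos_of_nonneg_of_nonpos (by linarith) (by linarith [ht.2])

theorem laplacian_norm_sq (x : Eucl d) :
    Laplacian.laplacian (fun y : Eucl d => ‖y‖ ^ 2) x = 2 * d := by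
  have := laplacian_comp_norm_sq (d := d) (η := fun s => s) (η' := fun _ => 1) (η'' := fun _ => 0)
    (fun s => hasDerivAt_id s) (fun s => hasDerivAt_const s 1) contDiff_id 1 0 x
  simpa using this

/-- Comparison of a viscosity supersolution of `Δw / 2 ≤ G` with the heat flow. -/
theorem gaussianAverage_le_of_touching {w G Gt φ : Eucl d → ℝ} (hw : Continuous w) {Bw : ℝ}
    (hBw : ∀ x, |w x| ≤ Bw)
    (htouch : ∀ (x : Eucl d) (ϕ : Eucl d → ℝ), ContDiff ℝ 2 ϕ → ϕ x = w x → (∀ y, ϕ y ≤ w y) →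
      (1 / 2 : ℝ) * Laplacian.laplacian ϕ x ≤ G x)
    (hGt : IsBoundedC2 Gt) (hG : ∀ x, G x ≤ Gt x) {A : ℝ}
    (hA : ∀ x, |Laplacian.laplacian Gt x| ≤ A) (hφ : IsBoundedC2 φ) {σ : ℝ} (hσ : 0 ≤ σ)
    (hφw : ∀ x, φ x ≤ w x + σ) {η β T : ℝ} (hη : 0 < η) (hβ : 0 < β)
    (hT : T * A / 2 + β * d < η) {t : ℝ} (ht : 0 < t) (htT : t ≤ T) (x : Eucl d) :
    gaussianAverage φ (√t) x ≤ w x + σ + t * (Gt x + η) + β * ‖x‖ ^ 2 := by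
  obtain ⟨Bφ, hBφ⟩ := hφ.bdd
  obtain ⟨BG, hBG⟩ := hGt.bdd
  have hA0 : 0 ≤ A := (abs_nonneg _).trans (hA 0)
  have hBG0 : 0 ≤ BG := (norm_nonneg _).trans (hBG 0)
  have hT0 : 0 < T := ht.trans_le htT
  -- If the claim fails, Ψ takes a value below -σ. The quadratic term confines the search to a
  -- compact set, so a minimum is attained; at time zero Ψ ≥ -σ, so the minimizing time is positive.
  set Ψ : ℝ × Eucl d → ℝ := fun p =>
    w p.2 - gaussianAverage φ (√p.1) p.2 + p.1 * (Gt p.2 + η) + β * ‖p.2‖ ^ 2 with hΨ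
  have hΨc : Continuous Ψ := by
    have h1 : Continuous fun p : ℝ × Eucl d => gaussianAverage φ (√p.1) p.2 :=
      (continuous_gaussianAverage hφ.contDiff.continuous hBφ).comp
        ((Real.continuous_sqrt.comp continuous_fst).prodMk continuous_snd)
    have h2 := hGt.contDiff.continuous
    fun_prop
  by_contra! hcon
  have hneg : Ψ (t, x) < -σ := by simp only [hΨ]; linarith
  set r : ℝ := √((Bw + Bφ + T * BG) / β) + ‖x‖ with hr
  have hfar : ∀ s ∈ Set.Icc 0 T, ∀ y : Eucl d, r ≤ ‖y‖ → 0 ≤ Ψ (s, y) := by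
    intro s hs y hy
    have h1 := neg_le_of_abs_le (hBw y)
    have h2 := (abs_le.1 (norm_gaussianAverage_le hBφ (√s) y)).2
    have h3 := neg_le_of_abs_le (hBG y)
    have h4 : -(T * BG) ≤ s * (Gt y + η) := by
      have : s * BG ≤ T * BG := mul_le_mul_of_nonneg_right hs.2 hBG0
      have : 0 ≤ s * (Gt y + η + BG) := mul_nonneg hs.1 (by linarith)
      linarith
    have h5 : Bw + Bφ + T * BG ≤ β * ‖y‖ ^ 2 := by
      have h6 : √((Bw + Bφ + T * BG) / β) ≤ ‖y‖ := by linarith [norm_nonneg x]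
      have h7 := (Real.sqrt_le_left (norm_nonneg y)).1 h6
      rw [div_le_iff₀ hβ] at h7
      linarith
    simp only [hΨ]
    linarith
  obtain ⟨⟨s₀, y₀⟩, hm, hmin⟩ := (isCompact_Icc.prod (isCompact_closedBall (0 : Eucl d) r)).exists_isMinOn
    ⟨(t, x), ⟨ht.le, htT⟩, by simp [hr]⟩ hΨc.continuousOn
  have hle := hmin (show (t, x) ∈ Set.Icc 0 T ×ˢ Metric.closedBall (0 : Eucl d) r from
    ⟨⟨ht.le, htT⟩, by simp [hr]⟩)
  have hneg0 : Ψ (s₀, y₀) < -σ := lt_of_le_of_lt hle hneg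
  have hglob : ∀ s ∈ Set.Icc 0 T, ∀ y, Ψ (s₀, y₀) ≤ Ψ (s, y) := by
    intro s hs y
    rcases le_or_gt r ‖y‖ with hy | hy
    · linarith [hfar s hs y hy]
    · exact hmin (show (s, y) ∈ Set.Icc 0 T ×ˢ Metric.closedBall (0 : Eucl d) r from
        ⟨hs, by simpa using hy.le⟩)
  have hs₀ : s₀ ∈ Set.Icc 0 T := hm.1
  have hs0 : 0 < s₀ := by
    refine lt_of_le_of_ne hs₀.1 fun h0 => ?_
    rw [← h0] at hneg0
    simp only [hΨ, Real.sqrt_zero, gaussianAverage_zero, zero_mul, add_zero] at hneg0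
    have h1 := hφw y₀
    have h2 : 0 ≤ β * ‖y₀‖ ^ 2 := by positivity
    linarith
  obtain ⟨hc2, hlap⟩ := hφ.contDiff_gaussianAverage (√s₀)
  -- At the minimizing time s₀ the other terms of Ψ form a function touching w from below at y₀,
  -- whence ½Δu - ½s₀ΔGt - βd ≤ G for the heat flow u. Minimality in time gives -½Δu + Gt + η ≤ 0.
  -- Adding the two contradicts TA/2 + βd < η.
  have ht1 := htouch y₀ (fun y => gaussianAverage φ (√s₀) y - s₀ * (Gt y + η) - β * ‖y‖ ^ 2 +
    Ψ (s₀, y₀)) ?_ ?_ ?_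
  · have hlapϕ : Laplacian.laplacian (fun y => gaussianAverage φ (√s₀) y - s₀ * (Gt y + η) -
        β * ‖y‖ ^ 2 + Ψ (s₀, y₀)) y₀ = gaussianAverage (Laplacian.laplacian φ) (√s₀) y₀ -
        s₀ * Laplacian.laplacian Gt y₀ - β * (2 * d) := by
      have c1 : ContDiffAt ℝ 2 (gaussianAverage φ (√s₀)) y₀ := hc2.contDiffAt
      have c2 : ContDiffAt ℝ 2 Gt y₀ := hGt.contDiff.contDiffAt
      have c3 : ContDiffAt ℝ 2 (fun y : Eucl d => ‖y‖ ^ 2) y₀ :=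
        (contDiff_id.norm_sq ℝ).contDiffAt
      have c4 : ContDiffAt ℝ 2 (fun _ : Eucl d => Ψ (s₀, y₀) - s₀ * η) y₀ := contDiffAt_const
      have e : (fun y => gaussianAverage φ (√s₀) y - s₀ * (Gt y + η) -
        β * ‖y‖ ^ 2 + Ψ (s₀, y₀)) = gaussianAverage φ (√s₀) - s₀ • Gt - β • (fun y => ‖y‖ ^ 2) +
          fun _ => Ψ (s₀, y₀) - s₀ * η := by
        ext y
        simp only [Pi.add_apply, Pi.sub_apply, Pi.smul_apply, smul_eq_mul]
        ring
      have c5 : ContDiffAt ℝ 2 (s₀ • Gt) y₀ := c2.const_smul s₀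
      have c6 : ContDiffAt ℝ 2 (β • fun y : Eucl d => ‖y‖ ^ 2) y₀ := c3.const_smul β
      have c7 : ContDiffAt ℝ 2 (gaussianAverage φ (√s₀) - s₀ • Gt) y₀ := c1.sub c5
      have c8 : ContDiffAt ℝ 2 (gaussianAverage φ (√s₀) - s₀ • Gt - β • fun y : Eucl d => ‖y‖ ^ 2)
        y₀ := c7.sub c6
      rw [e, ContDiffAt.laplacian_add c8 c4, ContDiffAt.laplacian_sub c7 c6,
        ContDiffAt.laplacian_sub c1 c5, InnerProductSpace.laplacian_smul _ c2,
        InnerProductSpace.laplacian_smul _ c3, hlap, laplacian_norm_sq]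
      simp
    rw [hlapϕ] at ht1
    have hder : HasDerivAt (fun s => Ψ (s, y₀))
        (-(1 / 2 * gaussianAverage (Laplacian.laplacian φ) (√s₀) y₀) + (Gt y₀ + η)) s₀ := by
      have h1 := (hφ.hasDerivAt_gaussianAverage_sqrt hs0 y₀).const_sub (w y₀)
      have h2 := ((h1.add ((hasDerivAt_id s₀).mul_const (Gt y₀ + η))).add_const (β * ‖y₀‖ ^ 2))
      refine h2.congr_deriv (by ring)
    have h3 := hder.nonpos_of_isMinOn_Icc hs0 fun s hs => hglob s ⟨hs.1, hs.2.trans hs₀.2⟩ y₀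
    have h4 := (abs_le.1 (hA y₀)).2
    have h5 : s₀ * Laplacian.laplacian Gt y₀ ≤ T * A :=
      (mul_le_mul_of_nonneg_left h4 hs₀.1).trans (mul_le_mul_of_nonneg_right hs₀.2 hA0)
    have h6 := hG y₀
    linarith
  · exact ((hc2.sub (contDiff_const.mul (hGt.contDiff.add contDiff_const))).sub
      (contDiff_const.mul (contDiff_id.norm_sq ℝ))).add contDiff_const
  · simp only [hΨ]; ring
  · intro y
    have := hglob s₀ hs₀ y
    simp only [hΨ] at this ⊢
    linarith

open ContinuousLinearMap

theorem norm_convolution_le_of_bounded {F F' : Type*} [NormedAddCommGroup F] [NormedSpace ℝ F]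
    [NormedAddCommGroup F'] [NormedSpace ℝ F'] (L : ℝ →L[ℝ] F →L[ℝ] F') {w : Eucl d → ℝ} {B : ℝ}
    (hB : ∀ x, |w x| ≤ B) {g : Eucl d → F} (hg : Integrable g) :
    ∃ B', ∀ x, ‖convolution w g L volume x‖ ≤ B' := by
  refine ⟨‖L‖ * B * ∫ y, ‖g y‖, fun x => ?_⟩
  rw [convolution_eq_swap, ← integral_const_mul]
  refine norm_integral_le_of_norm_le (hg.norm.const_mul _) (Eventually.of_forall fun y => ?_)
  refine (L.le_opNorm₂ _ _).trans ?_
  gcongr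
  exact hB _

theorem exists_fderiv_convolution_eq {F F' : Type*} [NormedAddCommGroup F] [NormedSpace ℝ F]
    [NormedAddCommGroup F'] [NormedSpace ℝ F'] (L : ℝ →L[ℝ] F →L[ℝ] F') {w : Eucl d → ℝ}
    (hw : LocallyIntegrable w volume) {g : Eucl d → F} (hg : ContDiff ℝ 1 g)
    (hc : HasCompactSupport g) :
    ∃ L' : ℝ →L[ℝ] (Eucl d →L[ℝ] F) →L[ℝ] (Eucl d →L[ℝ] F'),
     fderiv ℝ (convolution w g L volume) = convolution w (fderiv ℝ g) L' volume :=
  ⟨_, funext fun x => (hc.hasFDerivAt_convolution_right L hw hg x).fderiv⟩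

/-- Convolving a bounded function with a smooth kernel of compact support. -/
theorem isBoundedC2_convolution {w k : Eucl d → ℝ} (hw : LocallyIntegrable w volume) {B : ℝ}
    (hB : ∀ x, |w x| ≤ B) (hk : ContDiff ℝ ∞ k) (hc : HasCompactSupport k) (L : ℝ →L[ℝ] ℝ →L[ℝ] ℝ) :
    IsBoundedC2 (convolution w k L volume) := by
  have hc1 := hc.fderiv (𝕜 := ℝ)
  have hc2 := hc1.fderiv (𝕜 := ℝ)
  have hk1 : ContDiff ℝ ∞ (fderiv ℝ k) := hk.fderiv_right (by simp)
  obtain ⟨L1, e1⟩ := exists_fderiv_convolution_eq L hw (hk.of_le (by simp)) hc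
  obtain ⟨L2, e2⟩ := exists_fderiv_convolution_eq L1 hw (hk1.of_le (by simp)) hc1
  have b0 := norm_convolution_le_of_bounded L hB
    (hk.continuous.integrable_of_hasCompactSupport hc)
  have b1 := norm_convolution_le_of_bounded L1 hB
    (hk1.continuous.integrable_of_hasCompactSupport hc1)
  have b2 := norm_convolution_le_of_bounded L2 hB
    ((hk1.continuous_fderiv (by simp)).integrable_of_hasCompactSupport hc2)
  rw [← e2, ← e1] at b2
  rw [← e1] at b1
  have b3 : ContDiff ℝ 2 (convolution w k L volume) := (hc.contDiff_convolution_right L hw hk).of_le two_le_infty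
  exact ⟨b3, b0, b1, b2⟩

theorem laplacian_convolution {w k : Eucl d → ℝ} (hw : LocallyIntegrable w volume)
    (hk : ContDiff ℝ ∞ k) (hc : HasCompactSupport k) (x : Eucl d) :
    Laplacian.laplacian (convolution w k (lsmul ℝ ℝ) volume) x =
      ∫ y, w y * Laplacian.laplacian k (x - y) := by
  set e := EuclideanSpace.basisFun (Fin d) ℝ
  have hki : ∀ i, ContDiff ℝ ∞ fun a => fderiv ℝ k a (e i) := fun i =>
    (hk.fderiv_right (m := ∞) (by simp)).clm_apply contDiff_const
  have hci : ∀ i, HasCompactSupport fun a => fderiv ℝ k a (e i) := fun i =>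
    hc.fderiv_apply (𝕜 := ℝ) (e i)
  rw [laplacian_eq_sum_fderiv ((hc.contDiff_convolution_right _ hw hk).of_le two_le_infty)]
  simp only [laplacian_eq_sum_fderiv (hk.of_le two_le_infty), Finset.mul_sum]
  rw [integral_finsetSum]
  · refine Finset.sum_congr rfl fun i _ => ?_
    have e1 : (fun y => fderiv ℝ (convolution w k (lsmul ℝ ℝ) volume) y (e i)) =
        convolution w (fun a => fderiv ℝ k a (e i)) (lsmul ℝ ℝ) volume :=
      funext fun y => fderiv_convolution_apply hw hk hc y (e i)
    rw [e1, fderiv_convolution_apply hw (hki i) (hci i), convolution_lsmul]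
    rfl
  · intro i _
    have c : Continuous fun a => fderiv ℝ (fun a => fderiv ℝ k a (e i)) a (e i) :=
      ((hki i).continuous_fderiv (by simp)).clm_apply continuous_const
    exact hw.integrable_smul_right_of_hasCompactSupport (c.comp (continuous_const.sub continuous_id))
      (((hci i).fderiv_apply (𝕜 := ℝ) (e i)).comp_homeomorph (Homeomorph.subLeft x))

theorem fderiv_comp_neg_apply {F : Type*} [NormedAddCommGroup F] [NormedSpace ℝ F]
    {h : Eucl d → F} (hh : Differentiable ℝ h) (u v : Eucl d) :
    fderiv ℝ (fun u => h (-u)) u v = -fderiv ℝ h (-u) v := by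
  have h1 : HasFDerivAt (fun u : Eucl d => -u) (-ContinuousLinearMap.id ℝ (Eucl d)) u :=
    (hasFDerivAt_id u).neg
  have h2 : HasFDerivAt (fun u => h (-u))
    ((fderiv ℝ h (-u)).comp (-ContinuousLinearMap.id ℝ (Eucl d))) u :=
    (hh (-u)).hasFDerivAt.comp u h1
  rw [h2.fderiv]
  simp

theorem laplacian_comp_neg {h : Eucl d → ℝ} (hh : ContDiff ℝ ∞ h) (u : Eucl d) :
    Laplacian.laplacian (fun u => h (-u)) u = Laplacian.laplacian h (-u) := by
  have hk : ContDiff ℝ ∞ fun u => h (-u) := hh.comp contDiff_neg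
  rw [laplacian_eq_sum_fderiv (hk.of_le two_le_infty),
    laplacian_eq_sum_fderiv (hh.of_le two_le_infty)]
  refine Finset.sum_congr rfl fun i _ => ?_
  set e := EuclideanSpace.basisFun (Fin d) ℝ
  have hd : ContDiff ℝ ∞ fun a => -fderiv ℝ h a (e i) :=
    ((hh.fderiv_right (m := ∞) (by simp)).clm_apply contDiff_const).neg
  have e1 : (fun y => fderiv ℝ (fun u => h (-u)) y (e i)) = fun u =>
      (fun a => -fderiv ℝ h a (e i)) (-u) :=
    funext fun y => fderiv_comp_neg_apply (hh.differentiable (by simp)) y (e i)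
  rw [e1, fderiv_comp_neg_apply (hd.differentiable (by simp)), fderiv_fun_neg]
  simp

theorem exists_isBoundedC2_approx {w : Eucl d → ℝ} (hw : UniformContinuous w) {B : ℝ}
    (hB : ∀ x, |w x| ≤ B) {σ : ℝ} (hσ : 0 < σ) :
    ∃ φ : Eucl d → ℝ, IsBoundedC2 φ ∧ ∀ x, |φ x - w x| ≤ σ := by
  obtain ⟨δ, hδ, h⟩ := Metric.uniformContinuous_iff.1 hw σ hσ
  let ρ : ContDiffBump (0 : Eucl d) := ⟨δ / 2, δ, by positivity, by linarith⟩
  refine ⟨_, isBoundedC2_convolution hw.continuous.locallyIntegrable hB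
    (ρ.contDiff_normed (μ := volume)) (ρ.hasCompactSupport_normed (μ := volume)) (lsmul ℝ ℝ), fun x => ?_⟩
  have h1 := ρ.dist_normed_convolution_le (μ := volume) (x₀ := x) (ε := σ)
    hw.continuous.aestronglyMeasurable fun y hy => (h hy).le
  rw [Real.dist_eq, convolution_lsmul_swap] at h1
  rw [convolution_lsmul]
  simpa [mul_comm] using h1

/-- The time T depends only on η and the Laplacian of Gt. With x fixed, the quadratic penalty and
the distance from w to its smooth approximation can then be sent to zero; the Gaussian average does
not enlarge the latter. -/
theorem gaussianAverage_le_of_touching' {w G Gt : Eucl d → ℝ} (hw : UniformContinuous w) {Bw : ℝ}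
    (hBw : ∀ x, |w x| ≤ Bw)
    (htouch : ∀ (x : Eucl d) (ϕ : Eucl d → ℝ), ContDiff ℝ 2 ϕ → ϕ x = w x → (∀ y, ϕ y ≤ w y) →
      (1 / 2 : ℝ) * Laplacian.laplacian ϕ x ≤ G x)
    (hGt : IsBoundedC2 Gt) (hG : ∀ x, G x ≤ Gt x) {η : ℝ} (hη : 0 < η) :
    ∃ T > 0, ∀ t, 0 < t → t ≤ T → ∀ x,
      gaussianAverage w (√t) x ≤ w x + t * (Gt x + η) := by
  obtain ⟨A, hA⟩ := hGt.bdd_laplacian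
  have hA0 : 0 ≤ A := (norm_nonneg _).trans (hA 0)
  refine ⟨η / (A + 1), by positivity, fun t ht htT x => ?_⟩
  have hTA : η / (A + 1) * A / 2 ≤ η / 2 := by
    have : η / (A + 1) * A ≤ η := by
      rw [div_mul_eq_mul_div, div_le_iff₀ (by positivity)]
      nlinarith
    linarith
  refine le_of_forall_pos_le_add fun ε hε => ?_
  obtain ⟨β, hβ, hβd, hβx⟩ : ∃ β > 0, β * d < η / 2 ∧ β * ‖x‖ ^ 2 ≤ ε / 2 := by
    refine ⟨min (η / (4 * (d + 1))) (ε / (2 * (‖x‖ ^ 2 + 1))), by positivity, ?_, ?_⟩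
    · calc _ ≤ η / (4 * (d + 1)) * d := by gcongr; exact min_le_left _ _
        _ < η / 2 := by
          rw [div_mul_eq_mul_div, div_lt_iff₀ (by positivity)]
          nlinarith [Nat.cast_nonneg (α := ℝ) d]
    · calc _ ≤ ε / (2 * (‖x‖ ^ 2 + 1)) * ‖x‖ ^ 2 := by gcongr; exact min_le_right _ _
        _ ≤ ε / 2 := by
          rw [div_mul_eq_mul_div, div_le_iff₀ (by positivity)]
          nlinarith [sq_nonneg ‖x‖]
  obtain ⟨φ, hφ, hφw⟩ := exists_isBoundedC2_approx hw hBw (σ := ε / 4) (by positivity)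
  have h1 := gaussianAverage_le_of_touching hw.continuous hBw htouch hGt hG hA hφ
    (σ := ε / 4) (by positivity) (fun y => by linarith [(abs_le.1 (hφw y)).2]) hη hβ
    (by linarith) ht htT x
  obtain ⟨B, hB⟩ := hφ.bdd
  have h2 : gaussianAverage w (√t) x - gaussianAverage φ (√t) x ≤ ε / 4 := by
    have i1 := integrable_gaussianAverage hw.continuous hBw (√t) x
    have i2 := integrable_gaussianAverage hφ.contDiff.continuous hB (√t) x
    rw [gaussianAverage, gaussianAverage, ← integral_sub i1 i2]
    calc _ ≤ ∫ z : Eucl d, gaussianDensity z * (ε / 4) := by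
          refine integral_mono (i1.sub i2) (integrable_gaussianDensity.mul_const _) fun z => ?_
          simp only [smul_eq_mul]
          rw [← mul_sub]
          exact mul_le_mul_of_nonneg_left (by linarith [(abs_le.1 (hφw (x + √t • z))).1])
            (gaussianDensity_nonneg z)
      _ = ε / 4 := by rw [integral_mul_const, integral_gaussianDensity, one_mul]
  linarith

theorem continuous_gaussianAverage_sqrt {Φ : Eucl d → ℝ} (hΦ : Continuous Φ) {B : ℝ}
    (hB : ∀ x, ‖Φ x‖ ≤ B) (x : Eucl d) : Continuous fun t => gaussianAverage Φ (√t) x := by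
  have hs : Continuous fun t : ℝ => (√t, x) := Real.continuous_sqrt.prodMk continuous_const
  exact (continuous_gaussianAverage hΦ hB).comp hs

/-- Were half the Laplacian larger than q at the origin, the time derivative of the heat flow would
by continuity exceed q for all small times, against the mean value theorem. -/
theorem laplacian_le_of_gaussianAverage_le {A : Eucl d → ℝ} (hA : IsBoundedC2 A) {T q : ℝ}
    (hT : 0 < T) (h : ∀ t, 0 < t → t ≤ T → gaussianAverage A (√t) 0 - A 0 ≤ t * q) :
    (1 / 2 : ℝ) * Laplacian.laplacian A 0 ≤ q := by
  obtain ⟨B₂, hB₂⟩ := hA.bdd_laplacian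
  obtain ⟨B₀, hB₀⟩ := hA.bdd
  have hcont := continuous_gaussianAverage_sqrt hA.contDiff.continuous_laplacian hB₂ 0
  have hcont' := continuous_gaussianAverage_sqrt hA.contDiff.continuous hB₀ 0
  by_contra! hlt
  have hlim := (hcont.tendsto 0).const_mul (1 / 2)
  simp only [Real.sqrt_zero, gaussianAverage_zero] at hlim
  obtain ⟨δ, hδ, hδq⟩ := Metric.eventually_nhds_iff.1 (hlim.eventually (lt_mem_nhds hlt))
  obtain ⟨r, hr, hrT, hrδ⟩ : ∃ r, 0 < r ∧ r ≤ T ∧ r ≤ δ / 2 :=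
    ⟨min T (δ / 2), by positivity, min_le_left _ _, min_le_right _ _⟩
  have hder : ∀ s ∈ Set.Ioo 0 r, HasDerivAt (fun t => gaussianAverage A (√t) 0)
      (1 / 2 * gaussianAverage (Laplacian.laplacian A) (√s) 0) s :=
    fun s hs => hA.hasDerivAt_gaussianAverage_sqrt hs.1 0
  obtain ⟨s, hs, hs'⟩ := exists_hasDerivAt_eq_slope _ _ hr hcont'.continuousOn hder
  have h1 : q < 1 / 2 * gaussianAverage (Laplacian.laplacian A) (√s) 0 := by
    refine hδq ?_
    rw [Real.dist_eq, sub_zero, abs_of_pos hs.1]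
    linarith [hs.2]
  have h2 := h r hr hrT
  rw [eq_div_iff (by linarith)] at hs'
  simp only [Real.sqrt_zero, gaussianAverage_zero, sub_zero] at hs'
  have h3 := mul_lt_mul_of_pos_right h1 hr
  linarith

theorem integral_mul_gaussianAverage {w h : Eucl d → ℝ} (hw : Continuous w) {Bw : ℝ}
    (hBw : ∀ x, |w x| ≤ Bw) (hh : Continuous h) (hi : Integrable h) (s : ℝ) :
    ∫ z, gaussianDensity z * ∫ x, h x * w (x + s • z) = ∫ x, h x * gaussianAverage w s x := by
  have hcg := continuous_gaussianDensity (d := d)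
  have hmeas : Continuous (fun p : Eucl d × Eucl d =>
      gaussianDensity p.1 * (h p.2 * w (p.2 + s • p.1))) := by
    fun_prop
  have hint : Integrable (fun p : Eucl d × Eucl d =>
      gaussianDensity p.1 * (h p.2 * w (p.2 + s • p.1))) (volume.prod volume) := by
    refine ((integrable_gaussianDensity (d := d)).mul_prod (hi.norm.mul_const Bw)).mono'
      hmeas.aestronglyMeasurable (Eventually.of_forall fun p => ?_)
    rw [norm_mul, norm_mul, Real.norm_of_nonneg (gaussianDensity_nonneg _)]
    have := gaussianDensity_nonneg p.1
    gcongr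
    exact hBw _
  have hsw := integral_integral_swap (f := fun (z x : Eucl d) =>
    gaussianDensity z * (h x * w (x + s • z))) hint
  simp only [← integral_const_mul]
  rw [hsw]
  congr 1
  ext x
  rw [gaussianAverage, ← integral_const_mul]
  congr 1
  ext z
  simp only [smul_eq_mul]
  ring

/-- A viscosity supersolution of `Δw / 2 ≤ G` is a distributional one. -/
theorem integral_laplacian_le_of_touching {w G Gt : Eucl d → ℝ} (hw : UniformContinuous w) {Bw : ℝ}
    (hBw : ∀ x, |w x| ≤ Bw)
    (htouch : ∀ (x : Eucl d) (ϕ : Eucl d → ℝ), ContDiff ℝ 2 ϕ → ϕ x = w x → (∀ y, ϕ y ≤ w y) →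
      (1 / 2 : ℝ) * Laplacian.laplacian ϕ x ≤ G x)
    (hGt : IsBoundedC2 Gt) (hG : ∀ x, G x ≤ Gt x) {h : Eucl d → ℝ} (hh : ContDiff ℝ ∞ h)
    (hc : HasCompactSupport h) (h0 : ∀ x, 0 ≤ h x) :
    (1 / 2 : ℝ) * ∫ x, w x * Laplacian.laplacian h x ≤ ∫ x, Gt x * h x := by
  have hwc := hw.continuous
  have hGc := hGt.contDiff.continuous
  set k : Eucl d → ℝ := fun u => h (-u) with hk
  have hkd : ContDiff ℝ ∞ k := hh.comp contDiff_neg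
  have hks : HasCompactSupport k := hc.comp_homeomorph (Homeomorph.neg _)
  -- The correlation A(v) = ∫ h(x) w(x + v) dx is smooth even though w is only continuous. Its
  -- Laplacian at 0 is ∫ w Δh, and by Fubini its heat flow at 0 is h integrated against the heat
  -- flow of w, to which the comparison applies.
  set A := convolution w k (lsmul ℝ ℝ) volume with hA
  have hA2 : IsBoundedC2 A := isBoundedC2_convolution hwc.locallyIntegrable hBw hkd hks (lsmul ℝ ℝ)
  have hAe : ∀ v, A v = ∫ x, h x * w (x + v) := by
    intro v
    rw [hA, convolution_lsmul, ← integral_add_right_eq_self _ v]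
    congr 1
    ext x
    simp [hk, mul_comm]
  have hlapA : Laplacian.laplacian A 0 = ∫ x, w x * Laplacian.laplacian h x := by
    rw [hA, laplacian_convolution hwc.locallyIntegrable hkd hks]
    congr 1
    ext y
    rw [hk, laplacian_comp_neg hh]
    simp
  have hhi : Integrable h := hh.continuous.integrable_of_hasCompactSupport hc
  have hwh : ∀ v, Integrable fun x => h x * w (x + v) := fun v =>
    Continuous.integrable_of_hasCompactSupport (by have := hh.continuous; fun_prop) hc.mul_right
  have hGh : Integrable fun x => Gt x * h x :=
    Continuous.integrable_of_hasCompactSupport (by have := hh.continuous; fun_prop) hc.mul_left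
  refine le_of_forall_pos_le_add fun ε hε => ?_
  have hη : 0 < ε / (1 + ∫ x, h x) := by
    have : 0 ≤ ∫ x, h x := integral_nonneg h0
    positivity
  obtain ⟨T, hT, hcomp⟩ := gaussianAverage_le_of_touching' hw hBw htouch hGt hG hη
  have hηh : ε / (1 + ∫ x, h x) * ∫ x, h x ≤ ε := by
    have : 0 ≤ ∫ x, h x := integral_nonneg h0
    rw [div_mul_eq_mul_div, div_le_iff₀ (by positivity)]
    nlinarith
  set q := ∫ x, Gt x * h x + ε / (1 + ∫ x, h x) * h x with hq
  have hqe : q ≤ (∫ x, Gt x * h x) + ε := by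
    rw [hq, integral_add hGh (hhi.const_mul _), integral_const_mul]
    linarith
  refine le_trans ?_ hqe
  have hbound : ∀ t, 0 < t → t ≤ T → gaussianAverage A (√t) 0 - A 0 ≤ t * q := by
    intro t ht htT
    have e1 : gaussianAverage A (√t) 0 = ∫ x, h x * gaussianAverage w (√t) x := by
      rw [← integral_mul_gaussianAverage hwc hBw hh.continuous hhi, gaussianAverage]
      simp only [zero_add, hAe, smul_eq_mul]
    have hgc : Continuous fun x => gaussianAverage w (√t) x :=
      (continuous_gaussianAverage hwc hBw).comp (Continuous.prodMk_right (√t))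
    have e2 : A 0 = ∫ x, h x * w x := by rw [hAe]; simp
    have hwh0 := hwh 0
    simp only [add_zero] at hwh0
    have i1 : Integrable fun x => h x * gaussianAverage w (√t) x :=
      Continuous.integrable_of_hasCompactSupport (by have := hh.continuous; fun_prop) hc.mul_right
    rw [e1, e2, ← integral_sub i1 hwh0, hq, ← integral_const_mul]
    refine integral_mono (i1.sub hwh0) ((hGh.add (hhi.const_mul _)).const_mul t) fun x => ?_
    have := mul_le_mul_of_nonneg_left (hcomp t ht htT x) (h0 x)
    simp only
    linarith
  rw [← hlapA]
  exact laplacian_le_of_gaussianAverage_le hA2 hT hbound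

end Comparison

/-! ### Second order conditions at a minimum -/

section SecondDerivativeTest

variable {d : ℕ}

/-- A negative second derivative would make the point a local maximum as well; the function would be
locally constant and the second derivative zero. -/
theorem IsLocalMin.deriv_deriv_nonneg {f : ℝ → ℝ} {x : ℝ} (h : IsLocalMin f x)
    (hc : ContinuousAt f x) : 0 ≤ deriv (deriv f) x := by
  by_contra! hlt
  have h1 := isLocalMax_of_deriv_deriv_neg hlt h.deriv_eq_zero hc
  have h2 : f =ᶠ[𝓝 x] fun _ => f x := by
    filter_upwards [h, h1] with y hy hy'
    exact le_antisymm hy' hy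
  have h3 : deriv f =ᶠ[𝓝 x] fun _ => 0 := by
    refine h2.deriv.trans (Eventually.of_forall fun y => ?_)
    simp
  rw [h3.deriv_eq] at hlt
  simp at hlt

theorem IsLocalMin.laplacian_nonneg {f : Eucl d → ℝ} {x : Eucl d} (hf : ContDiff ℝ 2 f)
    (h : IsLocalMin f x) : 0 ≤ Laplacian.laplacian f x := by
  rw [laplacian_eq_sum_fderiv_fderiv]
  refine Finset.sum_nonneg fun i _ => ?_
  set e := EuclideanSpace.basisFun (Fin d) ℝ i
  have h1 : ∀ t : ℝ, HasDerivAt (fun t : ℝ => x + t • e) e t := fun t => by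
    simpa using ((hasDerivAt_id t).smul_const e).const_add x
  have hf1 : ContDiff ℝ 1 (fderiv ℝ f) := hf.fderiv_right (by norm_num)
  have e1 : deriv (fun t : ℝ => f (x + t • e)) = fun t => fderiv ℝ f (x + t • e) e :=
    funext fun t => (((hf.differentiable (by norm_num)) _).hasFDerivAt.comp_hasDerivAt t
      (h1 t)).deriv
  have e2 : deriv (fun t : ℝ => fderiv ℝ f (x + t • e) e) 0 =
      fderiv ℝ (fderiv ℝ f) x e e := by
    have h2 : HasDerivAt (fun t : ℝ => fderiv ℝ f (x + t • e))
        (fderiv ℝ (fderiv ℝ f) (x + (0 : ℝ) • e) e) 0 :=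
      ((hf1.differentiable (by simp)) _).hasFDerivAt.comp_hasDerivAt 0 (h1 0)
    have h3 : HasDerivAt (fun t : ℝ => fderiv ℝ f (x + t • e) e)
        (fderiv ℝ (fderiv ℝ f) (x + (0 : ℝ) • e) e e) 0 := by
      have := h2.clm_apply (hasDerivAt_const (0 : ℝ) e)
      simpa using this
    rw [h3.deriv]
    simp
  have h4 : IsLocalMin (fun t : ℝ => f (x + t • e)) 0 := by
    have h5 : Tendsto (fun t : ℝ => x + t • e) (𝓝 0) (𝓝 x) := by
      have := (h1 0).continuousAt.tendsto
      simpa using this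
    have h6 := h5.eventually h
    unfold IsLocalMin IsMinFilter
    simpa using h6
  have h7 := h4.deriv_deriv_nonneg
    ((hf.continuous.comp (continuous_const.add (continuous_id.smul continuous_const))).continuousAt)
  rwa [e1, e2] at h7

theorem laplacian_comp_add_right {f : Eucl d → ℝ} (v x : Eucl d) :
    Laplacian.laplacian (fun z => f (z + v)) x = Laplacian.laplacian f (x + v) := by
  rw [laplacian_eq_sum_fderiv_fderiv, laplacian_eq_sum_fderiv_fderiv]
  have e1 : fderiv ℝ (fun z => f (z + v)) = fun z => fderiv ℝ f (z + v) :=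
    funext fun z => fderiv_comp_add_right v
  rw [e1, fderiv_comp_add_right]

end SecondDerivativeTest

/-! ### Inf-convolutions of bounded lower semicontinuous functions -/

section InfConvolution

variable {d : ℕ}

/-- A lower semicontinuous function with values in `[a, b]`. -/
structure IsBoundedLSC (w : Eucl d → ℝ) (a b : ℝ) : Prop where
  lsc : LowerSemicontinuous w
  ge : ∀ x, a ≤ w x
  le : ∀ x, w x ≤ b

/-- The inf-convolution (Moreau envelope) of `w`. -/
noncomputable def infConvolution (w : Eucl d → ℝ) (ε : ℝ) (x : Eucl d) : ℝ :=
  ⨅ y, (w y + ‖x - y‖ ^ 2 / (2 * ε))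

namespace IsBoundedLSC

variable {w : Eucl d → ℝ} {a b ε : ℝ} (hw : IsBoundedLSC w a b)
include hw

theorem bddBelow (hε : 0 < ε) (x : Eucl d) :
    BddBelow (Set.range fun y => w y + ‖x - y‖ ^ 2 / (2 * ε)) := by
  refine ⟨a, ?_⟩
  rintro _ ⟨y, rfl⟩
  have := hw.ge y
  have : 0 ≤ ‖x - y‖ ^ 2 / (2 * ε) := by positivity
  simp only
  linarith

theorem infConvolution_le (hε : 0 < ε) (x y : Eucl d) :
    infConvolution w ε x ≤ w y + ‖x - y‖ ^ 2 / (2 * ε) :=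
  ciInf_le (hw.bddBelow hε x) y

theorem infConvolution_le_self (hε : 0 < ε) (x : Eucl d) : infConvolution w ε x ≤ w x := by
  simpa using hw.infConvolution_le hε x x

theorem le_infConvolution (hε : 0 < ε) (x : Eucl d) : a ≤ infConvolution w ε x := by
  refine le_ciInf fun y => ?_
  have := hw.ge y
  have : 0 ≤ ‖x - y‖ ^ 2 / (2 * ε) := by positivity
  linarith

theorem infConvolution_le_bound (hε : 0 < ε) (x : Eucl d) : infConvolution w ε x ≤ b :=
  (hw.infConvolution_le_self hε x).trans (hw.le x)

theorem infConvolution_anti {ε' : ℝ} (hε : 0 < ε) (h : ε ≤ ε') (x : Eucl d) :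
    infConvolution w ε' x ≤ infConvolution w ε x := by
  refine le_ciInf fun y => (hw.infConvolution_le (hε.trans_le h) x y).trans ?_
  gcongr

theorem osc_nonneg : 0 ≤ b - a := by linarith [hw.ge 0, hw.le 0]

theorem lowerSemicontinuous_penalized (ε : ℝ) :
    LowerSemicontinuous fun p : Eucl d × Eucl d => w p.2 + ‖p.1 - p.2‖ ^ 2 / (2 * ε) := by
  have h1 : LowerSemicontinuous fun p : Eucl d × Eucl d => w p.2 :=
    LowerSemicontinuous.comp hw.lsc continuous_snd
  have h2 : Continuous fun p : Eucl d × Eucl d => ‖p.1 - p.2‖ ^ 2 / (2 * ε) := by fun_prop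
  exact h1.add h2.lowerSemicontinuous

/-- Outside the ball of radius √(2ε(b - a)) the penalty alone is at least the oscillation b - a, so
the infimum is taken over a compact set. -/
theorem exists_infConvolution_eq (hε : 0 < ε) (x : Eucl d) :
    ∃ y, infConvolution w ε x = w y + ‖x - y‖ ^ 2 / (2 * ε) := by
  have hls : LowerSemicontinuous fun y => w y + ‖x - y‖ ^ 2 / (2 * ε) :=
    LowerSemicontinuous.comp (hw.lowerSemicontinuous_penalized ε)
      (Continuous.prodMk_right x)
  set r := √(2 * ε * (b - a)) with hr
  obtain ⟨y, hy, hmin⟩ := (hls.lowerSemicontinuousOn (Metric.closedBall x r)).exists_isMinOn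
    ⟨x, Metric.mem_closedBall_self (Real.sqrt_nonneg _)⟩ (isCompact_closedBall x r)
  refine ⟨y, le_antisymm (hw.infConvolution_le hε x y) (le_ciInf fun z => ?_)⟩
  rcases le_or_gt (dist z x) r with hz | hz
  · exact hmin (Metric.mem_closedBall.2 hz)
  · have h1 : w y + ‖x - y‖ ^ 2 / (2 * ε) ≤ w x + ‖x - x‖ ^ 2 / (2 * ε) :=
      hmin (Metric.mem_closedBall_self (Real.sqrt_nonneg _))
    have h2 : b - a ≤ ‖x - z‖ ^ 2 / (2 * ε) := by
      rw [le_div_iff₀ (by positivity)]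
      rw [dist_comm, dist_eq_norm] at hz
      rw [Real.sqrt_lt' ((Real.sqrt_nonneg _).trans_lt hz)] at hz
      linarith
    have h3 := hw.ge z
    have h4 := hw.le x
    simp only [sub_self, norm_zero] at h1
    norm_num at h1
    linarith

theorem norm_sq_le_of_eq (hε : 0 < ε) {x y : Eucl d}
    (h : infConvolution w ε x = w y + ‖x - y‖ ^ 2 / (2 * ε)) :
    ‖x - y‖ ^ 2 ≤ 2 * ε * (b - a) := by
  have h1 := hw.infConvolution_le_bound hε x
  have h2 := hw.ge y
  have h3 : ‖x - y‖ ^ 2 / (2 * ε) ≤ b - a := by linarith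
  rw [div_le_iff₀ (by positivity)] at h3
  linarith

theorem norm_le_of_eq (hε : 0 < ε) {x y : Eucl d}
    (h : infConvolution w ε x = w y + ‖x - y‖ ^ 2 / (2 * ε)) :
    ‖x - y‖ ≤ √(2 * ε * (b - a)) :=
  Real.le_sqrt_of_sq_le (hw.norm_sq_le_of_eq hε h)

/-- At distance at most 1, the minimizer for one point is a competitor for the other; it lies within
ρ, so the penalty changes by at most (1 + 2ρ)/(2ε) times the distance. At larger distances the
oscillation b - a is enough. -/
theorem exists_lipschitzWith (hε : 0 < ε) : ∃ L, LipschitzWith L (infConvolution w ε) := by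
  set ρ := √(2 * ε * (b - a))
  have hρ : 0 ≤ ρ := Real.sqrt_nonneg _
  have hosc := hw.osc_nonneg
  refine ⟨Real.toNNReal ((1 + 2 * ρ) / (2 * ε) + (b - a)), LipschitzWith.of_le_add_mul _
    fun x x' => ?_⟩
  rw [Real.coe_toNNReal _ (by positivity), dist_eq_norm]
  have hn := norm_nonneg (x - x')
  rcases le_or_gt ‖x - x'‖ 1 with h1 | h1
  · obtain ⟨y, hy⟩ := hw.exists_infConvolution_eq hε x'
    have h2 := hw.infConvolution_le hε x y
    have h3 := hw.norm_le_of_eq hε hy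
    have h4 : ‖x - y‖ ≤ ‖x - x'‖ + ‖x' - y‖ := norm_sub_le_norm_sub_add_norm_sub x x' y
    have h5 : ‖x - y‖ ^ 2 / (2 * ε) - ‖x' - y‖ ^ 2 / (2 * ε) ≤
        (1 + 2 * ρ) / (2 * ε) * ‖x - x'‖ := by
      rw [← sub_div, div_mul_eq_mul_div]
      gcongr
      have h6 : ‖x - y‖ ^ 2 ≤ (‖x - x'‖ + ‖x' - y‖) ^ 2 := by gcongr
      nlinarith [mul_nonneg hn (sub_nonneg.2 h1), mul_nonneg hn (sub_nonneg.2 h3)]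
    have h7 : 0 ≤ (b - a) * ‖x - x'‖ := by positivity
    linarith
  · have h2 := hw.infConvolution_le_bound hε x
    have h3 := hw.le_infConvolution hε x'
    have h4 : b - a ≤ (b - a) * ‖x - x'‖ := le_mul_of_one_le_right hosc h1.le
    have h5 : 0 ≤ (1 + 2 * ρ) / (2 * ε) * ‖x - x'‖ := by positivity
    linarith

theorem tendsto_infConvolution {ε : ℕ → ℝ} (hε : ∀ n, 0 < ε n) (hlim : Tendsto ε atTop (𝓝 0))
    (x : Eucl d) : Tendsto (fun n => infConvolution w (ε n) x) atTop (𝓝 (w x)) := by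
  refine tendsto_order.2 ⟨fun c hc => ?_, fun c hc => Eventually.of_forall fun n =>
    (hw.infConvolution_le_self (hε n) x).trans_lt hc⟩
  obtain ⟨δ, hδ, hδc⟩ := Metric.eventually_nhds_iff.1 (hw.lsc x c hc)
  have h1 : Tendsto (fun n => 2 * ε n * (b - a)) atTop (𝓝 0) := by
    simpa using (hlim.const_mul 2).mul_const (b - a)
  filter_upwards [h1.eventually (gt_mem_nhds (show 0 < δ ^ 2 by positivity))] with n hn
  obtain ⟨y, hy⟩ := hw.exists_infConvolution_eq (hε n) x
  have h2 := hw.norm_sq_le_of_eq (hε n) hy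
  have h3 : ‖x - y‖ < δ := lt_of_pow_lt_pow_left₀ 2 hδ.le (by linarith)
  have h4 := hδc (y := y) (by rwa [dist_comm, dist_eq_norm])
  have h5 : 0 ≤ ‖x - y‖ ^ 2 / (2 * ε n) := by
    have := hε n
    positivity
  linarith

/-- The paraboloid centred at the minimizer y lies above the envelope and meets it at x, so it meets
φ there too and the gradients agree. Applied to the envelope itself at a point of differentiability,
this determines y. -/
theorem fderiv_eq_of_touching (hε : 0 < ε) {φ : Eucl d → ℝ} {x y : Eucl d}
    (hy : infConvolution w ε x = w y + ‖x - y‖ ^ 2 / (2 * ε)) (hφ : DifferentiableAt ℝ φ x)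
    (hx : φ x = infConvolution w ε x) (hle : ∀ z, φ z ≤ infConvolution w ε z) :
    gradient φ x = (1 / ε) • (x - y) := by
  have h1 : HasFDerivAt (fun z => ‖z - y‖ ^ 2 / (2 * ε)) ((1 / ε) • innerSL ℝ (x - y)) x := by
    have h2 : HasFDerivAt (fun z : Eucl d => z - y) (ContinuousLinearMap.id ℝ _) x :=
      (hasFDerivAt_id x).sub_const y
    simp only [div_eq_mul_inv]
    refine (h2.norm_sq.mul_const _).congr_fderiv ?_
    ext v
    simp
    field_simp
  have h3 : IsLocalMin (fun z => ‖z - y‖ ^ 2 / (2 * ε) - φ z) x := by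
    refine Eventually.of_forall fun z => ?_
    have := hw.infConvolution_le hε z y
    have := hle z
    simp only
    linarith
  have h4 := h3.hasFDerivAt_eq_zero (h1.sub hφ.hasFDerivAt)
  have h5 : fderiv ℝ φ x = innerSL ℝ ((1 / ε) • (x - y)) := by
    rw [map_smul]
    exact (sub_eq_zero.1 h4).symm
  rw [gradient, h5]
  exact (InnerProductSpace.toDual ℝ (Eucl d)).symm_apply_apply _

/-- The second order comparison with the same paraboloid: semiconcavity of the envelope. -/
theorem laplacian_le_of_touching (hε : 0 < ε) {φ : Eucl d → ℝ} {x y : Eucl d}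
    (hy : infConvolution w ε x = w y + ‖x - y‖ ^ 2 / (2 * ε)) (hφ : ContDiff ℝ 2 φ)
    (hx : φ x = infConvolution w ε x) (hle : ∀ z, φ z ≤ infConvolution w ε z) :
    Laplacian.laplacian φ x ≤ d / ε := by
  have c1 : ContDiff ℝ 2 fun z : Eucl d => ‖z + -y‖ ^ 2 :=
    (contDiff_id.add contDiff_const).norm_sq ℝ
  have c2 : ContDiff ℝ 2 ((1 / (2 * ε)) • fun z : Eucl d => ‖z + -y‖ ^ 2) :=
    c1.const_smul (1 / (2 * ε))
  have h3 : IsLocalMin (((1 / (2 * ε)) • fun z : Eucl d => ‖z + -y‖ ^ 2) - φ) x := by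
    refine Eventually.of_forall fun z => ?_
    have h1 := hw.infConvolution_le hε z y
    have h2 := hle z
    simp only [Pi.sub_apply, Pi.smul_apply, smul_eq_mul, ← sub_eq_add_neg]
    rw [one_div_mul_eq_div, one_div_mul_eq_div]
    linarith
  have c3 : ContDiff ℝ 2 (((1 / (2 * ε)) • fun z : Eucl d => ‖z + -y‖ ^ 2) - φ) := c2.sub hφ
  have h4 := IsLocalMin.laplacian_nonneg c3 h3
  rw [ContDiffAt.laplacian_sub c2.contDiffAt hφ.contDiffAt,
    InnerProductSpace.laplacian_smul _ c1.contDiffAt,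
    laplacian_comp_add_right (f := fun z => ‖z‖ ^ 2), laplacian_norm_sq] at h4
  have h5 : (1 / (2 * ε)) • (2 * (d : ℝ)) = d / ε := by
    rw [smul_eq_mul]
    field_simp
  linarith

end IsBoundedLSC

/-- Viscosity supersolutions of `Δw / 2 + K (x, ∇w) ≤ 0`, tested globally. -/
def IsRealViscositySupersolution (K : Eucl d → Eucl d → ℝ) (w : Eucl d → ℝ) : Prop :=
  ∀ (x : Eucl d) (φ : Eucl d → ℝ), ContDiff ℝ 2 φ → φ x = w x → (∀ y, φ y ≤ w y) →
    (1 / 2 : ℝ) * Laplacian.laplacian φ x + K x (gradient φ x) ≤ 0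

/-- Translated by x - y and lowered by the penalty, φ touches w from below at y with unchanged
derivatives. The inequality for w at y thus holds for the envelope at x, but with K evaluated at y.
-/
theorem IsBoundedLSC.laplacian_le_hamiltonian {w : Eucl d → ℝ} {a b ε : ℝ}
    (hw : IsBoundedLSC w a b) {K : Eucl d → Eucl d → ℝ} (hv : IsRealViscositySupersolution K w)
    (hε : 0 < ε) {φ : Eucl d → ℝ} {x y : Eucl d}
    (hy : infConvolution w ε x = w y + ‖x - y‖ ^ 2 / (2 * ε)) (hφ : ContDiff ℝ 2 φ)
    (hx : φ x = infConvolution w ε x) (hle : ∀ z, φ z ≤ infConvolution w ε z) :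
    (1 / 2 : ℝ) * Laplacian.laplacian φ x ≤ -K y ((1 / ε) • (x - y)) := by
  have hg := hw.fderiv_eq_of_touching hε hy (hφ.differentiable (by norm_num) x) hx hle
  have c1 : ContDiff ℝ 2 fun z => φ (z + (x - y)) := hφ.comp (contDiff_id.add contDiff_const)
  have c2 : ContDiff ℝ 2 fun _ : Eucl d => -(‖x - y‖ ^ 2 / (2 * ε)) := contDiff_const
  have h1 := hv y ((fun z => φ (z + (x - y))) + fun _ => -(‖x - y‖ ^ 2 / (2 * ε))) (c1.add c2)
    (by simp [hx, hy]) fun z => by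
      have h2 := hle (z + (x - y))
      have h3 := hw.infConvolution_le hε (z + (x - y)) z
      rw [add_sub_cancel_left] at h3
      simp only [Pi.add_apply]
      linarith
  have h4 : gradient ((fun z => φ (z + (x - y))) + fun _ => -(‖x - y‖ ^ 2 / (2 * ε))) y =
      gradient φ x := by
    have e : ((fun z => φ (z + (x - y))) + fun _ => -(‖x - y‖ ^ 2 / (2 * ε))) =
      fun z => (fun z => φ (z + (x - y))) z + -(‖x - y‖ ^ 2 / (2 * ε)) := rfl
    rw [gradient, gradient, e, fderiv_add_const, fderiv_comp_add_right, add_sub_cancel]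
  rw [h4, hg, ContDiffAt.laplacian_add c1.contDiffAt c2.contDiffAt, laplacian_comp_add_right,
    InnerProductSpace.laplacian_const, add_sub_cancel] at h1
  simp only [Pi.zero_apply, add_zero] at h1
  linarith

end InfConvolution

/-! ### Continuity of the minimizers -/

section Selection

variable {d : ℕ} {w : Eucl d → ℝ} {a b ε : ℝ}

/-- Near a point of differentiability of the inf-convolution, the minimizers vary continuously. -/
theorem IsBoundedLSC.continuousAt_minimizer (hw : IsBoundedLSC w a b) (hε : 0 < ε)
    {Y : Eucl d → Eucl d} (hY : ∀ x, infConvolution w ε x = w (Y x) + ‖x - Y x‖ ^ 2 / (2 * ε))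
    {x : Eucl d} (hx : DifferentiableAt ℝ (infConvolution w ε) x) : ContinuousAt Y x := by
  have hcont : Continuous (infConvolution w ε) := (hw.exists_lipschitzWith hε).choose_spec.continuous
  refine IsCompact.tendsto_nhds_of_unique_mapClusterPt
    (isCompact_closedBall x (1 + √(2 * ε * (b - a)))) ?_ fun v _ hv => ?_
  · filter_upwards [Metric.closedBall_mem_nhds x one_pos] with x' hx'
    rw [Metric.mem_closedBall] at hx' ⊢
    have h1 := hw.norm_le_of_eq hε (hY x')
    rw [← dist_eq_norm, dist_comm] at h1
    linarith [dist_triangle (Y x') x' x]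
  -- By lower semicontinuity a cluster point v of nearby minimizers is a minimizer at x. The
  -- gradient of the envelope at x equals (x - v)/ε, so there is only one.
  · obtain ⟨U, hU, hUv⟩ := mapClusterPt_iff_ultrafilter.1 hv
    have hpair : Tendsto (fun x' => (x', Y x')) U (𝓝 (x, v)) :=
      (show Tendsto (fun x' => x') (U : Filter (Eucl d)) (𝓝 x) from hU).prodMk_nhds hUv
    have hle : w v + ‖x - v‖ ^ 2 / (2 * ε) ≤ infConvolution w ε x := by
      refine le_of_forall_lt_imp_le_of_dense fun c hc => ?_
      have h1 := hpair.eventually (hw.lowerSemicontinuous_penalized ε (x, v) c hc)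
      refine ge_of_tendsto ((hcont.tendsto x).mono_left hU) ?_
      filter_upwards [h1] with x' hx'
      rw [hY x']
      exact hx'.le
    have heq := le_antisymm (hw.infConvolution_le hε x v) hle
    have e1 := hw.fderiv_eq_of_touching hε heq hx rfl fun _ => le_rfl
    have e2 := hw.fderiv_eq_of_touching hε (hY x) hx rfl fun _ => le_rfl
    have h3 := smul_right_injective _ (one_div_pos.2 hε).ne' (e1.symm.trans e2)
    exact sub_right_injective h3

end Selection

/-! ### Right-hand sides that are continuous almost everywhere -/

section SupConvolution

variable {d : ℕ}

/-- The largest `n`-Lipschitz regularization from above. -/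
noncomputable def lipschitzMajorant (G : Eucl d → ℝ) (n : ℕ) (x : Eucl d) : ℝ :=
  ⨆ y, (G y - n * ‖x - y‖)

variable {G : Eucl d → ℝ} {B : ℝ} (hG : ∀ x, |G x| ≤ B)
include hG

theorem bddAbove_lipschitzMajorant (n : ℕ) (x : Eucl d) :
    BddAbove (Set.range fun y => G y - n * ‖x - y‖) := by
  refine ⟨B, ?_⟩
  rintro _ ⟨y, rfl⟩
  have := (abs_le.1 (hG y)).2
  have : 0 ≤ n * ‖x - y‖ := by positivity
  simp only
  linarith

theorem le_lipschitzMajorant (n : ℕ) (x : Eucl d) : G x ≤ lipschitzMajorant G n x := by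
  have h : G x - n * ‖x - x‖ ≤ lipschitzMajorant G n x :=
    le_ciSup (bddAbove_lipschitzMajorant hG n x) x
  simpa using h

theorem abs_lipschitzMajorant_le (n : ℕ) (x : Eucl d) : |lipschitzMajorant G n x| ≤ B := by
  refine abs_le.2 ⟨(abs_le.1 (hG x)).1.trans (le_lipschitzMajorant hG n x), ciSup_le fun y => ?_⟩
  have := (abs_le.1 (hG y)).2
  have : 0 ≤ n * ‖x - y‖ := by positivity
  linarith

theorem lipschitzWith_lipschitzMajorant (n : ℕ) : LipschitzWith n (lipschitzMajorant G n) := by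
  refine LipschitzWith.of_le_add_mul _ fun x x' => ciSup_le fun y => ?_
  have h1 := le_ciSup (bddAbove_lipschitzMajorant hG n x') y
  have h2 : n * ‖x' - y‖ ≤ n * (‖x - y‖ + dist x x') := by
    gcongr
    rw [dist_eq_norm, add_comm, norm_sub_rev x x']
    exact norm_sub_le_norm_sub_add_norm_sub x' x y
  change _ ≤ (⨆ y, (G y - n * ‖x' - y‖)) + _
  simp only [NNReal.coe_natCast]
  linarith

theorem tendsto_lipschitzMajorant {x : Eucl d} (hx : ContinuousAt G x) :
    Tendsto (fun n => lipschitzMajorant G n x) atTop (𝓝 (G x)) := by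
  refine tendsto_order.2 ⟨fun c hc => Eventually.of_forall fun n =>
    hc.trans_le (le_lipschitzMajorant hG n x), fun c hc => ?_⟩
  obtain ⟨c', hc', hcc'⟩ := exists_between hc
  obtain ⟨δ, hδ, hδc⟩ := Metric.eventually_nhds_iff.1 (hx.eventually (gt_mem_nhds hc'))
  have h1 : Tendsto (fun n : ℕ => (n : ℝ) * δ) atTop atTop :=
    tendsto_natCast_atTop_atTop.atTop_mul_const hδ
  filter_upwards [h1.eventually_ge_atTop (B - c')] with n hn
  refine lt_of_le_of_lt (ciSup_le fun y => ?_) hcc'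
  rcases lt_or_ge (dist y x) δ with hy | hy
  · have := hδc hy
    have : 0 ≤ n * ‖x - y‖ := by positivity
    linarith
  · have h2 := (abs_le.1 (hG y)).2
    rw [dist_comm, dist_eq_norm] at hy
    have : n * δ ≤ n * ‖x - y‖ := by gcongr
    linarith

omit hG

theorem IsBoundedC2.add_const {φ : Eucl d → ℝ} (hφ : IsBoundedC2 φ) (c : ℝ) :
    IsBoundedC2 fun x => φ x + c := by
  obtain ⟨B, hB⟩ := hφ.bdd
  have e : fderiv ℝ (fun x => φ x + c) = fderiv ℝ φ := funext fun x => fderiv_add_const c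
  refine ⟨hφ.contDiff.add contDiff_const, ⟨B + ‖c‖, fun x => (norm_add_le _ _).trans (by
    gcongr; exact hB x)⟩, ?_, ?_⟩
  · rw [e]; exact hφ.bdd_fderiv
  · rw [e]; exact hφ.bdd_fderiv_fderiv

/-- A mollification of Gs within σ, raised by σ, is a C² majorant of G, and σ is arbitrary. -/
theorem integral_laplacian_le_of_touching_uniformContinuous {w G Gs : Eucl d → ℝ}
    (hw : UniformContinuous w) {Bw : ℝ} (hBw : ∀ x, |w x| ≤ Bw)
    (htouch : ∀ (x : Eucl d) (ϕ : Eucl d → ℝ), ContDiff ℝ 2 ϕ → ϕ x = w x → (∀ y, ϕ y ≤ w y) →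
      (1 / 2 : ℝ) * Laplacian.laplacian ϕ x ≤ G x)
    (hGs : UniformContinuous Gs) {B : ℝ} (hB : ∀ x, |Gs x| ≤ B) (hG : ∀ x, G x ≤ Gs x)
    {h : Eucl d → ℝ} (hh : ContDiff ℝ ∞ h) (hc : HasCompactSupport h) (h0 : ∀ x, 0 ≤ h x) :
    (1 / 2 : ℝ) * ∫ x, w x * Laplacian.laplacian h x ≤ ∫ x, Gs x * h x := by
  refine le_of_forall_pos_le_add fun ε hε => ?_
  have hhi : Integrable h := hh.continuous.integrable_of_hasCompactSupport hc
  have hGi : Integrable fun x => Gs x * h x :=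
    (hGs.continuous.mul hh.continuous).integrable_of_hasCompactSupport hc.mul_left
  have hI : 0 ≤ ∫ x, h x := integral_nonneg h0
  obtain ⟨σ, hσ, hσε⟩ : ∃ σ > 0, 2 * σ * ∫ x, h x ≤ ε := by
    refine ⟨ε / (2 * (1 + ∫ x, h x)), by positivity, ?_⟩
    rw [mul_div_assoc', div_mul_eq_mul_div, div_le_iff₀ (by positivity)]
    nlinarith
  obtain ⟨φ, hφ, hφG⟩ := exists_isBoundedC2_approx hGs hB hσ
  have h1 := integral_laplacian_le_of_touching hw hBw htouch (hφ.add_const σ)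
    (fun x => by linarith [hG x, (abs_le.1 (hφG x)).1]) hh hc h0
  refine h1.trans ?_
  have hφi : Integrable fun x => (φ x + σ) * h x :=
    ((hφ.contDiff.continuous.add continuous_const).mul
      hh.continuous).integrable_of_hasCompactSupport hc.mul_left
  calc _ ≤ ∫ x, (Gs x * h x + 2 * σ * h x) := by
        refine integral_mono hφi (hGi.add (hhi.const_mul _)) fun x => ?_
        have := mul_le_mul_of_nonneg_right
          (show φ x + σ ≤ Gs x + 2 * σ by linarith [(abs_le.1 (hφG x)).2]) (h0 x)
        simp only
        linarith
    _ = (∫ x, Gs x * h x) + 2 * σ * ∫ x, h x := by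
        rw [integral_add hGi (hhi.const_mul _), integral_const_mul]
    _ ≤ _ := by linarith

/-- A viscosity inequality cannot be altered on null sets, so the right-hand side must be majorized
everywhere. The Lipschitz majorants do this and still converge to G at its points of continuity,
that is, almost everywhere. -/
theorem integral_laplacian_le_of_touching_ae_continuous {w G : Eucl d → ℝ}
    (hw : UniformContinuous w) {Bw : ℝ} (hBw : ∀ x, |w x| ≤ Bw)
    (htouch : ∀ (x : Eucl d) (ϕ : Eucl d → ℝ), ContDiff ℝ 2 ϕ → ϕ x = w x → (∀ y, ϕ y ≤ w y) →
      (1 / 2 : ℝ) * Laplacian.laplacian ϕ x ≤ G x)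
    {B : ℝ} (hG : ∀ x, |G x| ≤ B) (hGc : ∀ᵐ x, ContinuousAt G x)
    {h : Eucl d → ℝ} (hh : ContDiff ℝ ∞ h) (hc : HasCompactSupport h) (h0 : ∀ x, 0 ≤ h x) :
    (1 / 2 : ℝ) * ∫ x, w x * Laplacian.laplacian h x ≤ ∫ x, G x * h x := by
  have hhi : Integrable h := hh.continuous.integrable_of_hasCompactSupport hc
  have hlim : Tendsto (fun n => ∫ x, lipschitzMajorant G n x * h x) atTop
      (𝓝 (∫ x, G x * h x)) := by
    refine tendsto_integral_of_dominated_convergence (fun x => B * ‖h x‖) (fun n => ?_)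
      (hhi.norm.const_mul B) (fun n => Eventually.of_forall fun x => ?_) ?_
    · exact ((lipschitzWith_lipschitzMajorant hG n).continuous.mul
        hh.continuous).aestronglyMeasurable
    · rw [norm_mul]
      gcongr
      exact abs_lipschitzMajorant_le hG n x
    · filter_upwards [hGc] with x hx
      exact (tendsto_lipschitzMajorant hG hx).mul_const _
  exact ge_of_tendsto' hlim fun n => integral_laplacian_le_of_touching_uniformContinuous hw hBw
    htouch (lipschitzWith_lipschitzMajorant hG n).uniformContinuous
    (abs_lipschitzMajorant_le hG n) (le_lipschitzMajorant hG n) hh hc h0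

end SupConvolution

/-! ### Inf-convolutions are Lipschitz weak supersolutions up to a small error -/

section Approximation

variable {d : ℕ}

/-- `f` is a Lipschitz weak supersolution of `Δf / 2 + K (x, ∇f) ≤ γ`. -/
def IsApproxSupersolution (K : Eucl d → Eucl d → ℝ) (γ : ℝ) (f : Eucl d → ℝ) : Prop :=
  ∀ (L : ℝ≥0) (h : Eucl d → ℝ), LipschitzWith L h → HasCompactSupport h → (∀ x, 0 ≤ h x) →
    ∫ x, (-(1 / 2 : ℝ) * inner ℝ (gradient f x) (gradient h x)
      + (K x (gradient f x) - γ) * h x) ≤ 0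

variable {K : Eucl d → Eucl d → ℝ} {R lam Lam C : ℝ}

theorem IsLinearHamiltonian.measurable_comp (hK : IsLinearHamiltonian K R lam Lam C)
    {p : Eucl d → Eucl d} (hp : Measurable p) : Measurable fun x => K x (p x) :=
  hK.continuous.measurable.comp (measurable_id.prodMk hp)

theorem IsLinearHamiltonian.aestronglyMeasurable_comp {μ : Measure (Eucl d)}
    (hK : IsLinearHamiltonian K R lam Lam C)
    {p : Eucl d → Eucl d} (hp : AEStronglyMeasurable p μ) :
    AEStronglyMeasurable (fun x => K x (p x)) μ :=
  hK.continuous.comp_aestronglyMeasurable (aestronglyMeasurable_id.prodMk hp)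

theorem IsLinearHamiltonian.integrable_mul (hK : IsLinearHamiltonian K R lam Lam C)
    {p : Eucl d → Eucl d} (hp : Measurable p) {B : ℝ} (hB : ∀ x, ‖p x‖ ≤ B) {h : Eucl d → ℝ}
    (hh : Continuous h) (hc : HasCompactSupport h) : Integrable fun x => K x (p x) * h x := by
  have hc1 : Continuous fun x : Eucl d => (Lam * B + C * (‖x‖ + 1)) * ‖h x‖ := by fun_prop
  refine (hc1.integrable_of_hasCompactSupport hc.norm.mul_left).mono'
    ((hK.measurable_comp hp).mul hh.measurable).aestronglyMeasurable
    (Eventually.of_forall fun x => ?_)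
  rw [norm_mul]
  have hLam := hK.Lam_pos
  gcongr
  refine (hK.abs_le x (p x)).trans ?_
  gcongr
  exact hB x

theorem IsLinearHamiltonian.integrable_sub_mul (hK : IsLinearHamiltonian K R lam Lam C)
    {p : Eucl d → Eucl d} (hp : Measurable p) {B : ℝ} (hB : ∀ x, ‖p x‖ ≤ B) {h : Eucl d → ℝ}
    (hh : Continuous h) (hc : HasCompactSupport h) (γ : ℝ) :
    Integrable fun x => (γ - K x (p x)) * h x := by
  simp only [sub_mul]
  exact ((hh.integrable_of_hasCompactSupport hc).const_mul γ).sub (hK.integrable_mul hp hB hh hc)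

/-- At almost every x the envelope is differentiable, its gradient is (x - Y x)/ε for the minimizer
Y x, and Y is continuous there. The inequality with K at Y x thus has an almost everywhere
continuous right-hand side and becomes distributional; replacing Y x by x in K costs γ. -/
theorem IsBoundedLSC.exists_laplacian_infConvolution_le {w : Eucl d → ℝ} {a b : ℝ}
    (hw : IsBoundedLSC w a b) (hK : IsLinearHamiltonian K R lam Lam C)
    (hv : IsRealViscositySupersolution K w) {γ : ℝ} (hγ : 0 < γ) :
    ∃ ε₀ > 0, ∀ ε, 0 < ε → ε < ε₀ → ∀ h : Eucl d → ℝ, ContDiff ℝ ∞ h → HasCompactSupport h →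
      (∀ x, 0 ≤ h x) → (1 / 2 : ℝ) * ∫ x, infConvolution w ε x * Laplacian.laplacian h x ≤
        ∫ x, (γ - K x (gradient (infConvolution w ε) x)) * h x := by
  obtain ⟨δ, hδ, hδK⟩ := hK.uniform γ hγ
  have hosc := hw.osc_nonneg
  -- Minimizers satisfy |x - Y x|² ≤ 2ε(b - a), which this choice keeps below δ².
  refine ⟨δ ^ 2 / (2 * (b - a + 1)), by positivity, fun ε hε hεδ h hh hc h0 => ?_⟩
  obtain ⟨L, hL⟩ := hw.exists_lipschitzWith hε
  choose Y hY using fun x => hw.exists_infConvolution_eq hε x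
  have hYx : ∀ x, dist (Y x) x < δ := fun x => by
    have h1 := hw.norm_sq_le_of_eq hε (hY x)
    rw [lt_div_iff₀ (by positivity)] at hεδ
    rw [dist_comm, dist_eq_norm]
    refine lt_of_pow_lt_pow_left₀ 2 hδ.le ?_
    nlinarith
  set ρ := √(2 * ε * (b - a)) with hρ
  have hρ0 : 0 ≤ ρ := Real.sqrt_nonneg _
  -- The coercivity bound lets -K grow linearly in space; the semiconcavity bound d/(2ε), equally
  -- valid, caps it, so that G is bounded.
  set G : Eucl d → ℝ := fun x => min (-K (Y x) ((1 / ε) • (x - Y x))) (d / (2 * ε)) with hG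
  have hLam := hK.Lam_pos
  have hGB : ∀ x, |G x| ≤ Lam * (1 / ε * ρ) + d / (2 * ε) := by
    intro x
    have h1 : (0 : ℝ) ≤ d / (2 * ε) := by positivity
    have h2 : 0 ≤ Lam * (1 / ε * ρ) := by positivity
    have h3 : K (Y x) ((1 / ε) • (x - Y x)) ≤ Lam * (1 / ε * ρ) := by
      refine (hK.upper _ _).trans ?_
      rw [norm_smul, Real.norm_of_nonneg (by positivity)]
      gcongr
      exact hw.norm_le_of_eq hε (hY x)
    rw [abs_le]
    constructor
    · exact le_min (by linarith) (by linarith)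
    · exact (min_le_right _ _).trans (by linarith)
  have hdiff : ∀ᵐ x : Eucl d, DifferentiableAt ℝ (infConvolution w ε) x := hL.ae_differentiableAt
  have hGc : ∀ᵐ x, ContinuousAt G x := by
    filter_upwards [hdiff] with x hx
    have hYc := hw.continuousAt_minimizer hε hY hx
    have h0 : ContinuousAt (fun x => (1 / ε) • (x - Y x)) x :=
      (continuousAt_id.sub hYc).const_smul (1 / ε)
    have h1 : ContinuousAt (fun x => (Y x, (1 / ε) • (x - Y x))) x := hYc.prodMk h0
    have h2 : ContinuousAt (fun x => K (Y x) ((1 / ε) • (x - Y x))) x :=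
      ContinuousAt.comp (g := fun p : Eucl d × Eucl d => K p.1 p.2)
        hK.continuous.continuousAt h1
    exact h2.neg.min continuousAt_const
  have hbd : ∀ x, |infConvolution w ε x| ≤ max |a| |b| := fun x =>
    abs_le_max_abs_abs (hw.le_infConvolution hε x) (hw.infConvolution_le_bound hε x)
  have htouch : ∀ (x : Eucl d) (ϕ : Eucl d → ℝ), ContDiff ℝ 2 ϕ → ϕ x = infConvolution w ε x →
      (∀ y, ϕ y ≤ infConvolution w ε y) → (1 / 2 : ℝ) * Laplacian.laplacian ϕ x ≤ G x := by
    intro x ϕ hϕ hx hle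
    refine le_min (hw.laplacian_le_hamiltonian hv hε (hY x) hϕ hx hle) ?_
    have h1 := hw.laplacian_le_of_touching hε (hY x) hϕ hx hle
    have h2 : (d : ℝ) / (2 * ε) = 1 / 2 * (d / ε) := by field_simp
    linarith
  have h1 := integral_laplacian_le_of_touching_ae_continuous hL.uniformContinuous hbd htouch hGB
    hGc hh hc h0
  refine h1.trans ?_
  have hpm : Measurable (gradient (infConvolution w ε)) := measurable_gradient _
  have hi2 := hK.integrable_sub_mul hpm hL.norm_gradient_le hh.continuous hc γ
  by_cases hi1 : Integrable fun x => G x * h x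
  · refine integral_mono_ae hi1 hi2 ?_
    filter_upwards [hdiff] with x hx
    refine mul_le_mul_of_nonneg_right ?_ (h0 x)
    have h3 := hw.fderiv_eq_of_touching hε (hY x) hx rfl fun _ => le_rfl
    have h4 := (abs_lt.1 (hδK (Y x) x ((1 / ε) • (x - Y x)) (hYx x))).1
    rw [h3]
    exact (min_le_left _ _).trans (by linarith)
  -- The selection `Y` comes from choice and carries no measurability. G is nevertheless measurable,
  -- as an almost everywhere limit of its Lipschitz majorants.
  · exfalso
    refine hi1 ((hh.continuous.integrable_of_hasCompactSupport hc).bdd_mul ?_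
      (Eventually.of_forall hGB))
    have hm : ∀ᵐ x, Tendsto (fun n => lipschitzMajorant G n x) atTop (𝓝 (G x)) := by
      filter_upwards [hGc] with x hx using tendsto_lipschitzMajorant hGB hx
    exact aestronglyMeasurable_of_tendsto_ae atTop
      (fun n => (lipschitzWith_lipschitzMajorant hGB n).continuous.aestronglyMeasurable) hm

/-- Later test functions contain f itself and the weight, which are only Lipschitz; a Lipschitz
function of compact support is reached from smooth ones by mollification in H¹. -/
theorem isApproxSupersolution_of_laplacian_le {f : Eucl d → ℝ} {L : ℝ≥0} (hf : LipschitzWith L f)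
    (hK : IsLinearHamiltonian K R lam Lam C) {γ : ℝ}
    (hγ : ∀ h : Eucl d → ℝ, ContDiff ℝ ∞ h → HasCompactSupport h →
      (∀ x, 0 ≤ h x) → (1 / 2 : ℝ) * ∫ x, f x * Laplacian.laplacian h x ≤
        ∫ x, (γ - K x (gradient f x)) * h x) : IsApproxSupersolution K γ f := by
  intro L' h hh hc h0
  have hpm : Measurable (gradient f) := measurable_gradient _
  have hKm := hK.measurable_comp hpm
  have hfin : ∀ r, IsFiniteMeasure (volume.restrict (Metric.closedBall (0 : Eucl d) r)) := fun r =>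
    isFiniteMeasure_restrict.2 (isCompact_closedBall 0 r).measure_ne_top
  have hp : ∀ r, MemLp (gradient f) 2 (volume.restrict (Metric.closedBall 0 r)) := fun r =>
    MemLp.of_bound hpm.aestronglyMeasurable L (Eventually.of_forall hf.norm_gradient_le)
  have hκ : ∀ r, MemLp (fun x => K x (gradient f x) - γ) 2
      (volume.restrict (Metric.closedBall 0 r)) := fun r => by
    refine MemLp.of_bound (hKm.sub measurable_const).aestronglyMeasurable
      (Lam * L + C * (r + 1) + |γ|) ?_
    refine (ae_restrict_iff' measurableSet_closedBall).2 (Eventually.of_forall fun x hx => ?_)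
    have h3 := hK.abs_le x (gradient f x)
    have hLam := hK.Lam_pos
    have hC := hK.C_pos
    have h4 : Lam * ‖gradient f x‖ ≤ Lam * L := by
      gcongr
      exact hf.norm_gradient_le x
    have h5 : C * (‖x‖ + 1) ≤ C * (r + 1) := by
      gcongr
      simpa using hx
    rw [Real.norm_eq_abs]
    refine (abs_sub _ _).trans ?_
    linarith
  have hmain := (integral_nonpos_of_forall_contDiff (V := fun _ => 0) continuous_const hp hκ ?_
    (hh.memSobolevV_of_hasCompactSupport continuous_const hc) hc h0).2
  · refine le_of_eq_of_le (integral_congr_ae ?_) hmain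
    filter_upwards [hh.hasWeakGradient.weakGradient_ae_eq] with x hx
    rw [hx]
  · intro h hh hc h0
    have h1 := hγ h hh hc h0
    have h2 := hf.hasWeakGradient.integral_inner_gradient hh hc
    have hcg : Continuous (gradient h) := hh.continuous_gradient (by simp)
    have i1 : Integrable fun x => -(1 / 2 : ℝ) * inner ℝ (gradient f x) (gradient h x) := by
      refine Integrable.const_mul ?_ _
      refine ((hcg.integrable_of_hasCompactSupport hc.gradient).norm.const_mul (L : ℝ)).mono'
        (hpm.inner hcg.measurable).aestronglyMeasurable (Eventually.of_forall fun x => ?_)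
      refine (norm_inner_le_norm _ _).trans ?_
      gcongr
      exact hf.norm_gradient_le x
    have i2 : Integrable fun x => (K x (gradient f x) - γ) * h x := by
      refine (hK.integrable_sub_mul hpm hf.norm_gradient_le hh.continuous hc γ).neg.congr
        (Eventually.of_forall fun x => ?_)
      simp only [Pi.neg_apply]
      ring
    rw [integral_add i1 i2, integral_const_mul, h2]
    have h5 : ∫ x, (K x (gradient f x) - γ) * h x = -∫ x, (γ - K x (gradient f x)) * h x := by
      rw [← integral_neg]
      congr 1
      ext x
      ring
    rw [h5]
    linarith

theorem hasLaplacianBound_of_laplacian_le {f : Eucl d → ℝ} {L : ℝ≥0} (hf : LipschitzWith L f)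
    (hK : IsLinearHamiltonian K R lam Lam C) {γ : ℝ} (hγ0 : 0 ≤ γ)
    (hγ : ∀ h : Eucl d → ℝ, ContDiff ℝ ∞ h → HasCompactSupport h →
      (∀ x, 0 ≤ h x) → (1 / 2 : ℝ) * ∫ x, f x * Laplacian.laplacian h x ≤
        ∫ x, (γ - K x (gradient f x)) * h x) : HasLaplacianBound f (C + γ) := by
  intro h hh hc h0
  refine (hγ h hh hc h0).trans ?_
  have hlam := hK.lam_pos
  have hC := hK.C_pos
  have hc1 : Continuous fun x : Eucl d => (C + γ) * (‖x‖ + 1) * h x := by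
    have := hh.continuous
    fun_prop
  refine integral_mono (hK.integrable_sub_mul (measurable_gradient f) hf.norm_gradient_le
    hh.continuous hc γ) (hc1.integrable_of_hasCompactSupport hc.mul_left) fun x => ?_
  refine mul_le_mul_of_nonneg_right ?_ (h0 x)
  have h1 := hK.lower x (gradient f x)
  have h2 : 0 ≤ lam * ‖gradient f x‖ := by positivity
  have h3 : 0 ≤ γ * ‖x‖ := by positivity
  linarith

end Approximation

/-! ### Testing with the exponential weight -/

section WeightedTest

variable {d : ℕ} {V : Eucl d → ℝ} {K : Eucl d → Eucl d → ℝ} {R lam Lam C : ℝ}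

theorem inner_gradient_eq_fderiv (p : Eucl d) (h : Eucl d → ℝ) (x : Eucl d) :
    inner ℝ p (gradient h x) = fderiv ℝ h x p := by
  rw [real_inner_comm, gradient, InnerProductSpace.toDual_symm_apply]

theorem IsWeight.lipschitzWith (hV : IsWeight V lam) : LipschitzWith (2 * lam).toNNReal V := by
  refine LipschitzWith.of_dist_le' fun x y => ?_
  rw [dist_eq_norm, dist_eq_norm]
  exact hV.lipschitz x y

theorem LipschitzWith.mul_of_bounded {f g : Eucl d → ℝ} {Lf Lg : ℝ≥0} {Bf Bg : ℝ}
    (hf : LipschitzWith Lf f) (hg : LipschitzWith Lg g) (hBf : ∀ x, |f x| ≤ Bf)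
    (hBg : ∀ x, |g x| ≤ Bg) :
    ∃ L, LipschitzWith L fun x => f x * g x := by
  refine ⟨(Bf * Lg + Bg * Lf).toNNReal, LipschitzWith.of_dist_le' fun x y => ?_⟩
  have h1 := hf.dist_le_mul x y
  have h2 := hg.dist_le_mul x y
  rw [Real.dist_eq] at h1 h2 ⊢
  calc |f x * g x - f y * g y| = |f x * (g x - g y) + (f x - f y) * g y| := by ring_nf
    _ ≤ |f x| * |g x - g y| + |f x - f y| * |g y| := by
        rw [← abs_mul, ← abs_mul]; exact abs_add_le _ _
    _ ≤ Bf * (Lg * dist x y) + (Lf * dist x y) * Bg := by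
        have h3 : 0 ≤ Bf := (abs_nonneg _).trans (hBf x)
        have h4 := hBf x
        have h5 := hBg y
        gcongr
    _ = _ := by ring

theorem IsWeight.exists_lipschitzWith_exp (hV : IsWeight V lam) (hlam : 0 < lam) {θ : ℝ}
    (hθ : 0 < θ) : ∃ L B, LipschitzWith L (fun x => Real.exp (-(θ * V x))) ∧
      ∀ x, |Real.exp (-(θ * V x))| ≤ B := by
  obtain ⟨a, ha, b, hb⟩ := hV.exists_linear_lower hlam
  have hle : ∀ x, -(θ * V x) ≤ θ * b := fun x => by
    have := hb x
    have : 0 ≤ a * ‖x‖ := by positivity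
    nlinarith
  refine ⟨(Real.exp (θ * b) * (θ * (2 * lam))).toNNReal, Real.exp (θ * b),
    LipschitzWith.of_dist_le' fun x y => ?_, fun x => ?_⟩
  · have h1 : ∀ s t : ℝ, s ≤ θ * b → t ≤ s → Real.exp s - Real.exp t ≤
        Real.exp (θ * b) * (s - t) := by
      intro s t hs hst
      have h2 := Real.add_one_le_exp (t - s)
      have h3 : Real.exp t = Real.exp s * Real.exp (t - s) := by rw [← Real.exp_add]; ring_nf
      have h4 := Real.exp_le_exp.2 hs
      have h5 := Real.exp_pos s
      rw [h3]
      calc Real.exp s - Real.exp s * Real.exp (t - s) = Real.exp s * (1 - Real.exp (t - s)) := by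
            ring
        _ ≤ Real.exp s * (s - t) := mul_le_mul_of_nonneg_left (by linarith) h5.le
        _ ≤ _ := mul_le_mul_of_nonneg_right h4 (by linarith)
    have h2 := hV.lipschitz x y
    rw [Real.dist_eq, dist_eq_norm]
    have h3 : |Real.exp (-(θ * V x)) - Real.exp (-(θ * V y))| ≤
        Real.exp (θ * b) * (θ * |V x - V y|) := by
      rcases le_total (V x) (V y) with h | h
      · rw [abs_of_nonneg (sub_nonneg.2 (Real.exp_le_exp.2 (by nlinarith))),
          abs_of_nonpos (by linarith)]
        refine (h1 _ _ (hle x) (by nlinarith)).trans (le_of_eq ?_)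
        ring
      · rw [abs_of_nonpos (sub_nonpos.2 (Real.exp_le_exp.2 (by nlinarith))),
          abs_of_nonneg (by linarith), neg_sub]
        refine (h1 _ _ (hle y) (by nlinarith)).trans (le_of_eq ?_)
        ring
    refine h3.trans ?_
    rw [mul_assoc, mul_assoc]
    gcongr
  · rw [abs_of_pos (Real.exp_pos _)]
    exact Real.exp_le_exp.2 (hle x)

/-- The cutoff `(1 - |x| / r)₊`. -/
noncomputable def linearCutoff (r : ℝ) (x : Eucl d) : ℝ := max 0 (1 - ‖x‖ / r)

theorem linearCutoff_nonneg (r : ℝ) (x : Eucl d) : 0 ≤ linearCutoff r x := le_max_left _ _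

theorem linearCutoff_le_one {r : ℝ} (hr : 0 < r) (x : Eucl d) : linearCutoff r x ≤ 1 :=
  max_le zero_le_one (by have : 0 ≤ ‖x‖ / r := by positivity
                         linarith)

theorem lipschitzWith_linearCutoff {r : ℝ} (hr : 0 < r) :
    LipschitzWith (1 / r).toNNReal (linearCutoff r : Eucl d → ℝ) := by
  refine LipschitzWith.of_dist_le' fun x y => ?_
  have h1 : LipschitzWith 1 (fun s : ℝ => max 0 s) := by
    simpa using (LipschitzWith.id (α := ℝ)).const_max 0
  have h2 := h1.dist_le_mul (1 - ‖x‖ / r) (1 - ‖y‖ / r)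
  refine h2.trans ?_
  rw [NNReal.coe_one, one_mul, Real.dist_eq, dist_eq_norm, sub_sub_sub_cancel_left, ← sub_div,
    abs_div, abs_of_pos hr, div_eq_mul_one_div, mul_comm]
  gcongr
  rw [norm_sub_rev]
  exact abs_norm_sub_norm_le y x

theorem hasCompactSupport_linearCutoff {r : ℝ} (hr : 0 < r) :
    HasCompactSupport (linearCutoff r : Eucl d → ℝ) := by
  refine HasCompactSupport.intro (isCompact_closedBall 0 r) fun x hx => ?_
  rw [mem_closedBall_zero_iff, not_le] at hx
  refine max_eq_left ?_
  rw [sub_nonpos, le_div_iff₀ hr]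
  linarith

theorem tendsto_linearCutoff (x : Eucl d) :
    Tendsto (fun n : ℕ => linearCutoff ((n : ℝ) + 1) x) atTop (𝓝 1) := by
  have h1 : Tendsto (fun n : ℕ => ‖x‖ / ((n : ℝ) + 1)) atTop (𝓝 0) := by
    have := (tendsto_one_div_add_atTop_nhds_zero_nat (𝕜 := ℝ)).const_mul ‖x‖
    simpa [div_eq_mul_inv] using this
  have h2 := (tendsto_const_nhds (x := (0 : ℝ))).max (h1.const_sub 1)
  rw [sub_zero, max_eq_right zero_le_one] at h2
  exact h2

theorem LipschitzWith.integrable_inner_gradient {f h : Eucl d → ℝ} {L L' : ℝ≥0}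
    (hf : LipschitzWith L f) (hh : LipschitzWith L' h) (hc : HasCompactSupport h) :
    Integrable fun x => inner ℝ (_root_.gradient f x) (_root_.gradient h x) := by
  have h1 : Integrable ((tsupport h).indicator fun _ : Eucl d => (L * L' : ℝ)) :=
    (integrable_indicator_iff (isClosed_tsupport h).measurableSet).2
      (integrableOn_const (hs := hc.isCompact.measure_lt_top.ne))
  refine h1.mono' ((measurable_gradient f).inner (measurable_gradient h)).aestronglyMeasurable
    (Eventually.of_forall fun x => ?_)
  by_cases hx : x ∈ tsupport h
  · rw [Set.indicator_of_mem hx]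
    exact (norm_inner_le_norm _ _).trans (mul_le_mul (hf.norm_gradient_le x)
      (hh.norm_gradient_le x) (norm_nonneg _) L.2)
  · rw [Set.indicator_of_notMem hx]
    have h2 : fderiv ℝ h x = 0 := by
      by_contra h3
      exact hx (support_fderiv_subset ℝ h3)
    rw [inner_gradient_eq_fderiv, h2]
    simp

theorem IsWeight.integrable_mul_exp (hV : IsWeight V lam) (hlam : 0 < lam) {θ : ℝ} (hθ : 0 < θ)
    {u : Eucl d → ℝ} (hu : AEStronglyMeasurable u volume) {B : ℝ} (k : ℕ)
    (hB : ∀ x, |u x| ≤ B * (1 + ‖x‖) ^ k) :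
    Integrable fun x => u x * Real.exp (-(θ * V x)) := by
  refine ((hV.integrable_pow_mul_exp hlam k hθ).const_mul B).mono'
    (hu.mul (by have := hV.continuous; fun_prop)) (Eventually.of_forall fun x => ?_)
  rw [norm_mul, Real.norm_of_nonneg (Real.exp_pos _).le, ← mul_assoc]
  gcongr
  exact hB x

/-- The basic inequality, from testing with `g e^{-θV}`. -/
theorem IsApproxSupersolution.weighted_test {f : Eucl d → ℝ} {γ : ℝ}
    (hf : IsApproxSupersolution K γ f) (hK : IsLinearHamiltonian K R lam Lam C)
    (hV : IsWeight V lam) (hγ : 0 ≤ γ) {L : ℝ≥0} (hL : LipschitzWith L f) {θ : ℝ} (hθ : 0 < θ)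
    {g : Eucl d → ℝ} {L' : ℝ≥0} (hg : LipschitzWith L' g) {B : ℝ} (hgB : ∀ x, g x ≤ B)
    (hg0 : ∀ x, 0 ≤ g x) :
    0 ≤ ∫ x, (1 / 2 * inner ℝ (gradient f x) (gradient g x) -
      ((1 - θ) * lam * ‖gradient f x‖ - C * (‖x‖ + 1) - γ) * g x) * Real.exp (-(θ * V x)) := by
  have hlam := hK.lam_pos
  have hC := hK.C_pos
  have hB0 : 0 ≤ B := (hg0 0).trans (hgB 0)
  have hmf : Measurable (gradient f) := measurable_gradient f
  have hmg : Measurable (gradient g) := measurable_gradient g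
  set A : Eucl d → ℝ := fun x => (1 / 2 * inner ℝ (gradient f x) (gradient g x) -
      ((1 - θ) * lam * ‖gradient f x‖ - C * (‖x‖ + 1) - γ) * g x) * Real.exp (-(θ * V x)) with hA
  -- This is the price of the cutoff that makes the test function compactly supported: its gradient
  -- has size at most 1/r, so the term disappears as r grows.
  set D : Eucl d → ℝ := fun x => 1 / 2 * ‖gradient f x‖ * g x * Real.exp (-(θ * V x)) with hD
  have hgm := hg.continuous.measurable
  have hAi : Integrable A := by
    refine hV.integrable_mul_exp hlam hθ
      (B := L * L' + (|1 - θ| * lam * L + C + γ) * B) (k := 1)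
      (Measurable.aestronglyMeasurable ((((hmf.inner hmg)).const_mul _).sub
        (((((hmf.norm).const_mul _).sub (by fun_prop)).sub_const _).mul hgm))) fun x => ?_
    have h1 : |inner ℝ (gradient f x) (gradient g x)| ≤ L * L' :=
      (abs_real_inner_le_norm _ _).trans (mul_le_mul (hL.norm_gradient_le x)
        (hg.norm_gradient_le x) (norm_nonneg _) L.2)
    have h2 : |(1 - θ) * lam * ‖gradient f x‖ - C * (‖x‖ + 1) - γ| ≤
        (|1 - θ| * lam * L + C + γ) * (1 + ‖x‖) := by
      refine (abs_sub _ _).trans ?_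
      have h3 : |(1 - θ) * lam * ‖gradient f x‖ - C * (‖x‖ + 1)| ≤
          |1 - θ| * lam * L + C * (‖x‖ + 1) := by
        refine (abs_sub _ _).trans ?_
        rw [abs_mul, abs_mul, abs_norm, abs_of_pos hlam, abs_of_nonneg (a := C * (‖x‖ + 1))
          (by positivity)]
        gcongr
        exact hL.norm_gradient_le x
      rw [abs_of_nonneg hγ]
      have : 0 ≤ (|1 - θ| * lam * L + γ) * ‖x‖ := by positivity
      linarith
    refine (abs_sub _ _).trans ?_
    rw [abs_mul, abs_mul, abs_of_nonneg (hg0 x), abs_of_pos (by norm_num : (0 : ℝ) < 1 / 2),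
      pow_one]
    have h4 : |(1 - θ) * lam * ‖gradient f x‖ - C * (‖x‖ + 1) - γ| * g x ≤
        (|1 - θ| * lam * L + C + γ) * (1 + ‖x‖) * B := by
      have := hgB x
      have := hg0 x
      gcongr
    have h5 : (0 : ℝ) ≤ L * L' := by positivity
    have h6 : (0 : ℝ) ≤ L * L' * ‖x‖ := by positivity
    linarith
  have hDi : Integrable D := by
    refine hV.integrable_mul_exp hlam hθ (B := 1 / 2 * L * B) (k := 0)
      (Measurable.aestronglyMeasurable ((hmf.norm.const_mul _).mul hgm)) fun x => ?_
    rw [abs_mul, abs_mul, abs_norm, abs_of_nonneg (hg0 x),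
      abs_of_pos (by norm_num : (0 : ℝ) < 1 / 2), pow_zero, mul_one]
    have h1 := hL.norm_gradient_le x
    have h2 := hgB x
    have h3 := hg0 x
    gcongr
  obtain ⟨LE, BE, hLE, hBE⟩ := hV.exists_lipschitzWith_exp hlam hθ
  have hgB' : ∀ x, |g x| ≤ B := fun x => by rw [abs_of_nonneg (hg0 x)]; exact hgB x
  obtain ⟨L1, hL1⟩ := hg.mul_of_bounded hLE hgB' hBE
  have hB1 : ∀ x, |g x * Real.exp (-(θ * V x))| ≤ B * BE := fun x => by
    rw [abs_mul]
    have := hgB' x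
    gcongr
    exact hBE x
  have hstep : ∀ r : ℝ, 0 < r → 0 ≤ ∫ x, (linearCutoff r x * A x + 1 / r * D x) := by
    intro r hr
    have hB2 : ∀ x : Eucl d, |linearCutoff r x| ≤ 1 := fun x => by
      rw [abs_of_nonneg (linearCutoff_nonneg r x)]; exact linearCutoff_le_one hr x
    obtain ⟨L2, hL2⟩ := (lipschitzWith_linearCutoff (d := d) hr).mul_of_bounded hL1 hB2 hB1
    have hcs : HasCompactSupport fun x => linearCutoff r x * (g x * Real.exp (-(θ * V x))) :=
      (hasCompactSupport_linearCutoff hr).mul_right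
    have hh0 : ∀ x, 0 ≤ linearCutoff r x * (g x * Real.exp (-(θ * V x))) := fun x =>
      mul_nonneg (linearCutoff_nonneg r x) (mul_nonneg (hg0 x) (Real.exp_pos _).le)
    have h1 := hf L2 _ hL2 hcs hh0
    have hζA : Integrable fun x => linearCutoff r x * A x :=
      hAi.bdd_mul (lipschitzWith_linearCutoff hr).continuous.aestronglyMeasurable
        (Eventually.of_forall hB2)
    have i1 := (hL.integrable_inner_gradient hL2 hcs).const_mul (-(1 / 2 : ℝ))
    have i2 := (hK.integrable_sub_mul hmf hL.norm_gradient_le hL2.continuous hcs γ).neg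
    have i3 : Integrable fun x => -(1 / 2 : ℝ) * inner ℝ (gradient f x)
        (gradient (fun x => linearCutoff r x * (g x * Real.exp (-(θ * V x)))) x) +
        (K x (gradient f x) - γ) * (linearCutoff r x * (g x * Real.exp (-(θ * V x)))) := by
      refine i1.add (i2.congr (Eventually.of_forall fun x => ?_))
      simp only [Pi.neg_apply]
      ring
    have h2 : ∫ x, -(linearCutoff r x * A x + 1 / r * D x) ≤ 0 := by
      refine le_trans (integral_mono_ae (hζA.add (hDi.const_mul _)).neg i3 ?_) h1
      filter_upwards [(lipschitzWith_linearCutoff (d := d) hr).ae_differentiableAt (μ := volume),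
        hg.ae_differentiableAt (μ := volume), hV.lipschitzWith.ae_differentiableAt (μ := volume)]
        with x dζ dg dV
      have e0 : HasFDerivAt (fun x => -(θ * V x)) (-(θ • fderiv ℝ V x)) x :=
        (dV.hasFDerivAt.const_mul θ).neg
      have e1 : HasFDerivAt (fun x => linearCutoff r x * (g x * Real.exp (-(θ * V x))))
          (linearCutoff r x • (g x • Real.exp (-(θ * V x)) • -(θ • fderiv ℝ V x) +
            Real.exp (-(θ * V x)) • fderiv ℝ g x) +
            (g x * Real.exp (-(θ * V x))) • fderiv ℝ (linearCutoff r) x) x :=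
        dζ.hasFDerivAt.mul (dg.hasFDerivAt.mul e0.exp)
      rw [inner_gradient_eq_fderiv, e1.fderiv]
      simp only [hA, hD, inner_gradient_eq_fderiv]
      set p := gradient f x
      set E := Real.exp (-(θ * V x)) with hE
      have hE0 : 0 < E := Real.exp_pos _
      set ζ := linearCutoff r x with hζ
      have hζ0 : 0 ≤ ζ := linearCutoff_nonneg r x
      have q1 : |fderiv ℝ (linearCutoff r) x p| ≤ 1 / r * ‖p‖ := by
        have := norm_fderiv_le_of_lipschitz ℝ (lipschitzWith_linearCutoff (d := d) hr) (x₀ := x)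
        rw [Real.coe_toNNReal _ (by positivity)] at this
        exact ContinuousLinearMap.le_of_opNorm_le _ this p
      -- The constant 2λ is what the coercivity can afford: half the derivative of the weight costs
      -- at most θλ‖p‖, and λ‖p‖ is available from K, leaving (1 - θ)λ‖p‖.
      have q2 : |fderiv ℝ V x p| ≤ 2 * lam * ‖p‖ := by
        have := norm_fderiv_le_of_lipschitz ℝ hV.lipschitzWith (x₀ := x)
        rw [Real.coe_toNNReal _ (by positivity)] at this
        exact ContinuousLinearMap.le_of_opNorm_le _ this p
      have q3 := hK.lower x p
      have q4 := hg0 x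
      simp only [add_apply, smul_apply,
        neg_apply, smul_eq_mul]
      have m1 : (g x * E) * fderiv ℝ (linearCutoff r) x p ≤ (g x * E) * (1 / r * ‖p‖) :=
        mul_le_mul_of_nonneg_left (abs_le.1 q1).2 (by positivity)
      have m2 : (ζ * g x * E * θ) * -(2 * lam * ‖p‖) ≤ (ζ * g x * E * θ) * fderiv ℝ V x p :=
        mul_le_mul_of_nonneg_left (abs_le.1 q2).1 (by positivity)
      have m3 : (ζ * g x * E) * (lam * ‖p‖ - C * (‖x‖ + 1)) ≤ (ζ * g x * E) * K x p :=
        mul_le_mul_of_nonneg_left q3 (by positivity)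
      linear_combination (1 / 2) * m1 + (1 / 2) * m2 + m3
    rw [integral_neg] at h2
    linarith
  have hlim : Tendsto (fun n : ℕ => ∫ x, (linearCutoff ((n : ℝ) + 1) x * A x +
      1 / ((n : ℝ) + 1) * D x)) atTop (𝓝 (∫ x, A x)) := by
    refine tendsto_integral_of_dominated_convergence (fun x => ‖A x‖ + ‖D x‖) (fun n => ?_)
      (hAi.norm.add hDi.norm) (fun n => Eventually.of_forall fun x => ?_)
      (Eventually.of_forall fun x => ?_)
    · exact ((lipschitzWith_linearCutoff (by positivity)).continuous.aestronglyMeasurable.mul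
        hAi.aestronglyMeasurable).add (hDi.aestronglyMeasurable.const_mul _)
    · refine (norm_add_le _ _).trans ?_
      rw [norm_mul (linearCutoff _ _), norm_mul (1 / _), Real.norm_of_nonneg (linearCutoff_nonneg _ x),
        Real.norm_of_nonneg (by positivity : 0 ≤ 1 / ((n : ℝ) + 1))]
      have h1 := linearCutoff_le_one (by positivity : 0 < (n : ℝ) + 1) x
      have h2 : 1 / ((n : ℝ) + 1) ≤ 1 := by
        rw [div_le_one (by positivity)]
        linarith [Nat.cast_nonneg (α := ℝ) n]
      gcongr
      · exact mul_le_of_le_one_left (norm_nonneg _) h1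
      · exact mul_le_of_le_one_left (norm_nonneg _) h2
    · have := ((tendsto_linearCutoff x).mul_const (A x)).add
        ((tendsto_one_div_add_atTop_nhds_zero_nat (𝕜 := ℝ)).mul_const (D x))
      simpa using this
  exact ge_of_tendsto' hlim fun n => hstep _ (by positivity)

end WeightedTest

/-! ### The weighted measure as a probability measure -/

section WeightProbability

variable {d : ℕ} {V : Eucl d → ℝ} {lam : ℝ}

theorem IsWeight.isProbabilityMeasure (hV : IsWeight V lam) :
    IsProbabilityMeasure (weightMeasure V) := by
  refine ⟨?_⟩
  rw [weightMeasure, withDensity_apply _ MeasurableSet.univ, Measure.restrict_univ,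
    ← ofReal_integral_eq_lintegral_ofReal hV.integrable
      (Eventually.of_forall fun x => (Real.exp_pos _).le), hV.integral_eq_one, ENNReal.ofReal_one]

theorem IsWeight.integrable_of_abs_le (hV : IsWeight V lam) (hlam : 0 < lam) {u : Eucl d → ℝ}
    (hu : AEStronglyMeasurable u volume) {B : ℝ} (k : ℕ) (hB : ∀ x, |u x| ≤ B * (1 + ‖x‖) ^ k) :
    Integrable u (weightMeasure V) := by
  rw [integrable_weightMeasure_iff hV.continuous]
  refine (hV.integrable_mul_exp hlam one_pos hu k hB).congr (Eventually.of_forall fun x => ?_)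
  simp [mul_comm]

theorem aestronglyMeasurable_weightMeasure {F : Type*} [TopologicalSpace F] {u : Eucl d → F}
    (hu : AEStronglyMeasurable u volume) : AEStronglyMeasurable u (weightMeasure V) :=
  hu.mono_ac weightMeasure_absolutelyContinuous

theorem tendsto_setIntegral_norm_of_eLpNorm {F : Type*} [NormedAddCommGroup F] (hV : Continuous V)
    {u : ℕ → Eucl d → F} (hu : ∀ n, AEStronglyMeasurable (u n) volume)
    (h : Tendsto (fun n => eLpNorm (u n) 1 (weightMeasure V)) atTop (𝓝 0)) (r : ℝ) :
    Tendsto (fun n => ∫ x in Metric.closedBall 0 r, ‖u n x‖) atTop (𝓝 0) := by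
  obtain ⟨c, hc, hle⟩ := restrict_le_smul_weightMeasure hV (isCompact_closedBall (0 : Eucl d) r)
  have h1 : Tendsto (fun n => c * eLpNorm (u n) 1 (weightMeasure V)) atTop (𝓝 0) := by
    have := ENNReal.Tendsto.const_mul h (Or.inr hc)
    simpa using this
  have h2 : Tendsto (fun n => ∫⁻ x in Metric.closedBall 0 r, ‖u n x‖ₑ) atTop (𝓝 0) := by
    refine tendsto_of_tendsto_of_tendsto_of_le_of_le tendsto_const_nhds h1
      (fun _ => zero_le) fun n => ?_
    refine (lintegral_mono' hle le_rfl).trans ?_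
    rw [lintegral_smul_measure, eLpNorm_one_eq_lintegral_enorm, smul_eq_mul]
  have h3 := (ENNReal.tendsto_toReal ENNReal.zero_ne_top).comp h2
  rw [ENNReal.toReal_zero] at h3
  refine h3.congr fun n => ?_
  exact (integral_norm_eq_lintegral_enorm (hu n).restrict).symm

end WeightProbability

/-! ### Gradients of differences -/

section GradientAlgebra

variable {d : ℕ} {f g : Eucl d → ℝ}

theorem gradient_const_sub (c : ℝ) (x : Eucl d) :
    gradient (fun y => c - f y) x = -gradient f x := by
  rw [gradient, gradient, fderiv_const_sub, map_neg]

theorem gradient_sub_apply {x : Eucl d} (hf : DifferentiableAt ℝ f x)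
    (hg : DifferentiableAt ℝ g x) :
    gradient (fun y => f y - g y) x = gradient f x - gradient g x := by
  rw [gradient, gradient, gradient, fderiv_fun_sub hf hg, map_sub]

end GradientAlgebra

/-! ### A priori estimates for Lipschitz almost supersolutions -/

section EnergyEstimates

variable {d : ℕ} {V : Eucl d → ℝ} {K : Eucl d → Eucl d → ℝ} {R lam Lam C : ℝ}

/-- The case θ = 1 of the weighted test, in which the weight consumes the coercive term completely.
-/
theorem IsApproxSupersolution.integral_nonneg {f : Eucl d → ℝ} {γ : ℝ}
    (hf : IsApproxSupersolution K γ f) (hK : IsLinearHamiltonian K R lam Lam C)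
    (hV : IsWeight V lam) (hγ : 0 ≤ γ) {L : ℝ≥0} (hL : LipschitzWith L f)
    {g : Eucl d → ℝ} {L' : ℝ≥0} (hg : LipschitzWith L' g) {B : ℝ} (hgB : ∀ x, g x ≤ B)
    (hg0 : ∀ x, 0 ≤ g x) :
    0 ≤ ∫ x, (1 / 2 * inner ℝ (gradient f x) (gradient g x) +
      (C * (‖x‖ + 1) + γ) * g x) ∂(weightMeasure V) := by
  rw [integral_weightMeasure hV.continuous]
  refine (hf.weighted_test hK hV hγ hL one_pos hg hgB hg0).trans_eq (integral_congr_ae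
    (Eventually.of_forall fun x => ?_))
  simp only [one_mul, smul_eq_mul]
  ring

/-- An a priori bound on the gradient, in `L¹` with the weight `e^{-V/2}`. -/
theorem IsApproxSupersolution.integral_norm_gradient_le {f : Eucl d → ℝ} {γ : ℝ}
    (hf : IsApproxSupersolution K γ f) (hK : IsLinearHamiltonian K R lam Lam C)
    (hV : IsWeight V lam) (hγ : 0 ≤ γ) (hγ1 : γ ≤ 1) {L : ℝ≥0} (hL : LipschitzWith L f) :
    ∫ x, ‖gradient f x‖ * Real.exp (-(1 / 2 * V x)) ≤
      2 / lam * ∫ x, (C * (‖x‖ + 1) + 1) * Real.exp (-(1 / 2 * V x)) := by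
  have hlam := hK.lam_pos
  have hC := hK.C_pos
  -- Only half of the coercive term is spent on the weight. With g constant there is no other
  -- gradient term, and the remaining half is the quantity to be bounded.
  have h1 := hf.weighted_test hK hV hγ hL (θ := 1 / 2) (by norm_num) (g := fun _ => 1) (L' := 0)
    (LipschitzWith.const 1) (B := 1) (fun _ => le_rfl) (fun _ => zero_le_one)
  have e1 : ∀ x, gradient (fun _ : Eucl d => (1 : ℝ)) x = 0 := fun x => by
    rw [gradient, fderiv_fun_const]
    simp
  simp only [e1, inner_zero_right, mul_one] at h1
  have i1 : Integrable fun x => ‖gradient f x‖ * Real.exp (-(1 / 2 * V x)) :=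
    hV.integrable_mul_exp hlam (by norm_num) (measurable_gradient f).norm.aestronglyMeasurable
      (B := L) 0 fun x => by simpa using hL.norm_gradient_le x
  have i2 : Integrable fun x => (C * (‖x‖ + 1) + 1) * Real.exp (-(1 / 2 * V x)) :=
    hV.integrable_mul_exp hlam (by norm_num) (Continuous.aestronglyMeasurable (by fun_prop))
      (B := C + 1) 1 fun x => by
        rw [abs_of_nonneg (by positivity), pow_one]
        linarith [norm_nonneg x]
  have h2 : 0 ≤ ∫ x, ((C * (‖x‖ + 1) + 1) * Real.exp (-(1 / 2 * V x)) -
      lam / 2 * (‖gradient f x‖ * Real.exp (-(1 / 2 * V x)))) := by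
    by_cases hi : Integrable fun x => (1 / 2 * 0 - ((1 - 1 / 2) * lam * ‖gradient f x‖ -
        C * (‖x‖ + 1) - γ)) * Real.exp (-(1 / 2 * V x))
    · refine h1.trans (integral_mono hi (i2.sub (i1.const_mul _)) fun x => ?_)
      have := mul_le_mul_of_nonneg_right hγ1 (Real.exp_pos (-(1 / 2 * V x))).le
      simp only
      linarith
    · exfalso
      have i3 : Integrable fun x => γ * Real.exp (-(1 / 2 * V x)) :=
        (hV.integrable_exp hlam (by norm_num)).const_mul γ
      have i4 : Integrable fun x => 1 * Real.exp (-(1 / 2 * V x)) :=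
        (hV.integrable_exp hlam (by norm_num)).const_mul 1
      refine hi ((((i2.sub (i1.const_mul (lam / 2))).add i3).sub i4).congr
        (Eventually.of_forall fun x => ?_))
      simp only [Pi.sub_apply, Pi.add_apply]
      ring
  rw [integral_sub i2 (i1.const_mul _), integral_const_mul] at h2
  rw [div_mul_eq_mul_div, le_div_iff₀ hlam]
  linarith

theorem LipschitzWith.integrable_inner_gradient_weight (hV : IsWeight V lam) (hlam : 0 < lam)
    {f g : Eucl d → ℝ} {L L' : ℝ≥0} (hf : LipschitzWith L f) (hg : LipschitzWith L' g) :
    Integrable (fun x => inner ℝ (_root_.gradient f x) (_root_.gradient g x))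
      (weightMeasure V) := by
  refine hV.integrable_of_abs_le hlam
    ((measurable_gradient f).inner (measurable_gradient g)).aestronglyMeasurable
    (B := L * L') 0 fun x => ?_
  rw [pow_zero, mul_one]
  exact (abs_real_inner_le_norm _ _).trans (mul_le_mul (hf.norm_gradient_le x)
    (hg.norm_gradient_le x) (norm_nonneg _) L.2)

theorem IsWeight.integrable_linear_mul (hV : IsWeight V lam) (hlam : 0 < lam) (hC : 0 < C)
    {g : Eucl d → ℝ} (hg : AEStronglyMeasurable g volume) {B : ℝ} (hB : ∀ x, |g x| ≤ B) {γ : ℝ}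
    (hγ : 0 ≤ γ) : Integrable (fun x => (C * (‖x‖ + 1) + γ) * g x) (weightMeasure V) := by
  refine hV.integrable_of_abs_le hlam
    ((Continuous.aestronglyMeasurable (by fun_prop)).mul hg) (B := (C + γ) * B) 1 fun x => ?_
  rw [abs_mul, abs_of_nonneg (by positivity), pow_one, mul_right_comm]
  have := hB x
  have h1 : C * (‖x‖ + 1) + γ ≤ (C + γ) * (1 + ‖x‖) := by
    have : 0 ≤ γ * ‖x‖ := by positivity
    linarith
  gcongr

/-- Testing with b - f ≥ 0 turns ½∇f·∇g into -½|∇f|². -/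
theorem IsApproxSupersolution.energy_le {f : Eucl d → ℝ} {γ : ℝ}
    (hf : IsApproxSupersolution K γ f) (hK : IsLinearHamiltonian K R lam Lam C)
    (hV : IsWeight V lam) (hγ : 0 ≤ γ) {L : ℝ≥0} (hL : LipschitzWith L f) {a b : ℝ}
    (ha : ∀ x, a ≤ f x) (hb : ∀ x, f x ≤ b) :
    ∫ x, ‖gradient f x‖ ^ 2 ∂(weightMeasure V) ≤
      2 * ∫ x, (C * (‖x‖ + 1) + γ) * (b - f x) ∂(weightMeasure V) := by
  have hlam := hK.lam_pos
  have hg : LipschitzWith L fun x => b - f x := LipschitzWith.of_le_add_mul _ fun x y => by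
    have h1 := hL.dist_le_mul y x
    rw [Real.dist_eq, dist_comm y x] at h1
    linarith [(abs_le.1 h1).2]
  have h1 := hf.integral_nonneg hK hV hγ hL hg (B := b - a) (fun x => by linarith [ha x])
    fun x => by linarith [hb x]
  simp only [gradient_const_sub, inner_neg_right, real_inner_self_eq_norm_sq] at h1
  have i1 : Integrable (fun x => ‖gradient f x‖ ^ 2) (weightMeasure V) := by
    have := hL.integrable_inner_gradient_weight hV hlam hL
    simpa only [real_inner_self_eq_norm_sq] using this
  have i2 : Integrable (fun x => (C * (‖x‖ + 1) + γ) * (b - f x)) (weightMeasure V) :=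
    hV.integrable_linear_mul hlam hK.C_pos hg.continuous.aestronglyMeasurable (B := b - a)
      (fun x => by rw [abs_of_nonneg (by linarith [hb x])]; linarith [ha x]) hγ
  have h2 : ∫ x, (1 / 2 * -‖gradient f x‖ ^ 2 + (C * (‖x‖ + 1) + γ) * (b - f x))
      ∂(weightMeasure V) = -(1 / 2) * (∫ x, ‖gradient f x‖ ^ 2 ∂(weightMeasure V)) +
      ∫ x, (C * (‖x‖ + 1) + γ) * (b - f x) ∂(weightMeasure V) := by
    rw [← integral_const_mul, ← integral_add (i1.const_mul _) i2]
    congr 1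
    ext x
    ring
  rw [h2] at h1
  linarith

/-- In |∇f' - ∇f|² = |∇f'|² - |∇f|² - 2∇f·(∇f' - ∇f) the last term is controlled by testing with f'
- f ≥ 0. For an increasing sequence this makes the energies almost monotone, which is why the
gradients converge strongly. -/
theorem IsApproxSupersolution.integral_norm_sub_le {f f' : Eucl d → ℝ} {γ : ℝ}
    (hf : IsApproxSupersolution K γ f) (hK : IsLinearHamiltonian K R lam Lam C)
    (hV : IsWeight V lam) (hγ : 0 ≤ γ) {L L' : ℝ≥0} (hL : LipschitzWith L f)
    (hL' : LipschitzWith L' f') (hle : ∀ x, f x ≤ f' x) {B : ℝ} (hB : ∀ x, f' x - f x ≤ B) :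
    ∫ x, ‖gradient f' x - gradient f x‖ ^ 2 ∂(weightMeasure V) ≤
      (∫ x, ‖gradient f' x‖ ^ 2 ∂(weightMeasure V)) - (∫ x, ‖gradient f x‖ ^ 2 ∂(weightMeasure V))
      + 4 * ∫ x, (C * (‖x‖ + 1) + γ) * (f' x - f x) ∂(weightMeasure V) := by
  have hlam := hK.lam_pos
  have h1 := hf.integral_nonneg hK hV hγ hL (hL'.sub hL) hB fun x => by linarith [hle x]
  have i1 := hL.integrable_inner_gradient_weight hV hlam hL
  have i2 := hL.integrable_inner_gradient_weight hV hlam hL'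
  have i3 := hL'.integrable_inner_gradient_weight hV hlam hL'
  have i4 : Integrable (fun x => (C * (‖x‖ + 1) + γ) * (f' x - f x)) (weightMeasure V) :=
    hV.integrable_linear_mul hlam hK.C_pos (hL'.sub hL).continuous.aestronglyMeasurable (B := B)
      (fun x => by rw [abs_of_nonneg (by linarith [hle x])]; exact hB x) hγ
  have i5 : Integrable (fun x => 1 / 2 * (inner ℝ (gradient f x) (gradient f' x) -
      inner ℝ (gradient f x) (gradient f x))) (weightMeasure V) := (i2.sub i1).const_mul _
  have i6 : Integrable (fun x => inner ℝ (gradient f' x) (gradient f' x) -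
      2 * inner ℝ (gradient f x) (gradient f' x)) (weightMeasure V) := i3.sub (i2.const_mul 2)
  have e1 : ∫ x, (1 / 2 * inner ℝ (gradient f x) (gradient (fun x => f' x - f x) x) +
      (C * (‖x‖ + 1) + γ) * (f' x - f x)) ∂(weightMeasure V) =
      1 / 2 * ((∫ x, inner ℝ (gradient f x) (gradient f' x) ∂(weightMeasure V)) -
        ∫ x, inner ℝ (gradient f x) (gradient f x) ∂(weightMeasure V)) +
      ∫ x, (C * (‖x‖ + 1) + γ) * (f' x - f x) ∂(weightMeasure V) := by
    rw [← integral_sub i2 i1, ← integral_const_mul, ← integral_add i5 i4]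
    refine integral_congr_ae (weightMeasure_absolutelyContinuous.ae_le ?_)
    filter_upwards [hL.ae_differentiableAt (μ := volume), hL'.ae_differentiableAt (μ := volume)]
      with x hx hx'
    rw [gradient_sub_apply hx' hx, inner_sub_right]
  have e2 : ∫ x, ‖gradient f' x - gradient f x‖ ^ 2 ∂(weightMeasure V) =
      (∫ x, inner ℝ (gradient f' x) (gradient f' x) ∂(weightMeasure V)) -
      2 * (∫ x, inner ℝ (gradient f x) (gradient f' x) ∂(weightMeasure V)) +
      ∫ x, inner ℝ (gradient f x) (gradient f x) ∂(weightMeasure V) := by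
    rw [← integral_const_mul, ← integral_sub i3 (i2.const_mul _),
      ← integral_add i6 i1]
    congr 1
    ext x
    rw [norm_sub_sq_real, real_inner_self_eq_norm_sq, real_inner_self_eq_norm_sq, real_inner_comm]
  simp only [real_inner_self_eq_norm_sq] at e1 e2 h1
  rw [e1] at h1
  rw [e2]
  linarith

end EnergyEstimates

/-! ### Completeness of L² in terms of integrals -/

section SquareIntegrable

variable {α F : Type*} [MeasurableSpace α] {μ : Measure α} [NormedAddCommGroup F]

theorem MeasureTheory.MemLp.eLpNorm_two_eq {u : α → F} (hu : MemLp u 2 μ) :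
    eLpNorm u 2 μ = ENNReal.ofReal (√(∫ x, ‖u x‖ ^ 2 ∂μ)) := by
  rw [hu.eLpNorm_eq_integral_rpow_norm (by norm_num) (by norm_num), Real.sqrt_eq_rpow]
  simp

theorem exists_tendsto_eLpNorm_two [CompleteSpace F] {u : ℕ → α → F} (hu : ∀ n, MemLp (u n) 2 μ)
    (hc : ∀ η > 0, ∃ N, ∀ n ≥ N, ∫ x, ‖u n x - u N x‖ ^ 2 ∂μ < η) :
    ∃ g, MemLp g 2 μ ∧ Tendsto (fun n => eLpNorm (u n - g) 2 μ) atTop (𝓝 0) := by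
  have : Fact ((1 : ℝ≥0∞) ≤ 2) := ⟨by norm_num⟩
  have hcs : CauchySeq fun n => (hu n).toLp (u n) := by
    refine Metric.cauchySeq_iff'.2 fun ε hε => ?_
    obtain ⟨N, hN⟩ := hc (ε ^ 2) (by positivity)
    refine ⟨N, fun n hn => ?_⟩
    rw [dist_edist, Lp.edist_toLp_toLp, ((hu n).sub (hu N)).eLpNorm_two_eq,
      ENNReal.toReal_ofReal (Real.sqrt_nonneg _), Real.sqrt_lt' hε]
    exact hN n hn
  obtain ⟨g, hg⟩ := cauchySeq_tendsto_of_complete hcs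
  refine ⟨g, Lp.memLp g, ?_⟩
  have h1 : g = (Lp.memLp g).toLp g := (Lp.toLp_coeFn g (Lp.memLp g)).symm
  rw [h1] at hg
  exact (Lp.tendsto_Lp_iff_tendsto_eLpNorm'' u hu g (Lp.memLp g)).1 hg

end SquareIntegrable

/-! ### Increasing approximations and their limits -/

section Approximation

variable {d : ℕ} {V : Eucl d → ℝ} {K : Eucl d → Eucl d → ℝ} {R lam Lam C : ℝ}

/-- `f n` increases to `w`, and consists of Lipschitz functions that are almost supersolutions. -/
structure IsApproximation (K : Eucl d → Eucl d → ℝ) (C a : ℝ) (w : Eucl d → ℝ)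
    (f : ℕ → Eucl d → ℝ) : Prop where
  lipschitz : ∀ n, ∃ L, LipschitzWith L (f n)
  mono : ∀ m n, m ≤ n → ∀ x, f m x ≤ f n x
  ge : ∀ n x, a ≤ f n x
  le : ∀ n x, f n x ≤ w x
  tendsto : ∀ x, Tendsto (fun n => f n x) atTop (𝓝 (w x))
  approx : ∀ n : ℕ, IsApproxSupersolution K (1 / ((n : ℝ) + 1)) (f n)
  laplacian : ∀ n, HasLaplacianBound (f n) (C + 1)

/-- Each almost supersolution needs its parameter below its own threshold, while the envelopes
increase only if the parameters decrease. Products of the halved thresholds, cut at 1, do both and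
decay geometrically. -/
theorem exists_antitone_lt {ε₀ : ℕ → ℝ} (h : ∀ n, 0 < ε₀ n) :
    ∃ ε : ℕ → ℝ, Antitone ε ∧ (∀ n, 0 < ε n) ∧ (∀ n, ε n < ε₀ n) ∧ Tendsto ε atTop (𝓝 0) := by
  have hδ : ∀ n, 0 < min (ε₀ n) 1 / 2 := fun n => by
    have := h n
    positivity
  have hδ2 : ∀ n, min (ε₀ n) 1 / 2 ≤ 1 / 2 := fun n => by linarith [min_le_right (ε₀ n) 1]
  have hp : ∀ n, 0 < ∏ k ∈ Finset.range n, min (ε₀ k) 1 / 2 := fun n =>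
    Finset.prod_pos fun k _ => hδ k
  have hp1 : ∀ n, ∏ k ∈ Finset.range n, min (ε₀ k) 1 / 2 ≤ (1 / 2) ^ n := fun n => by
    have := Finset.prod_le_prod (s := Finset.range n) (fun k _ => (hδ k).le) fun k _ => hδ2 k
    simpa using this
  refine ⟨fun n => ∏ k ∈ Finset.range (n + 1), min (ε₀ k) 1 / 2, antitone_nat_of_succ_le fun n =>
    ?_, fun n => hp _, fun n => ?_, ?_⟩
  · rw [Finset.prod_range_succ _ (n + 1)]
    exact mul_le_of_le_one_right (hp _).le ((hδ2 _).trans (by norm_num))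
  · simp only [Finset.prod_range_succ _ n]
    have h1 : ∏ k ∈ Finset.range n, min (ε₀ k) 1 / 2 ≤ 1 :=
      (hp1 n).trans (pow_le_one₀ (by norm_num) (by norm_num))
    have h2 := mul_le_of_le_one_left (hδ n).le h1
    have h3 := min_le_left (ε₀ n) 1
    have h4 := h n
    linarith
  · have h1 : Tendsto (fun n : ℕ => (1 / 2 : ℝ) ^ (n + 1)) atTop (𝓝 0) :=
      (tendsto_pow_atTop_nhds_zero_of_lt_one (by norm_num) (by norm_num)).comp
        (tendsto_add_atTop_nat 1)
    exact squeeze_zero (fun n => (hp _).le) (fun n => hp1 _) h1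

theorem IsBoundedLSC.exists_isApproximation {w : Eucl d → ℝ} {a b : ℝ} (hw : IsBoundedLSC w a b)
    (hK : IsLinearHamiltonian K R lam Lam C) (hv : IsRealViscositySupersolution K w) :
    ∃ f, IsApproximation K C a w f := by
  have hγ : ∀ n : ℕ, 0 < 1 / ((n : ℝ) + 1) := fun n => by positivity
  choose ε₀ hε₀ hlap using fun n => hw.exists_laplacian_infConvolution_le hK hv (hγ n)
  obtain ⟨ε, hanti, hpos, hlt, hlim⟩ := exists_antitone_lt hε₀
  refine ⟨fun n => infConvolution w (ε n), fun n => hw.exists_lipschitzWith (hpos n),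
    fun m n hmn => hw.infConvolution_anti (hpos n) (hanti hmn), fun n =>
    hw.le_infConvolution (hpos n), fun n => hw.infConvolution_le_self (hpos n),
    hw.tendsto_infConvolution hpos hlim, fun n => ?_, fun n => ?_⟩
  · obtain ⟨L, hL⟩ := hw.exists_lipschitzWith (hpos n)
    exact isApproxSupersolution_of_laplacian_le hL hK (hlap n _ (hpos n) (hlt n))
  · obtain ⟨L, hL⟩ := hw.exists_lipschitzWith (hpos n)
    intro h hh hc h0
    refine (hasLaplacianBound_of_laplacian_le hL hK (hγ n).le (hlap n _ (hpos n) (hlt n)) h hh hc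
      h0).trans ?_
    have hc1 : ∀ A : ℝ, Integrable fun x : Eucl d => A * (‖x‖ + 1) * h x := fun A =>
      Continuous.integrable_of_hasCompactSupport (by have := hh.continuous; fun_prop) hc.mul_left
    refine integral_mono (hc1 _) (hc1 _) fun x => ?_
    have h1 : 1 / ((n : ℝ) + 1) ≤ 1 := by
      rw [div_le_one (by positivity)]
      linarith [Nat.cast_nonneg (α := ℝ) n]
    have := h0 x
    simp only
    gcongr

theorem IsLinearHamiltonian.integrable_weakForm (hK : IsLinearHamiltonian K R lam Lam C)
    {p : Eucl d → Eucl d} (hp : LocallyIntegrable p volume) {h : Eucl d → ℝ}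
    (hh : ContDiff ℝ ∞ h) (hc : HasCompactSupport h) :
    Integrable (fun x => -(1 / 2 : ℝ) * inner ℝ (p x) (gradient h x)) ∧
    Integrable fun x => K x (p x) * h x := by
  have hcg : Continuous (gradient h) := hh.continuous_gradient (by simp)
  have hhc := hh.continuous
  have hpm := hp.aestronglyMeasurable
  have hpn : LocallyIntegrable (fun x => ‖p x‖) volume :=
    hp.mono hpm.norm (Eventually.of_forall fun x => (norm_norm _).le)
  constructor
  · refine Integrable.const_mul ?_ _
    have h1 := hpn.integrable_smul_left_of_hasCompactSupport hcg.norm hc.gradient.norm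
    refine h1.mono' (hpm.inner hcg.aestronglyMeasurable) (Eventually.of_forall fun x => ?_)
    rw [smul_eq_mul, mul_comm]
    exact norm_inner_le_norm _ _
  · have h1 := hpn.integrable_smul_left_of_hasCompactSupport hhc.norm hc.norm
    have h2 : Integrable fun x : Eucl d => C * (‖x‖ + 1) * ‖h x‖ :=
      Continuous.integrable_of_hasCompactSupport (by fun_prop) hc.norm.mul_left
    refine ((h1.const_mul Lam).add h2).mono' ((hK.aestronglyMeasurable_comp hpm).mul
      hhc.aestronglyMeasurable) (Eventually.of_forall fun x => ?_)
    rw [norm_mul]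
    refine (mul_le_mul_of_nonneg_right (hK.abs_le x (p x)) (norm_nonneg _)).trans (le_of_eq ?_)
    simp only [Pi.add_apply, smul_eq_mul]
    ring

namespace IsApproximation

variable {a b : ℝ} {w : Eucl d → ℝ} {f : ℕ → Eucl d → ℝ}

theorem measurable (h : IsApproximation K C a w f) : Measurable w :=
  measurable_of_tendsto_metrizable (fun n => (h.lipschitz n).choose_spec.continuous.measurable)
    (tendsto_pi_nhds.2 h.tendsto)

theorem ge_limit (h : IsApproximation K C a w f) (x : Eucl d) : a ≤ w x := (h.ge 0 x).trans (h.le 0 x)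

theorem tendsto_integral_linear_mul (h : IsApproximation K C a w f) (hV : IsWeight V lam)
    (hlam : 0 < lam) (hC : 0 < C) (hb : ∀ x, w x ≤ b) :
    Tendsto (fun n => ∫ x, (C * (‖x‖ + 1) + 1) * (w x - f n x) ∂(weightMeasure V)) atTop
      (𝓝 0) := by
  have hfm : ∀ n, Measurable (f n) := fun n => (h.lipschitz n).choose_spec.continuous.measurable
  have h1 := tendsto_integral_of_dominated_convergence (μ := weightMeasure V)
    (F := fun n x => (C * (‖x‖ + 1) + 1) * (w x - f n x)) (f := fun _ => 0)
    (fun x => (C * (‖x‖ + 1) + 1) * (b - a)) (fun n => ?_)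
    (hV.integrable_linear_mul hlam hC aestronglyMeasurable_const (B := |b - a|) (fun _ => le_rfl)
      zero_le_one) (fun n => Eventually.of_forall fun x => ?_) (Eventually.of_forall fun x => ?_)
  · simpa using h1
  · exact Measurable.aestronglyMeasurable (by have := h.measurable; have := hfm n; fun_prop)
  · have h2 := h.le n x
    have h3 := h.ge n x
    have h4 := hb x
    rw [norm_mul, Real.norm_of_nonneg (by positivity), Real.norm_of_nonneg (by linarith)]
    gcongr
  · have := ((h.tendsto x).const_sub (w x)).const_mul (C * (‖x‖ + 1) + 1)
    simpa using this

theorem memLp_gradient (h : IsApproximation K C a w f) (hV : IsWeight V lam) (n : ℕ) :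
    MemLp (gradient (f n)) 2 (weightMeasure V) := by
  have := hV.isProbabilityMeasure
  obtain ⟨L, hL⟩ := h.lipschitz n
  exact MemLp.of_bound (measurable_gradient _).aestronglyMeasurable L
    (Eventually.of_forall hL.norm_gradient_le)

/-- The energies of the approximations. -/
theorem energy_le (h : IsApproximation K C a w f) (hK : IsLinearHamiltonian K R lam Lam C)
    (hV : IsWeight V lam) (hb : ∀ x, w x ≤ b) (n : ℕ) :
    ∫ x, ‖gradient (f n) x‖ ^ 2 ∂(weightMeasure V) ≤
      2 * ((∫ x, (C * (‖x‖ + 1) + 1) * (b - w x) ∂(weightMeasure V)) +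
        ∫ x, (C * (‖x‖ + 1) + 1) * (w x - f n x) ∂(weightMeasure V)) := by
  have hlam := hK.lam_pos
  have hC := hK.C_pos
  obtain ⟨L, hL⟩ := h.lipschitz n
  have hγ : 0 < 1 / ((n : ℝ) + 1) := by positivity
  have hγ1 : 1 / ((n : ℝ) + 1) ≤ 1 := by
    rw [div_le_one (by positivity)]
    linarith [Nat.cast_nonneg (α := ℝ) n]
  have hfb : ∀ x, f n x ≤ b := fun x => (h.le n x).trans (hb x)
  have hwm := h.measurable
  have hfm := hL.continuous.measurable
  refine ((h.approx n).energy_le hK hV hγ.le hL (h.ge n) hfb).trans ?_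
  have bd : ∀ {u : Eucl d → ℝ}, (∀ x, 0 ≤ u x) → (∀ x, u x ≤ b - a) → ∀ x, |u x| ≤ b - a :=
    fun h0 h1 x => by rw [abs_of_nonneg (h0 x)]; exact h1 x
  have i0 : Integrable (fun x => (C * (‖x‖ + 1) + 1 / ((n : ℝ) + 1)) * (b - f n x))
      (weightMeasure V) :=
    hV.integrable_linear_mul hlam hC (measurable_const.sub hfm).aestronglyMeasurable
      (bd (u := fun x => b - f n x) (fun x => by linarith [hfb x]) fun x => by linarith [h.ge n x]) hγ.le
  have i1 : Integrable (fun x => (C * (‖x‖ + 1) + 1) * (b - w x)) (weightMeasure V) :=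
    hV.integrable_linear_mul hlam hC (measurable_const.sub hwm).aestronglyMeasurable
      (bd (u := fun x => b - w x) (fun x => by linarith [hb x]) fun x => by linarith [h.ge_limit x]) zero_le_one
  have i2 : Integrable (fun x => (C * (‖x‖ + 1) + 1) * (w x - f n x)) (weightMeasure V) :=
    hV.integrable_linear_mul hlam hC (hwm.sub hfm).aestronglyMeasurable
      (bd (u := fun x => w x - f n x) (fun x => by linarith [h.le n x]) fun x => by linarith [h.ge n x, hb x]) zero_le_one
  rw [← integral_add i1 i2]
  refine mul_le_mul_of_nonneg_left (integral_mono i0 (i1.add i2) fun x => ?_) zero_le_two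
  have := mul_le_mul_of_nonneg_right hγ1 (show 0 ≤ b - f n x by linarith [hfb x])
  simp only
  linarith

/-- For m ≤ n the squared distance of the gradients is at most E n - E m + 4 δ m, with bounded
energies E and δ tending to zero. An index N whose energy nearly attains the supremum over a tail
makes both contributions small for all n ≥ N, although E need not be monotone. -/
theorem exists_tendsto_gradient (h : IsApproximation K C a w f)
    (hK : IsLinearHamiltonian K R lam Lam C) (hV : IsWeight V lam) (hb : ∀ x, w x ≤ b) :
    ∃ g, MemLp g 2 (weightMeasure V) ∧
      Tendsto (fun n => eLpNorm (gradient (f n) - g) 2 (weightMeasure V)) atTop (𝓝 0) := by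
  have hlam := hK.lam_pos
  have hC := hK.C_pos
  have hlim := h.tendsto_integral_linear_mul hV hlam hC hb
  set δ : ℕ → ℝ := fun n => ∫ x, (C * (‖x‖ + 1) + 1) * (w x - f n x) ∂(weightMeasure V)
  set E : ℕ → ℝ := fun n => ∫ x, ‖gradient (f n) x‖ ^ 2 ∂(weightMeasure V)
  have hE : BddAbove (Set.range E) := by
    obtain ⟨D, hD⟩ := hlim.bddAbove_range
    refine ⟨2 * ((∫ x, (C * (‖x‖ + 1) + 1) * (b - w x) ∂(weightMeasure V)) + D), ?_⟩
    rintro _ ⟨n, rfl⟩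
    refine (h.energy_le hK hV hb n).trans ?_
    gcongr
    exact hD ⟨n, rfl⟩
  have hstep : ∀ m n, m ≤ n →
      ∫ x, ‖gradient (f n) x - gradient (f m) x‖ ^ 2 ∂(weightMeasure V) ≤
        E n - E m + 4 * δ m := by
    intro m n hmn
    obtain ⟨L, hL⟩ := h.lipschitz m
    obtain ⟨L', hL'⟩ := h.lipschitz n
    have hγ : 0 < 1 / ((m : ℝ) + 1) := by positivity
    have hγ1 : 1 / ((m : ℝ) + 1) ≤ 1 := by
      rw [div_le_one (by positivity)]
      linarith [Nat.cast_nonneg (α := ℝ) m]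
    have hwm := h.measurable
    have hbd : ∀ n m x, f n x - f m x ≤ b - a := fun n m x => by
      linarith [h.le n x, hb x, h.ge m x]
    refine ((h.approx m).integral_norm_sub_le hK hV hγ.le hL hL' (h.mono m n hmn)
      (hbd n m)).trans ?_
    have i1 : Integrable (fun x => (C * (‖x‖ + 1) + 1 / ((m : ℝ) + 1)) * (f n x - f m x))
        (weightMeasure V) :=
      hV.integrable_linear_mul hlam hC (hL'.continuous.sub
        hL.continuous).aestronglyMeasurable (B := b - a) (fun x => by
          rw [Pi.sub_apply, abs_of_nonneg (by linarith [h.mono m n hmn x])]; exact hbd n m x) hγ.le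
    have i2 : Integrable (fun x => (C * (‖x‖ + 1) + 1) * (w x - f m x)) (weightMeasure V) :=
      hV.integrable_linear_mul hlam hC (hwm.sub
        hL.continuous.measurable).aestronglyMeasurable (B := b - a) (fun x => by
          rw [Pi.sub_apply, abs_of_nonneg (by linarith [h.le m x])]
          linarith [hb x, h.ge m x]) zero_le_one
    have h0 : ∫ x, (C * (‖x‖ + 1) + 1 / ((m : ℝ) + 1)) * (f n x - f m x) ∂(weightMeasure V) ≤
        δ m := integral_mono i1 i2 fun x => by
      have h1 := h.mono m n hmn x
      have h2 := h.le n x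
      have h3 : 0 ≤ f n x - f m x := by linarith
      simp only
      gcongr
    linarith
  refine exists_tendsto_eLpNorm_two (h.memLp_gradient hV) fun η hη => ?_
  -- With δ below η/8 the term 4δ takes less than η/2; the other half is left for the energy
  -- difference.
  obtain ⟨m₀, hm₀⟩ := (hlim.eventually (gt_mem_nhds (show 0 < η / 8 by positivity))).exists_forall_of_atTop
  set S : Set ℝ := E '' Set.Ici m₀
  have hS : BddAbove S := hE.mono (Set.image_subset_range _ _)
  obtain ⟨_, ⟨N, hN, rfl⟩, hNS⟩ := exists_lt_of_lt_csSup (⟨E m₀, m₀, Set.mem_Ici.2 le_rfl, rfl⟩ : S.Nonempty)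
    (show sSup S - η / 2 < sSup S by linarith)
  refine ⟨N, fun n hn => (hstep N n hn).trans_lt ?_⟩
  have h1 : E n ≤ sSup S := le_csSup hS ⟨n, le_trans (Set.mem_Ici.1 hN) hn, rfl⟩
  have h2 := hm₀ N hN
  linarith

theorem tendsto_eLpNorm_one (h : IsApproximation K C a w f) (hV : IsWeight V lam)
    {g : Eucl d → Eucl d} (hg : MemLp g 2 (weightMeasure V))
    (hlim : Tendsto (fun n => eLpNorm (gradient (f n) - g) 2 (weightMeasure V)) atTop (𝓝 0)) :
    Tendsto (fun n => eLpNorm (gradient (f n) - g) 1 (weightMeasure V)) atTop (𝓝 0) := by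
  have := hV.isProbabilityMeasure
  exact tendsto_of_tendsto_of_tendsto_of_le_of_le tendsto_const_nhds hlim (fun _ => zero_le)
    fun n => eLpNorm_le_eLpNorm_of_exponent_le (by norm_num)
      ((h.memLp_gradient hV n).sub hg).aestronglyMeasurable

theorem tendsto_setIntegral_gradient (h : IsApproximation K C a w f) (hV : IsWeight V lam)
    {g : Eucl d → Eucl d} (hg : MemLp g 2 (weightMeasure V))
    (hlim : Tendsto (fun n => eLpNorm (gradient (f n) - g) 2 (weightMeasure V)) atTop (𝓝 0))
    (r : ℝ) :
    Tendsto (fun n => ∫ x in Metric.closedBall 0 r, ‖gradient (f n) x - g x‖) atTop (𝓝 0) :=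
  tendsto_setIntegral_norm_of_eLpNorm hV.continuous (fun _ =>
    (measurable_gradient _).aestronglyMeasurable.sub (hg.aestronglyMeasurable.mono_ac
      (absolutelyContinuous_weightMeasure hV.continuous))) (h.tendsto_eLpNorm_one hV hg hlim) r

theorem hasWeakGradient (h : IsApproximation K C a w f) (hV : IsWeight V lam)
    (hb : ∀ x, w x ≤ b) {g : Eucl d → Eucl d} (hg : MemLp g 2 (weightMeasure V))
    (hlim : Tendsto (fun n => eLpNorm (gradient (f n) - g) 2 (weightMeasure V)) atTop (𝓝 0)) :
    HasWeakGradient w g := by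
  have hwm := h.measurable
  have hfm : ∀ n, Measurable (f n) := fun n => (h.lipschitz n).choose_spec.continuous.measurable
  have hfin : ∀ r, IsFiniteMeasure (volume.restrict (Metric.closedBall (0 : Eucl d) r)) := fun r =>
    isFiniteMeasure_restrict.2 (isCompact_closedBall 0 r).measure_ne_top
  refine HasWeakGradient.of_tendsto (fun n => (h.lipschitz n).choose_spec.hasWeakGradient) ?_
    (MemLp.locallyIntegrable_of_weightMeasure (by norm_num) hg hV.continuous) (fun r => ?_)
    (h.tendsto_setIntegral_gradient hV hg hlim)
  · refine (locallyIntegrable_const (max |a| |b|)).mono hwm.aestronglyMeasurable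
      (Eventually.of_forall fun x => ?_)
    rw [Real.norm_eq_abs, Real.norm_of_nonneg (le_max_of_le_left (abs_nonneg _))]
    exact abs_le_max_abs_abs (h.ge_limit x) (hb x)
  · have h1 := tendsto_integral_of_dominated_convergence
      (μ := volume.restrict (Metric.closedBall (0 : Eucl d) r))
      (F := fun n x => ‖f n x - w x‖) (f := fun _ => 0) (fun _ => b - a) (fun n => ?_)
      (integrable_const (b - a)) (fun n => Eventually.of_forall fun x => ?_)
      (Eventually.of_forall fun x => ?_)
    · simpa using h1
    · exact ((hfm n).sub hwm).norm.aestronglyMeasurable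
    · rw [norm_norm, norm_sub_rev, Real.norm_of_nonneg (by linarith [h.le n x])]
      linarith [hb x, h.ge n x]
    · have := ((h.tendsto x).sub_const (w x)).norm
      simpa using this

/-- For a smooth test function, K being Lipschitz in the gradient, replacing the limit gradient by
that of f n changes the weak form by at most a constant times their L¹ distance on a ball, which
tends to zero. Since g is locally square integrable, mollification extends the inequality to all of
H¹. -/
theorem isWeakSupersolution (h : IsApproximation K C a w f)
    (hK : IsLinearHamiltonian K R lam Lam C) (hV : IsWeight V lam)
    (hb : ∀ x, w x ≤ b) {g : Eucl d → Eucl d} (hg : MemLp g 2 (weightMeasure V))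
    (hlim : Tendsto (fun n => eLpNorm (gradient (f n) - g) 2 (weightMeasure V)) atTop (𝓝 0)) :
    IsWeakSupersolution V K w := by
  have hwg := h.hasWeakGradient hV hb hg hlim
  have hloc := hwg.locallyIntegrable_grad
  have hR := hK.R_nonneg
  intro k hk hkc hk0
  have hfin : ∀ r, IsFiniteMeasure (volume.restrict (Metric.closedBall (0 : Eucl d) r)) := fun r =>
    isFiniteMeasure_restrict.2 (isCompact_closedBall 0 r).measure_ne_top
  have hp : ∀ r, MemLp g 2 (volume.restrict (Metric.closedBall 0 r)) := fun r =>
    MemLp.restrict_of_weightMeasure hg hV.continuous (isCompact_closedBall 0 r)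
  have hκ : ∀ r, MemLp (fun x => K x (g x)) 2 (volume.restrict (Metric.closedBall 0 r)) := by
    intro r
    have h1 : MemLp (fun _ : Eucl d => C * (r + 1)) 2 (volume.restrict (Metric.closedBall 0 r)) :=
      memLp_const _
    refine (((hp r).norm.const_mul Lam).add h1).mono'
      (hK.aestronglyMeasurable_comp (hp r).aestronglyMeasurable) ?_
    refine (ae_restrict_iff' measurableSet_closedBall).2 (Eventually.of_forall fun x hx => ?_)
    refine (hK.abs_le x (g x)).trans ?_
    have hC := hK.C_pos
    simp only [Pi.add_apply]
    gcongr
    simpa using hx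
  have hmain := integral_nonpos_of_forall_contDiff hV.continuous hp hκ (fun k hk hkc hk0 => ?_)
    hk hkc hk0
  · have hae := hwg.weakGradient_ae_eq
    have e : (fun x => -(1 / 2 : ℝ) * inner ℝ (weakGradient w x) (weakGradient k x)
        + K x (weakGradient w x) * k x) =ᵐ[volume] fun x =>
        -(1 / 2 : ℝ) * inner ℝ (g x) (weakGradient k x) + K x (g x) * k x := by
      filter_upwards [hae] with x hx
      rw [hx]
    exact ⟨hmain.1.congr e.symm, (integral_congr_ae e).trans_le hmain.2⟩
  · obtain ⟨r, hr⟩ := hkc.isCompact.isBounded.subset_closedBall 0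
    have hcg : Continuous (gradient k) := hk.continuous_gradient (by simp)
    obtain ⟨B₁, hB₁⟩ := hkc.gradient.exists_bound_of_continuous hcg
    obtain ⟨B₂, hB₂⟩ := hkc.exists_bound_of_continuous hk.continuous
    have hki : Integrable k := hk.continuous.integrable_of_hasCompactSupport hkc
    obtain ⟨j1, j2⟩ := hK.integrable_weakForm hloc hk hkc
    obtain ⟨L', hL'⟩ := hk.lipschitzWith_of_hasCompactSupport hkc (by simp)
    have hball : ∀ n, Integrable ((Metric.closedBall (0 : Eucl d) r).indicator fun x =>
        ‖gradient (f n) x - g x‖) := fun n =>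
      (integrable_indicator_iff measurableSet_closedBall).2
        (((h.lipschitz n).choose_spec.locallyIntegrable_gradient.sub hloc).integrableOn_isCompact
          (isCompact_closedBall 0 r)).norm
    have hn : ∀ n : ℕ, ∫ x, (-(1 / 2 : ℝ) * inner ℝ (g x) (gradient k x) + K x (g x) * k x) ≤
        (1 / 2 * B₁ + R * B₂) * (∫ x in Metric.closedBall 0 r, ‖gradient (f n) x - g x‖) +
        1 / ((n : ℝ) + 1) * ∫ x, k x := by
      intro n
      obtain ⟨L, hL⟩ := h.lipschitz n
      obtain ⟨l1, l2⟩ := hK.integrable_weakForm hL.locallyIntegrable_gradient hk hkc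
      have h1 := h.approx n L' k hL' hkc hk0
      have l3 : Integrable fun x => -(1 / 2 : ℝ) * inner ℝ (gradient (f n) x) (gradient k x) +
          (K x (gradient (f n) x) - 1 / ((n : ℝ) + 1)) * k x := by
        refine (l1.add (l2.sub (hki.const_mul (1 / ((n : ℝ) + 1))))).congr
          (Eventually.of_forall fun x => ?_)
        simp only [Pi.add_apply, Pi.sub_apply]
        ring
      have l4 := (hball n).const_mul (1 / 2 * B₁ + R * B₂)
      have l5 := hki.const_mul (1 / ((n : ℝ) + 1))
      have h2 : ∫ x, (-(1 / 2 : ℝ) * inner ℝ (g x) (gradient k x) + K x (g x) * k x) ≤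
          ∫ x, ((-(1 / 2 : ℝ) * inner ℝ (gradient (f n) x) (gradient k x) +
          (K x (gradient (f n) x) - 1 / ((n : ℝ) + 1)) * k x) +
          ((1 / 2 * B₁ + R * B₂) * (Metric.closedBall (0 : Eucl d) r).indicator (fun x =>
            ‖gradient (f n) x - g x‖) x + 1 / ((n : ℝ) + 1) * k x)) := by
        refine integral_mono (j1.add j2) (l3.add (l4.add l5)) fun x => ?_
        have h3 : -(1 / 2 : ℝ) * inner ℝ (g x) (gradient k x) + 1 / 2 *
            inner ℝ (gradient (f n) x) (gradient k x) + (K x (g x) - K x (gradient (f n) x)) * k x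
            ≤ (1 / 2 * B₁ + R * B₂) * (Metric.closedBall (0 : Eucl d) r).indicator (fun x =>
            ‖gradient (f n) x - g x‖) x := by
          by_cases hx : x ∈ Metric.closedBall (0 : Eucl d) r
          · rw [Set.indicator_of_mem hx]
            have h4 : inner ℝ (gradient (f n) x - g x) (gradient k x) ≤
                ‖gradient (f n) x - g x‖ * B₁ :=
              (real_inner_le_norm _ _).trans (by gcongr; exact hB₁ x)
            have h5 : (K x (g x) - K x (gradient (f n) x)) * k x ≤
                R * ‖gradient (f n) x - g x‖ * B₂ := by
              refine (le_abs_self _).trans ?_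
              rw [abs_mul]
              have h6 := hK.lipschitz x (g x) (gradient (f n) x)
              rw [norm_sub_rev] at h6
              gcongr
              exact hB₂ x
            rw [inner_sub_left] at h4
            linarith
          · rw [Set.indicator_of_notMem hx]
            have hx' : x ∉ tsupport k := fun hx' => hx (hr hx')
            have h4 : k x = 0 := image_eq_zero_of_notMem_tsupport hx'
            have h5 : gradient k x = 0 := by
              have : fderiv ℝ k x = 0 := by
                by_contra h3
                exact hx' (support_fderiv_subset ℝ h3)
              rw [gradient, this, map_zero]
            rw [h4, h5]
            simp
        simp only
        linarith
      refine h2.trans ?_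
      have l6 : Integrable fun x => (1 / 2 * B₁ + R * B₂) *
          (Metric.closedBall (0 : Eucl d) r).indicator (fun x => ‖gradient (f n) x - g x‖) x +
          1 / ((n : ℝ) + 1) * k x := l4.add l5
      rw [integral_add l3 l6]
      have h6 : ∫ x, ((1 / 2 * B₁ + R * B₂) * (Metric.closedBall (0 : Eucl d) r).indicator (fun x =>
            ‖gradient (f n) x - g x‖) x + 1 / ((n : ℝ) + 1) * k x) =
          (1 / 2 * B₁ + R * B₂) * (∫ x in Metric.closedBall 0 r, ‖gradient (f n) x - g x‖) +
          1 / ((n : ℝ) + 1) * ∫ x, k x := by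
        rw [integral_add l4 l5, integral_const_mul, integral_const_mul,
          integral_indicator measurableSet_closedBall]
      linarith
    have hlim2 := (((h.tendsto_setIntegral_gradient hV hg hlim r).const_mul
      (1 / 2 * B₁ + R * B₂)).add
      ((tendsto_one_div_add_atTop_nhds_zero_nat (𝕜 := ℝ)).mul_const (∫ x, k x)))
    simp only [mul_zero, zero_mul, add_zero] at hlim2
    exact ge_of_tendsto' hlim2 hn

end IsApproximation

end Approximation

/-! ### Norm bounds for the limit and gradients of truncations -/

section Bounds

variable {d : ℕ} {V : Eucl d → ℝ} {K : Eucl d → Eucl d → ℝ} {R lam Lam C : ℝ} {a b : ℝ}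
  {w : Eucl d → ℝ} {f : ℕ → Eucl d → ℝ} {g : Eucl d → Eucl d}

theorem one_div_succ_le_one (n : ℕ) : 1 / ((n : ℝ) + 1) ≤ 1 := by
  rw [div_le_one (by positivity)]
  linarith [Nat.cast_nonneg (α := ℝ) n]

theorem eLpNorm_le_of_tendsto_sub {α F : Type*} [MeasurableSpace α] {μ : Measure α}
    [NormedAddCommGroup F] {p : ℝ≥0∞} (hp : 1 ≤ p) {u : ℕ → α → F} {g : α → F}
    (hu : ∀ n, AEStronglyMeasurable (u n) μ) (hg : AEStronglyMeasurable g μ)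
    (hlim : Tendsto (fun n => eLpNorm (u n - g) p μ) atTop (𝓝 0)) {c : ℕ → ℝ≥0∞} {c' : ℝ≥0∞}
    (hc : ∀ n, eLpNorm (u n) p μ ≤ c n) (hc' : Tendsto c atTop (𝓝 c')) : eLpNorm g p μ ≤ c' := by
  have h1 := hc'.add hlim
  rw [add_zero] at h1
  refine ge_of_tendsto' h1 fun n => ?_
  have h2 : g = u n - (u n - g) := by simp
  calc eLpNorm g p μ = eLpNorm (u n - (u n - g)) p μ := by rw [← h2]
    _ ≤ eLpNorm (u n) p μ + eLpNorm (u n - g) p μ := eLpNorm_sub_le (hu n) ((hu n).sub hg) hp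
    _ ≤ _ := by gcongr; exact hc n

theorem IsApproximation.eLpNorm_two_le (h : IsApproximation K C a w f)
    (hK : IsLinearHamiltonian K R lam Lam C) (hV : IsWeight V lam) (hb : ∀ x, w x ≤ b)
    (hg : MemLp g 2 (weightMeasure V))
    (hlim : Tendsto (fun n => eLpNorm (gradient (f n) - g) 2 (weightMeasure V)) atTop (𝓝 0)) :
    eLpNorm g 2 (weightMeasure V) ≤
      ENNReal.ofReal (√(2 * ∫ x, (C * (‖x‖ + 1) + 1) * (b - w x) ∂(weightMeasure V))) := by
  refine eLpNorm_le_of_tendsto_sub (by norm_num)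
    (fun n => (h.memLp_gradient hV n).aestronglyMeasurable) hg.aestronglyMeasurable hlim
    (c := fun n => ENNReal.ofReal (√(2 * ((∫ x, (C * (‖x‖ + 1) + 1) * (b - w x)
      ∂(weightMeasure V)) + ∫ x, (C * (‖x‖ + 1) + 1) * (w x - f n x) ∂(weightMeasure V)))))
    (fun n => ?_) ?_
  · rw [(h.memLp_gradient hV n).eLpNorm_two_eq]
    exact ENNReal.ofReal_le_ofReal (Real.sqrt_le_sqrt (h.energy_le hK hV hb n))
  · have h1 := (((h.tendsto_integral_linear_mul hV hK.lam_pos hK.C_pos hb).const_add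
      (∫ x, (C * (‖x‖ + 1) + 1) * (b - w x) ∂(weightMeasure V))).const_mul 2).sqrt
    rw [add_zero] at h1
    exact ENNReal.tendsto_ofReal h1

/-- The a priori bound for `∫ |∇f| e^{-V/2}`. -/
noncomputable def gradientBound (V : Eucl d → ℝ) (lam C : ℝ) : ℝ :=
  2 / lam * ∫ x, (C * (‖x‖ + 1) + 1) * Real.exp (-(1 / 2 * V x))

theorem IsApproximation.integral_norm_gradient_le (h : IsApproximation K C a w f)
    (hK : IsLinearHamiltonian K R lam Lam C) (hV : IsWeight V lam) (n : ℕ) :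
    ∫ x, ‖gradient (f n) x‖ * Real.exp (-(1 / 2 * V x)) ≤ gradientBound V lam C :=
  (h.approx n).integral_norm_gradient_le hK hV (by positivity) (one_div_succ_le_one n)
    (h.lipschitz n).choose_spec

theorem IsApproximation.eLpNorm_one_le (h : IsApproximation K C a w f)
    (hK : IsLinearHamiltonian K R lam Lam C) (hV : IsWeight V lam) {b₀ : ℝ} (hb₀ : ∀ x, -b₀ ≤ V x)
    (hg : MemLp g 2 (weightMeasure V))
    (hlim : Tendsto (fun n => eLpNorm (gradient (f n) - g) 2 (weightMeasure V)) atTop (𝓝 0)) :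
    eLpNorm g 1 (weightMeasure V) ≤
      ENNReal.ofReal (Real.exp (b₀ / 2) * gradientBound V lam C) := by
  have hlam := hK.lam_pos
  have := hV.isProbabilityMeasure
  refine eLpNorm_le_of_tendsto_sub le_rfl
    (fun n => (h.memLp_gradient hV n).aestronglyMeasurable) hg.aestronglyMeasurable
    (h.tendsto_eLpNorm_one hV hg hlim) (fun n => ?_) tendsto_const_nhds
  obtain ⟨L, hL⟩ := h.lipschitz n
  have i0 : Integrable (gradient (f n)) (weightMeasure V) :=
    (h.memLp_gradient hV n).integrable (by norm_num)
  have i1 : Integrable fun x => ‖gradient (f n) x‖ * Real.exp (-(1 / 2 * V x)) :=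
    hV.integrable_mul_exp hlam (by norm_num) (measurable_gradient _).norm.aestronglyMeasurable
      (B := L) 0 fun x => by simpa using hL.norm_gradient_le x
  rw [eLpNorm_one_eq_lintegral_enorm, ← ofReal_integral_norm_eq_lintegral_enorm i0]
  refine ENNReal.ofReal_le_ofReal ?_
  have h1 := h.integral_norm_gradient_le hK hV n
  refine le_trans ?_ (mul_le_mul_of_nonneg_left h1 (Real.exp_pos _).le)
  rw [integral_weightMeasure hV.continuous, ← integral_const_mul]
  refine integral_mono ?_ (i1.const_mul _) fun x => ?_
  · exact (integrable_weightMeasure_iff hV.continuous _).1 i0.norm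
  · simp only [smul_eq_mul]
    rw [mul_left_comm, mul_comm, ← Real.exp_add]
    gcongr
    linarith [hb₀ x]

theorem gradient_min_const {u : Eucl d → ℝ} {M : ℝ} {x : Eucl d}
    (hu : DifferentiableAt ℝ u x) :
    gradient (fun y => min (u y) M) x = if u x < M then gradient u x else 0 := by
  split_ifs with h
  · have h1 : (fun y => min (u y) M) =ᶠ[𝓝 x] u := by
      filter_upwards [hu.continuousAt.eventually (gt_mem_nhds h)] with y hy
      exact min_eq_left hy.le
    rw [gradient, gradient, h1.fderiv_eq]
  · have h1 : IsLocalMax (fun y => min (u y) M) x := by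
      refine Eventually.of_forall fun y => ?_
      simp only
      rw [min_eq_right (not_lt.1 h)]
      exact min_le_right _ _
    rw [gradient, h1.fderiv_eq_zero, map_zero]

/-- The weak gradient of a truncation. -/
theorem IsApproximation.hasWeakGradient_min (h : IsApproximation K C a w f) (hV : IsWeight V lam)
    (hb : ∀ x, w x ≤ b) (hg : MemLp g 2 (weightMeasure V))
    (hlim : Tendsto (fun n => eLpNorm (gradient (f n) - g) 2 (weightMeasure V)) atTop (𝓝 0))
    (M : ℝ) :
    HasWeakGradient (fun x => min (w x) M) ({x | w x ≤ M}.indicator g) := by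
  have hwm := h.measurable
  have hfm : ∀ n, Measurable (f n) := fun n => (h.lipschitz n).choose_spec.continuous.measurable
  have hfin : ∀ r, IsFiniteMeasure (volume.restrict (Metric.closedBall (0 : Eucl d) r)) := fun r =>
    isFiniteMeasure_restrict.2 (isCompact_closedBall 0 r).measure_ne_top
  have hgl : LocallyIntegrable g volume :=
    MemLp.locallyIntegrable_of_weightMeasure (by norm_num) hg hV.continuous
  have hSm : MeasurableSet {x | w x ≤ M} := measurableSet_le hwm measurable_const
  have hgS : LocallyIntegrable ({x | w x ≤ M}.indicator g) volume :=
    hgl.mono (hgl.aestronglyMeasurable.indicator hSm)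
      (Eventually.of_forall fun x => norm_indicator_le_norm_self _ _)
  have hs : Tendsto (fun n : ℕ => 1 / ((n : ℝ) + 1)) atTop (𝓝 0) :=
    tendsto_one_div_add_atTop_nhds_zero_nat
  have hLip : ∀ n : ℕ, ∃ L, LipschitzWith L fun x => f n x - 1 / ((n : ℝ) + 1) := fun n => by
    obtain ⟨L, hL⟩ := h.lipschitz n
    exact ⟨L + 0, hL.sub (LipschitzWith.const _)⟩
  have hLipM : ∀ n : ℕ, ∃ L, LipschitzWith L fun x => min (f n x - 1 / ((n : ℝ) + 1)) M := fun n =>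
    by
    obtain ⟨L, hL⟩ := hLip n
    exact ⟨L, hL.min_const M⟩
  -- The shift by 1/(n+1) puts the set w ≤ M inside every T n, while a point with w > M lies outside
  -- T n for large n. The indicators therefore converge everywhere, and nothing has to be known
  -- about the gradient on the level set w = M.
  set T : ℕ → Set (Eucl d) := fun n => {x | f n x - 1 / ((n : ℝ) + 1) < M} with hT
  have hTm : ∀ n, MeasurableSet (T n) := fun n =>
    measurableSet_lt ((hfm n).sub_const _) measurable_const
  have hgrad : ∀ n : ℕ, HasWeakGradient (fun x => min (f n x - 1 / ((n : ℝ) + 1)) M)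
      ((T n).indicator (gradient (f n))) := by
    intro n
    obtain ⟨L, hL⟩ := h.lipschitz n
    obtain ⟨L', hL'⟩ := hLipM n
    refine hL'.hasWeakGradient.congr (EventuallyEq.refl _ _) ?_
    filter_upwards [hL.ae_differentiableAt (μ := volume)] with x hx
    rw [gradient_min_const (u := fun x => f n x - 1 / ((n : ℝ) + 1)) (hx.sub_const _),
      Set.indicator_apply]
    congr 1
    rw [gradient, gradient, fderiv_sub_const]
  have hsub : ∀ n x, w x ≤ M → x ∈ T n := fun n x hx => by
    have : 0 < 1 / ((n : ℝ) + 1) := by positivity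
    have := h.le n x
    change f n x - 1 / ((n : ℝ) + 1) < M
    linarith
  refine HasWeakGradient.of_tendsto hgrad ?_ hgS (fun r => ?_) fun r => ?_
  · refine (locallyIntegrable_const (max |min a M| |M|)).mono
      (hwm.min measurable_const).aestronglyMeasurable (Eventually.of_forall fun x => ?_)
    rw [Real.norm_eq_abs, Real.norm_of_nonneg (le_max_of_le_left (abs_nonneg _))]
    exact abs_le_max_abs_abs (min_le_min_right M (h.ge_limit x)) (min_le_right _ _)
  · have h1 := tendsto_integral_of_dominated_convergence
      (μ := volume.restrict (Metric.closedBall (0 : Eucl d) r))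
      (F := fun (n : ℕ) x => ‖min (f n x - 1 / ((n : ℝ) + 1)) M - min (w x) M‖) (f := fun _ => 0)
      (fun _ => b - a + 1) (fun n => ?_)
      (integrable_const (b - a + 1)) (fun n => Eventually.of_forall fun x => ?_)
      (Eventually.of_forall fun x => ?_)
    · simpa using h1
    · exact ((((hfm n).sub_const _).min measurable_const).sub
        (hwm.min measurable_const)).norm.aestronglyMeasurable
    · rw [norm_norm]
      refine (abs_min_sub_min_le_max _ _ _ _).trans ?_
      have h2 : 0 < 1 / ((n : ℝ) + 1) := by positivity
      have h3 := one_div_succ_le_one n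
      have h4 := h.le n x
      have h5 := h.ge n x
      have h6 := hb x
      rw [sub_self, abs_zero, max_eq_left (abs_nonneg _), abs_le]
      constructor <;> linarith
    · have h2 := (((((h.tendsto x).sub hs).min (tendsto_const_nhds (x := M))).sub_const
        (min (w x) M))).norm
      simpa using h2
  · have hsec : Tendsto (fun n => ∫ x in Metric.closedBall (0 : Eucl d) r,
        (T n \ {x | w x ≤ M}).indicator (fun x => ‖g x‖) x) atTop (𝓝 0) := by
      have h1 := tendsto_integral_of_dominated_convergence
        (μ := volume.restrict (Metric.closedBall (0 : Eucl d) r))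
        (F := fun n => (T n \ {x | w x ≤ M}).indicator (fun x => ‖g x‖)) (f := fun _ => 0)
        (fun x => ‖g x‖) (fun n => ?_)
        (hgl.integrableOn_isCompact (isCompact_closedBall 0 r)).norm
        (fun n => Eventually.of_forall fun x => ?_) (Eventually.of_forall fun x => ?_)
      · simpa using h1
      · exact hgl.aestronglyMeasurable.norm.restrict.indicator ((hTm n).diff hSm)
      · exact (norm_indicator_le_norm_self _ _).trans (norm_norm _).le
      · refine tendsto_const_nhds.congr' ?_
        by_cases hx : w x ≤ M
        · refine Eventually.of_forall fun n => ?_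
          exact (Set.indicator_of_notMem (fun hx' => hx'.2 hx) _).symm
        · have h2 := (h.tendsto x).sub hs
          rw [sub_zero] at h2
          filter_upwards [h2.eventually (lt_mem_nhds (not_le.1 hx))] with n hn
          exact (Set.indicator_of_notMem (fun hx' => lt_irrefl _ (hn.trans hx'.1)) _).symm
    have hsum := (h.tendsto_setIntegral_gradient hV hg hlim r).add hsec
    rw [add_zero] at hsum
    refine squeeze_zero (fun n => integral_nonneg fun x => norm_nonneg _) (fun n => ?_) hsum
    have l1 := (((h.lipschitz n).choose_spec.locallyIntegrable_gradient.sub hgl).integrableOn_isCompact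
      (isCompact_closedBall 0 r)).norm
    have l2 : IntegrableOn ((T n \ {x | w x ≤ M}).indicator (fun x => ‖g x‖))
        (Metric.closedBall 0 r) :=
      (hgl.integrableOn_isCompact (isCompact_closedBall 0 r)).norm.indicator ((hTm n).diff hSm)
    have l3 := (((hgrad n).locallyIntegrable_grad.sub hgS).integrableOn_isCompact
      (isCompact_closedBall 0 r)).norm
    refine (integral_mono l3 (l1.add l2) fun x => ?_).trans_eq (integral_add l1 l2)
    simp only [Pi.sub_apply, Pi.add_apply]
    by_cases hx : w x ≤ M
    · rw [Set.indicator_of_mem (hsub n x hx), Set.indicator_of_mem (show x ∈ {x | w x ≤ M} from hx),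
        Set.indicator_of_notMem fun hx' => hx'.2 hx, add_zero]
    · by_cases hx' : x ∈ T n
      · rw [Set.indicator_of_mem hx', Set.indicator_of_notMem (show x ∉ {x | w x ≤ M} from hx),
          Set.indicator_of_mem (show x ∈ T n \ {x | w x ≤ M} from ⟨hx', hx⟩), sub_zero]
        have := norm_add_le (gradient (f n) x - g x) (g x)
        rwa [sub_add_cancel] at this
      · rw [Set.indicator_of_notMem hx', Set.indicator_of_notMem (show x ∉ {x | w x ≤ M} from hx),
          Set.indicator_of_notMem fun hx'' => hx' hx''.1, sub_zero, norm_zero, add_zero]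
        exact norm_nonneg _

end Bounds

/-! ### An L¹ Poincaré inequality for log-concave weights -/

section Poincare

variable {d : ℕ} {V : Eucl d → ℝ} {lam : ℝ}

open Classical in
/-- The norm of the derivative, set to `∞` where `f` is not differentiable. -/
noncomputable def extendedSlope (f : Eucl d → ℝ) (x : Eucl d) : ℝ≥0∞ :=
  if DifferentiableAt ℝ f x then ‖gradient f x‖ₑ else ⊤

theorem measurable_extendedSlope (f : Eucl d → ℝ) : Measurable (extendedSlope f) :=
  Measurable.ite (measurableSet_of_differentiableAt ℝ f) (measurable_gradient f).enorm
    measurable_const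

theorem LipschitzWith.extendedSlope_ae_eq {f : Eucl d → ℝ} {L : ℝ≥0} (hf : LipschitzWith L f) :
    extendedSlope f =ᵐ[volume] fun x => ‖_root_.gradient f x‖ₑ := by
  filter_upwards [hf.ae_differentiableAt (μ := volume)] with x hx
  rw [extendedSlope, if_pos hx]

/-- The fundamental theorem of calculus on the segment. Giving the slope the value ∞ at points of
non-differentiability makes the bound true for every pair x, y, even if the whole segment lies in
the exceptional null set. -/
theorem LipschitzWith.enorm_sub_midpoint_le {f : Eucl d → ℝ} {L : ℝ≥0} (hf : LipschitzWith L f)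
    (x y : Eucl d) :
    ‖f ((1 / 2 : ℝ) • x + (1 / 2 : ℝ) • y) - f x‖ₑ ≤
      ∫⁻ s in Set.Ioc (0 : ℝ) (1 / 2), ‖y - x‖ₑ * extendedSlope f ((1 - s) • x + s • y) := by
  rcases eq_or_ne x y with rfl | hne
  · rw [← add_smul]
    norm_num
  have hγ : ∀ s : ℝ, HasDerivAt (fun s : ℝ => (1 - s) • x + s • y) (y - x) s := fun s => by
    have h1 : HasDerivAt (fun s : ℝ => (1 - s) • x) ((-1 : ℝ) • x) s :=
      ((hasDerivAt_id s).const_sub 1).smul_const x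
    have h2 : HasDerivAt (fun s : ℝ => s • y) ((1 : ℝ) • y) s := (hasDerivAt_id s).smul_const y
    refine (h1.add h2).congr_deriv ?_
    simp [sub_eq_neg_add]
  have hlip : LipschitzWith (L * ‖y - x‖₊) fun s : ℝ => f ((1 - s) • x + s • y) := by
    refine hf.comp (LipschitzWith.of_dist_le_mul fun s t => ?_)
    have e : (1 - s) • x + s • y - ((1 - t) • x + t • y) = (s - t) • (y - x) := by
      module
    rw [dist_eq_norm, e, norm_smul, mul_comm, coe_nnnorm, dist_eq_norm]
  have hac := (hlip.lipschitzOnWith (s := Set.uIcc 0 (1 / 2))).absolutelyContinuousOnInterval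
  have h1 := hac.integral_deriv_eq_sub
  have e1 : f ((1 / 2 : ℝ) • x + (1 / 2 : ℝ) • y) - f x =
      ∫ s in (0 : ℝ)..(1 / 2), deriv (fun s : ℝ => f ((1 - s) • x + s • y)) s := by
    rw [h1]
    norm_num
  rw [e1, intervalIntegral.integral_of_le (by norm_num)]
  refine (enorm_integral_le_lintegral_enorm _).trans (lintegral_mono fun s => ?_)
  by_cases hd : DifferentiableAt ℝ f ((1 - s) • x + s • y)
  · have h3 : HasDerivAt (fun s : ℝ => f ((1 - s) • x + s • y))
        (fderiv ℝ f ((1 - s) • x + s • y) (y - x)) s :=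
      hd.hasFDerivAt.comp_hasDerivAt s (hγ s)
    rw [extendedSlope, if_pos hd, h3.deriv, ← ofReal_norm, ← ofReal_norm, ← ofReal_norm, ← ENNReal.ofReal_mul (norm_nonneg _),
      norm_gradient, mul_comm]
    exact ENNReal.ofReal_le_ofReal (ContinuousLinearMap.le_opNorm _ _)
  · rw [extendedSlope, if_neg hd, ENNReal.mul_top]
    · exact le_top
    · rw [enorm_ne_zero, sub_ne_zero]
      exact hne.symm

/-- The factor 1 - s is at least ½, which bounds the Jacobian by 2^d. This is the reason for
stopping at the midpoint. -/
theorem lintegral_comp_affine_le {F : Eucl d → ℝ≥0∞} (hF : Measurable F) {s : ℝ}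
    (hs : s ≤ 1 / 2) (y : Eucl d) :
    ∫⁻ x, F ((1 - s) • x + s • y) ≤ ENNReal.ofReal (2 ^ d) * ∫⁻ z, F z := by
  have hs1 : (0 : ℝ) < 1 - s := by linarith
  have hH : Measurable fun z => F (z + s • y) := hF.comp (measurable_id.add_const _)
  have h1 := lintegral_map hH (measurable_const_smul (α := Eucl d) (1 - s)) (μ := volume)
  rw [← h1, Measure.map_addHaar_smul _ hs1.ne', lintegral_smul_measure,
    lintegral_add_right_eq_self, smul_eq_mul]
  gcongr
  rw [finrank_euclideanSpace_fin, abs_of_pos (by positivity), ← inv_pow]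
  gcongr
  rw [inv_le_comm₀ hs1 two_pos]
  linarith

/-- Convexity gives V(z) ≤ (1 - s)V(x) + sV(y) at the intermediate point z, so V(x) + V(y) ≥ V(z) +
sV(x) + (1 - s)V(y). As s ≤ ½, the last term still grows like (a/2)‖y‖ and provides decay in y; V is
bounded below, which takes care of sV(x). -/
theorem IsWeight.exists_weight_mul_le (hV : IsWeight V lam) (hlam : 0 < lam) :
    ∃ A > 0, ∃ α > 0, ∀ (x y : Eucl d) (s : ℝ), 0 ≤ s → s ≤ 1 / 2 →
      Real.exp (-V x) * Real.exp (-V y) * ‖y - x‖ ≤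
        A * ((1 + ‖y‖) * Real.exp (-(α * ‖y‖))) *
          ((1 + ‖(1 - s) • x + s • y‖) * Real.exp (-V ((1 - s) • x + s • y))) := by
  obtain ⟨a, ha, b, hb⟩ := hV.exists_linear_lower hlam
  refine ⟨2 * Real.exp (2 * |b|), by positivity, a / 2, by positivity, fun x y s hs0 hs => ?_⟩
  set z := (1 - s) • x + s • y with hz
  have hs1 : 0 < 1 - s := by linarith
  have h1 : ‖y - x‖ ≤ 2 * ((1 + ‖y‖) * (1 + ‖z‖)) := by
    have e : y - z = (1 - s) • (y - x) := by rw [hz]; module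
    have h2 : (1 - s) * ‖y - x‖ = ‖y - z‖ := by
      rw [e, norm_smul, Real.norm_of_nonneg hs1.le]
    have h3 := norm_sub_le y z
    have h4 : 1 / 2 * ‖y - x‖ ≤ (1 - s) * ‖y - x‖ := by
      gcongr
      linarith
    nlinarith [norm_nonneg y, norm_nonneg z, mul_nonneg (norm_nonneg y) (norm_nonneg z)]
  have h2 : V z ≤ (1 - s) * V x + s * V y :=
    hV.convexOn.2 (Set.mem_univ x) (Set.mem_univ y) hs1.le hs0 (by ring)
  have hb1 := le_abs_self b
  have hb0 := abs_nonneg b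
  have hx : -|b| ≤ s * V x := by
    have h3 : -|b| ≤ V x := by linarith [hb x, mul_nonneg ha.le (norm_nonneg x)]
    nlinarith
  have hy : a / 2 * ‖y‖ - |b| ≤ (1 - s) * V y := by
    have h3 : (1 - s) * (a * ‖y‖ - |b|) ≤ (1 - s) * V y := by
      gcongr
      linarith [hb y]
    have h4 : 1 / 2 * (a * ‖y‖) ≤ (1 - s) * (a * ‖y‖) := by
      gcongr
      linarith
    nlinarith
  have h3 : Real.exp (-V x) * Real.exp (-V y) ≤
      Real.exp (2 * |b|) * Real.exp (-(a / 2 * ‖y‖)) * Real.exp (-V z) := by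
    rw [← Real.exp_add, ← Real.exp_add, ← Real.exp_add]
    exact Real.exp_le_exp.2 (by linarith)
  calc Real.exp (-V x) * Real.exp (-V y) * ‖y - x‖
      ≤ (Real.exp (2 * |b|) * Real.exp (-(a / 2 * ‖y‖)) * Real.exp (-V z)) *
        (2 * ((1 + ‖y‖) * (1 + ‖z‖))) := by gcongr
    _ = _ := by ring

/-- After Tonelli, at fixed s and y the change of variables x ↦ z turns the inner integral into a
weighted integral of the slope, and the decay in y makes the outer one finite. -/
theorem lintegral_midpoint_le {f : Eucl d → ℝ} {L : ℝ≥0} (hf : LipschitzWith L f)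
    (hV : Continuous V) {A α : ℝ} (hA : 0 < A)
    (hle : ∀ (x y : Eucl d) (s : ℝ), 0 ≤ s → s ≤ 1 / 2 →
      Real.exp (-V x) * Real.exp (-V y) * ‖y - x‖ ≤
        A * ((1 + ‖y‖) * Real.exp (-(α * ‖y‖))) *
          ((1 + ‖(1 - s) • x + s • y‖) * Real.exp (-V ((1 - s) • x + s • y)))) :
    ∫⁻ y, ∫⁻ x, ENNReal.ofReal (Real.exp (-V x) * Real.exp (-V y)) *
        ‖f ((1 / 2 : ℝ) • x + (1 / 2 : ℝ) • y) - f x‖ₑ ≤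
      (∫⁻ y : Eucl d, ENNReal.ofReal (A * ((1 + ‖y‖) * Real.exp (-(α * ‖y‖))))) *
        (ENNReal.ofReal (2 ^ d) *
          ∫⁻ z, ENNReal.ofReal ((1 + ‖z‖) * Real.exp (-V z)) * ‖gradient f z‖ₑ) := by
  set Q : Eucl d → ℝ≥0∞ := fun z =>
    ENNReal.ofReal ((1 + ‖z‖) * Real.exp (-V z)) * extendedSlope f z with hQ
  have hQm : Measurable Q :=
    (Continuous.measurable (by fun_prop)).ennreal_ofReal.mul (measurable_extendedSlope f)
  have hQe : ∫⁻ z, Q z = ∫⁻ z, ENNReal.ofReal ((1 + ‖z‖) * Real.exp (-V z)) * ‖gradient f z‖ₑ := by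
    refine lintegral_congr_ae ?_
    filter_upwards [hf.extendedSlope_ae_eq] with z hz
    simp only [hQ, hz]
  rw [← hQe, ← lintegral_mul_const _ (Continuous.measurable (by fun_prop)).ennreal_ofReal]
  refine lintegral_mono fun y => ?_
  set P := ENNReal.ofReal (A * ((1 + ‖y‖) * Real.exp (-(α * ‖y‖))))
  have haff : Measurable fun p : Eucl d × ℝ => Q ((1 - p.2) • p.1 + p.2 • y) :=
    hQm.comp (Continuous.measurable (by fun_prop))
  calc ∫⁻ x, ENNReal.ofReal (Real.exp (-V x) * Real.exp (-V y)) *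
        ‖f ((1 / 2 : ℝ) • x + (1 / 2 : ℝ) • y) - f x‖ₑ
      ≤ ∫⁻ x, ∫⁻ s in Set.Ioc (0 : ℝ) (1 / 2), P * Q ((1 - s) • x + s • y) := by
        refine lintegral_mono fun x => ?_
        refine (mul_le_mul_right (hf.enorm_sub_midpoint_le x y) _).trans ?_
        rw [← lintegral_const_mul' _ _ ENNReal.ofReal_ne_top]
        refine setLIntegral_mono' measurableSet_Ioc fun s hs => ?_
        rw [← mul_assoc, ← mul_assoc]
        refine mul_le_mul_left ?_ _
        rw [← ofReal_norm, ← ENNReal.ofReal_mul (by positivity),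
          ← ENNReal.ofReal_mul (by positivity)]
        exact ENNReal.ofReal_le_ofReal (hle x y s hs.1.le hs.2)
    _ = ∫⁻ s in Set.Ioc (0 : ℝ) (1 / 2), ∫⁻ x, P * Q ((1 - s) • x + s • y) :=
        lintegral_lintegral_swap (haff.const_mul P).aemeasurable
    _ ≤ ∫⁻ s in Set.Ioc (0 : ℝ) (1 / 2), P * (ENNReal.ofReal (2 ^ d) * ∫⁻ z, Q z) := by
        refine setLIntegral_mono' measurableSet_Ioc fun s hs => ?_
        rw [lintegral_const_mul' _ _ ENNReal.ofReal_ne_top]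
        gcongr
        exact lintegral_comp_affine_le hQm hs.2 y
    _ ≤ P * (ENNReal.ofReal (2 ^ d) * ∫⁻ z, Q z) := by
        rw [setLIntegral_const, Real.volume_Ioc]
        refine mul_le_of_le_one_right' ?_
        rw [ENNReal.ofReal_le_one]
        norm_num

theorem lintegral_weightMeasure (hV : Continuous V) {u : Eucl d → ℝ≥0∞} (hu : Measurable u) :
    ∫⁻ x, u x ∂(weightMeasure V) = ∫⁻ x, ENNReal.ofReal (Real.exp (-V x)) * u x :=
  lintegral_withDensity_eq_lintegral_mul volume (measurable_weight_density hV) hu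

/-- The triangle inequality through the midpoint gives two halves, equal by exchanging x and y. -/
theorem LipschitzWith.lintegral_lintegral_sub_le {f : Eucl d → ℝ} {L : ℝ≥0}
    (hf : LipschitzWith L f) (hV : Continuous V) :
    ∫⁻ x, ∫⁻ y, ‖f x - f y‖ₑ ∂(weightMeasure V) ∂(weightMeasure V) ≤
      2 * ∫⁻ y, ∫⁻ x, ENNReal.ofReal (Real.exp (-V x) * Real.exp (-V y)) *
        ‖f ((1 / 2 : ℝ) • x + (1 / 2 : ℝ) • y) - f x‖ₑ := by
  have hfc := hf.continuous
  have hρ := measurable_weight_density hV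
  have hm : Measurable fun p : Eucl d × Eucl d => ENNReal.ofReal (Real.exp (-V p.1) *
      Real.exp (-V p.2)) * ‖f ((1 / 2 : ℝ) • p.1 + (1 / 2 : ℝ) • p.2) - f p.1‖ₑ :=
    (Continuous.measurable (by fun_prop)).ennreal_ofReal.mul
      (Continuous.measurable (f := fun p : Eucl d × Eucl d =>
        f ((1 / 2 : ℝ) • p.1 + (1 / 2 : ℝ) • p.2) - f p.1) (by fun_prop)).enorm
  have e1 : ∫⁻ x, ∫⁻ y, ‖f x - f y‖ₑ ∂(weightMeasure V) ∂(weightMeasure V) =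
      ∫⁻ x, ∫⁻ y, ENNReal.ofReal (Real.exp (-V x) * Real.exp (-V y)) * ‖f x - f y‖ₑ := by
    have e2 : ∀ x, ∫⁻ y, ‖f x - f y‖ₑ ∂(weightMeasure V) =
        ∫⁻ y, ENNReal.ofReal (Real.exp (-V y)) * ‖f x - f y‖ₑ := fun x =>
      lintegral_weightMeasure hV (measurable_const.sub hfc.measurable).enorm
    have hm2 : Measurable fun x => ∫⁻ y, ‖f x - f y‖ₑ ∂(weightMeasure V) := by
      simp only [e2]
      refine Measurable.lintegral_prod_right' (f := fun p : Eucl d × Eucl d =>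
        ENNReal.ofReal (Real.exp (-V p.2)) * ‖f p.1 - f p.2‖ₑ) ?_
      exact (hρ.comp measurable_snd).mul (Continuous.measurable
        (f := fun p : Eucl d × Eucl d => f p.1 - f p.2) (by fun_prop)).enorm
    rw [lintegral_weightMeasure hV hm2]
    refine lintegral_congr fun x => ?_
    rw [e2, ← lintegral_const_mul' _ _ ENNReal.ofReal_ne_top]
    refine lintegral_congr fun y => ?_
    rw [ENNReal.ofReal_mul (Real.exp_pos _).le, mul_assoc]
  rw [e1]
  have e3 : ∫⁻ x, ∫⁻ y, ENNReal.ofReal (Real.exp (-V x) * Real.exp (-V y)) *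
      ‖f ((1 / 2 : ℝ) • x + (1 / 2 : ℝ) • y) - f x‖ₑ =
      ∫⁻ y, ∫⁻ x, ENNReal.ofReal (Real.exp (-V x) * Real.exp (-V y)) *
      ‖f ((1 / 2 : ℝ) • x + (1 / 2 : ℝ) • y) - f x‖ₑ :=
    lintegral_lintegral_swap hm.aemeasurable
  have e4 : ∫⁻ x, ∫⁻ y, ENNReal.ofReal (Real.exp (-V x) * Real.exp (-V y)) *
      ‖f ((1 / 2 : ℝ) • x + (1 / 2 : ℝ) • y) - f y‖ₑ =
      ∫⁻ y, ∫⁻ x, ENNReal.ofReal (Real.exp (-V x) * Real.exp (-V y)) *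
      ‖f ((1 / 2 : ℝ) • x + (1 / 2 : ℝ) • y) - f x‖ₑ := by
    refine lintegral_congr fun x => lintegral_congr fun y => ?_
    rw [mul_comm (Real.exp _), add_comm ((1 / 2 : ℝ) • x)]
  have hm1 : ∀ x, Measurable fun y => ENNReal.ofReal (Real.exp (-V x) * Real.exp (-V y)) *
      ‖f ((1 / 2 : ℝ) • x + (1 / 2 : ℝ) • y) - f x‖ₑ := fun x => hm.comp measurable_prodMk_left
  calc ∫⁻ x, ∫⁻ y, ENNReal.ofReal (Real.exp (-V x) * Real.exp (-V y)) * ‖f x - f y‖ₑ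
      ≤ ∫⁻ x, ∫⁻ y, (ENNReal.ofReal (Real.exp (-V x) * Real.exp (-V y)) *
          ‖f ((1 / 2 : ℝ) • x + (1 / 2 : ℝ) • y) - f x‖ₑ +
          ENNReal.ofReal (Real.exp (-V x) * Real.exp (-V y)) *
          ‖f ((1 / 2 : ℝ) • x + (1 / 2 : ℝ) • y) - f y‖ₑ) := by
        refine lintegral_mono fun x => lintegral_mono fun y => ?_
        simp only
        rw [← mul_add]
        gcongr
        have h1 := enorm_sub_le (a := f ((1 / 2 : ℝ) • x + (1 / 2 : ℝ) • y) - f y)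
          (b := f ((1 / 2 : ℝ) • x + (1 / 2 : ℝ) • y) - f x)
        rw [sub_sub_sub_cancel_left, add_comm] at h1
        exact h1
    _ = _ := by
        rw [lintegral_congr fun x => lintegral_add_left (hm1 x) _,
          lintegral_add_left (Measurable.lintegral_prod_right' hm), e3, e4, two_mul]

/-- An `L¹` Poincaré inequality for a log-concave weight. -/
theorem IsWeight.exists_poincare (hV : IsWeight V lam) (hlam : 0 < lam) :
    ∃ c : ℝ, 0 ≤ c ∧ ∀ (f : Eucl d → ℝ) (L : ℝ≥0), LipschitzWith L f →
      ∫⁻ x, ∫⁻ y, ‖f x - f y‖ₑ ∂(weightMeasure V) ∂(weightMeasure V) ≤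
        ENNReal.ofReal (c * ∫ z, ‖gradient f z‖ * Real.exp (-(1 / 2 * V z))) := by
  obtain ⟨A, hA, α, hα, hle⟩ := hV.exists_weight_mul_le hlam
  obtain ⟨a, ha, b, hb⟩ := hV.exists_linear_lower hlam
  have hPi : Integrable fun y : Eucl d => A * ((1 + ‖y‖) * Real.exp (-(α * ‖y‖))) := by
    have := integrable_one_add_norm_pow_mul_exp_neg (d := d) 1 hα
    simp only [pow_one] at this
    exact this.const_mul A
  set P := ∫ y : Eucl d, A * ((1 + ‖y‖) * Real.exp (-(α * ‖y‖))) with hP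
  have hP0 : 0 ≤ P := integral_nonneg fun y => by positivity
  -- The linear factor is traded for half of the weight: 1 + ‖z‖ is at most (1 + 2/a) e^{a‖z‖/2},
  -- and a‖z‖ ≤ V(z) + b.
  set B := (1 + 2 / a) * Real.exp (b / 2) with hB
  have hq : ∀ z, (1 + ‖z‖) * Real.exp (-V z) ≤ B * Real.exp (-(1 / 2 * V z)) := by
    intro z
    have h1 : 1 + ‖z‖ ≤ (1 + 2 / a) * Real.exp (a * ‖z‖ / 2) := by
      have h2 := Real.add_one_le_exp (a * ‖z‖ / 2)
      have h3 : 2 / a * (a * ‖z‖ / 2) = ‖z‖ := by field_simp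
      have h4 : 0 ≤ a * ‖z‖ / 2 := by positivity
      have h5 : 0 < 2 / a := by positivity
      nlinarith
    calc (1 + ‖z‖) * Real.exp (-V z) ≤ (1 + 2 / a) * Real.exp (a * ‖z‖ / 2) * Real.exp (-V z) := by
          gcongr
      _ = (1 + 2 / a) * Real.exp (a * ‖z‖ / 2 - V z) := by rw [mul_assoc, ← Real.exp_add]; rfl
      _ ≤ (1 + 2 / a) * Real.exp (b / 2 + -(1 / 2 * V z)) := by
          gcongr
          linarith [hb z]
      _ = _ := by rw [Real.exp_add, hB, mul_assoc]
  refine ⟨2 * (P * (2 ^ d * B)), by positivity, fun f L hf => ?_⟩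
  have i1 : Integrable fun z => ‖gradient f z‖ * Real.exp (-(1 / 2 * V z)) :=
    hV.integrable_mul_exp hlam (by norm_num) (measurable_gradient _).norm.aestronglyMeasurable
      (B := L) 0 fun x => by simpa using hf.norm_gradient_le x
  have h1 : ∫⁻ z, ENNReal.ofReal ((1 + ‖z‖) * Real.exp (-V z)) * ‖gradient f z‖ₑ ≤
      ENNReal.ofReal (B * ∫ z, ‖gradient f z‖ * Real.exp (-(1 / 2 * V z))) := by
    rw [← integral_const_mul, ofReal_integral_eq_lintegral_ofReal (i1.const_mul B)
      (Eventually.of_forall fun z => by positivity)]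
    refine lintegral_mono fun z => ?_
    rw [← ofReal_norm, ← ENNReal.ofReal_mul (by positivity)]
    refine ENNReal.ofReal_le_ofReal ?_
    calc _ ≤ B * Real.exp (-(1 / 2 * V z)) * ‖gradient f z‖ := by
          have := hq z
          gcongr
      _ = _ := by ring
  have h2 : ∫⁻ y : Eucl d, ENNReal.ofReal (A * ((1 + ‖y‖) * Real.exp (-(α * ‖y‖)))) =
      ENNReal.ofReal P :=
    (ofReal_integral_eq_lintegral_ofReal hPi (Eventually.of_forall fun y => by positivity)).symm
  refine (hf.lintegral_lintegral_sub_le hV.continuous).trans ?_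
  have h3 := lintegral_midpoint_le hf hV.continuous hA hle
  rw [h2] at h3
  calc _ ≤ 2 * (ENNReal.ofReal P * (ENNReal.ofReal (2 ^ d) * ENNReal.ofReal (B *
        ∫ z, ‖gradient f z‖ * Real.exp (-(1 / 2 * V z))))) := by
        gcongr
        refine h3.trans ?_
        gcongr
    _ = _ := by
        have e2 : ∀ X : ℝ, 2 * ENNReal.ofReal X = ENNReal.ofReal (2 * X) := fun X => by
          rw [ENNReal.ofReal_mul two_pos.le]
          simp
        rw [← ENNReal.ofReal_mul (by positivity), ← ENNReal.ofReal_mul hP0, e2]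
        congr 1
        ring

end Poincare

theorem EReal.coe_min (x y : ℝ) : ((min x y : ℝ) : EReal) = min (x : EReal) y :=
  EReal.coe_strictMono.monotone.map_min

/-! ### Truncations of extended real valued supersolutions -/

section Truncation

variable {d : ℕ} {ψ : Eucl d → EReal} {x : Eucl d} {b M : ℝ}

theorem coe_truncation (h : ψ x ≠ ⊥) (M : ℝ) : ((truncation ψ M x : ℝ) : EReal) = min (ψ x) M := by
  refine EReal.coe_toReal ?_ ?_
  · exact ((min_le_right _ _).trans_lt (EReal.coe_lt_top M)).ne
  · exact (lt_min (bot_lt_iff_ne_bot.2 h) (EReal.bot_lt_coe M)).ne'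

theorem truncation_le (h : ψ x ≠ ⊥) (M : ℝ) : truncation ψ M x ≤ M := by
  rw [← EReal.coe_le_coe_iff, coe_truncation h]
  exact min_le_right _ _

theorem truncation_eq_min_toReal (h : ψ x ≠ ⊥) (h' : ψ x ≠ ⊤) (M : ℝ) :
    truncation ψ M x = min (ψ x).toReal M := by
  rw [← EReal.coe_eq_coe_iff, coe_truncation h, EReal.coe_min, EReal.coe_toReal h' h]

theorem min_truncation (h : ψ x ≠ ⊥) {k l : ℝ} (hkl : k ≤ l) :
    min (truncation ψ l x) k = truncation ψ k x := by
  rw [← EReal.coe_eq_coe_iff, EReal.coe_min, coe_truncation h, coe_truncation h, min_assoc,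
    min_eq_right (EReal.coe_le_coe_iff.2 hkl)]

theorem ne_bot_of_coe_le (hb : (b : EReal) ≤ ψ x) : ψ x ≠ ⊥ :=
  ((EReal.bot_lt_coe b).trans_le hb).ne'

theorem isBoundedLSC_truncation (hψ : LowerSemicontinuous ψ) (hb : ∀ x, (b : EReal) ≤ ψ x)
    (M : ℝ) : IsBoundedLSC (truncation ψ M) (min b M) M where
  lsc x y hy := by
    have h0 := fun x => ne_bot_of_coe_le (hb x)
    change y < truncation ψ M x at hy
    rw [← EReal.coe_lt_coe_iff, coe_truncation (h0 x), lt_min_iff] at hy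
    filter_upwards [hψ x y hy.1] with z hz
    change y < truncation ψ M z
    rw [← EReal.coe_lt_coe_iff, coe_truncation (h0 z), lt_min_iff]
    exact ⟨hz, hy.2⟩
  ge x := by
    rw [← EReal.coe_le_coe_iff, coe_truncation (ne_bot_of_coe_le (hb x)), EReal.coe_min]
    exact min_le_min_right _ (hb x)
  le x := truncation_le (ne_bot_of_coe_le (hb x)) M

/-- Where ψ ≥ M, a function touching the truncation from below has a maximum. Its gradient vanishes,
its Laplacian is at most zero, and K(x, 0) ≤ 0. Elsewhere it touches ψ itself. -/
theorem IsViscositySupersolution.truncation {K : Eucl d → Eucl d → ℝ} {R lam Lam C : ℝ}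
    (hK : IsLinearHamiltonian K R lam Lam C) (hψ : IsViscositySupersolution K ψ)
    (h0 : ∀ x, ψ x ≠ ⊥) (M : ℝ) : IsRealViscositySupersolution K (truncation ψ M) := by
  intro x φ hφ hx hle
  have hleψ : ∀ y, (φ y : EReal) ≤ ψ y := fun y =>
    (EReal.coe_le_coe_iff.2 (hle y)).trans (by rw [coe_truncation (h0 y)]; exact min_le_left _ _)
  rcases le_total (ψ x) M with h | h
  · refine hψ x φ hφ ?_ (Eventually.of_forall hleψ)
    rw [hx, coe_truncation (h0 x), min_eq_left h]
  · have hM : φ x = M := by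
      rw [hx, ← EReal.coe_eq_coe_iff, coe_truncation (h0 x), min_eq_right h]
    have hmax : ∀ y, φ y ≤ φ x := fun y => by
      rw [hM]
      exact (hle y).trans (truncation_le (h0 y) M)
    have h1 : IsLocalMax φ x := Eventually.of_forall hmax
    have h2 : gradient φ x = 0 := by rw [gradient, h1.fderiv_eq_zero, map_zero]
    have h3 : IsLocalMin (-φ) x := Eventually.of_forall fun y => neg_le_neg (hmax y)
    have h4 := IsLocalMin.laplacian_nonneg hφ.neg h3
    change 0 ≤ Laplacian.laplacian (-φ) x at h4
    rw [InnerProductSpace.laplacian_neg] at h4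
    have h5 := hK.upper x 0
    rw [norm_zero, mul_zero] at h5
    rw [h2]
    simp only [Pi.neg_apply] at h4
    linarith

end Truncation

/-! ### The L¹ bound from the zero mean -/

section Mean

variable {d : ℕ} {V : Eucl d → ℝ} {K : Eucl d → Eucl d → ℝ} {R lam Lam C : ℝ}

theorem lintegral_lintegral_enorm_sub_le_of_tendsto {α : Type*} [MeasurableSpace α] {μ : Measure α}
    [SFinite μ] {u : ℕ → α → ℝ} {w : α → ℝ} (hu : ∀ n, Measurable (u n))
    (hlim : ∀ᵐ x ∂μ, Tendsto (fun n => u n x) atTop (𝓝 (w x))) {c : ℝ≥0∞}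
    (hc : ∀ n, ∫⁻ x, ∫⁻ y, ‖u n x - u n y‖ₑ ∂μ ∂μ ≤ c) :
    ∫⁻ x, ∫⁻ y, ‖w x - w y‖ₑ ∂μ ∂μ ≤ c := by
  have hm : ∀ n, Measurable fun p : α × α => ‖u n p.1 - u n p.2‖ₑ := fun n =>
    (((hu n).comp measurable_fst).sub ((hu n).comp measurable_snd)).enorm
  calc ∫⁻ x, ∫⁻ y, ‖w x - w y‖ₑ ∂μ ∂μ
      ≤ ∫⁻ x, liminf (fun n => ∫⁻ y, ‖u n x - u n y‖ₑ ∂μ) atTop ∂μ := by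
        refine lintegral_mono_ae ?_
        filter_upwards [hlim] with x hx
        calc ∫⁻ y, ‖w x - w y‖ₑ ∂μ = ∫⁻ y, liminf (fun n => ‖u n x - u n y‖ₑ) atTop ∂μ := by
              refine lintegral_congr_ae ?_
              filter_upwards [hlim] with y hy
              exact (hx.sub hy).enorm.liminf_eq.symm
          _ ≤ _ := lintegral_liminf_le fun n => (hm n).comp measurable_prodMk_left
    _ ≤ liminf (fun n => ∫⁻ x, ∫⁻ y, ‖u n x - u n y‖ₑ ∂μ ∂μ) atTop :=
        lintegral_liminf_le fun n => (hm n).lintegral_prod_right'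
    _ ≤ c := (liminf_le_liminf (Eventually.of_forall hc)).trans_eq (by simp)

/-- With zero mean under a probability measure, w(x) is the average over y of w(x) - w(y). -/
theorem lintegral_enorm_le_of_integral_eq_zero {α : Type*} [MeasurableSpace α] {μ : Measure α}
    [IsProbabilityMeasure μ] {w : α → ℝ} (hw : Integrable w μ) (h0 : ∫ x, w x ∂μ = 0) :
    ∫⁻ x, ‖w x‖ₑ ∂μ ≤ ∫⁻ x, ∫⁻ y, ‖w x - w y‖ₑ ∂μ ∂μ := by
  refine lintegral_mono fun x => ?_
  have h1 : w x = ∫ y, (w x - w y) ∂μ := by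
    rw [integral_sub (integrable_const _) hw, h0]
    simp
  calc ‖w x‖ₑ = ‖∫ y, (w x - w y) ∂μ‖ₑ := by rw [← h1]
    _ ≤ _ := enorm_integral_le_lintegral_enorm _

theorem tendsto_truncation_natCast {ψ : Eucl d → EReal} {x : Eucl d} (h : ψ x ≠ ⊥)
    (h' : ψ x ≠ ⊤) : Tendsto (fun k : ℕ => truncation ψ k x) atTop (𝓝 (ψ x).toReal) := by
  refine tendsto_const_nhds.congr' ?_
  filter_upwards [eventually_ge_atTop ⌈(ψ x).toReal⌉₊] with k hk
  rw [truncation_eq_min_toReal h h', min_eq_left (Nat.ceil_le.1 hk)]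

/-- The Poincaré inequality and the uniform L¹ gradient bound apply to the Lipschitz approximations.
Fatou's lemma passes first to each truncation and then to ψ, and only there does the zero mean
enter. -/
theorem IsViscositySupersolution.lintegral_enorm_le {ψ : Eucl d → EReal} {b : ℝ}
    (hψ : IsViscositySupersolution K ψ) (hK : IsLinearHamiltonian K R lam Lam C)
    (hV : IsWeight V lam) (hl : LowerSemicontinuous ψ) (hb : ∀ x, (b : EReal) ≤ ψ x)
    (hm : HasZeroMean V ψ) {c : ℝ} (hc : 0 ≤ c)
    (hp : ∀ (f : Eucl d → ℝ) (L : ℝ≥0), LipschitzWith L f →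
      ∫⁻ x, ∫⁻ y, ‖f x - f y‖ₑ ∂(weightMeasure V) ∂(weightMeasure V) ≤
        ENNReal.ofReal (c * ∫ z, ‖gradient f z‖ * Real.exp (-(1 / 2 * V z)))) :
    ∫⁻ x, ‖(ψ x).toReal‖ₑ ∂(weightMeasure V) ≤ ENNReal.ofReal (c * gradientBound V lam C) := by
  have h0 := fun x => ne_bot_of_coe_le (hb x)
  have := hV.isProbabilityMeasure
  refine (lintegral_enorm_le_of_integral_eq_zero hm.integrable hm.integral_eq).trans ?_
  have hkey : ∀ k : ℕ, Measurable (_root_.truncation ψ k) ∧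
      ∫⁻ x, ∫⁻ y, ‖_root_.truncation ψ k x - _root_.truncation ψ k y‖ₑ ∂(weightMeasure V)
        ∂(weightMeasure V) ≤ ENNReal.ofReal (c * gradientBound V lam C) := fun k => by
    obtain ⟨f, hf⟩ := (isBoundedLSC_truncation hl hb k).exists_isApproximation hK
      (hψ.truncation hK h0 k)
    refine ⟨hf.measurable, ?_⟩
    refine lintegral_lintegral_enorm_sub_le_of_tendsto
      (fun n => (hf.lipschitz n).choose_spec.continuous.measurable)
      (Eventually.of_forall hf.tendsto) fun n => ?_
    obtain ⟨L, hL⟩ := hf.lipschitz n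
    refine (hp _ L hL).trans (ENNReal.ofReal_le_ofReal ?_)
    have := hf.integral_norm_gradient_le hK hV n
    gcongr
  refine lintegral_lintegral_enorm_sub_le_of_tendsto (fun k => (hkey k).1) ?_ fun k => (hkey k).2
  filter_upwards [weightMeasure_absolutelyContinuous.ae_le hm.finite_ae] with x hx
  exact tendsto_truncation_natCast hx.2 hx.1

end Mean

/-! ### Pointwise lower bounds -/

section LowerBound

variable {d : ℕ} {V : Eucl d → ℝ} {K : Eucl d → Eucl d → ℝ} {R lam Lam C a b : ℝ}
  {w : Eucl d → ℝ} {f : ℕ → Eucl d → ℝ}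

theorem IsApproximation.tendsto_radialAverage (h : IsApproximation K C a w f)
    (hb : ∀ x, w x ≤ b) (x : Eucl d) :
    Tendsto (fun n => radialAverage (f n) 1 x) atTop (𝓝 (radialAverage w 1 x)) := by
  have hk : Continuous fun y : Eucl d => radialKernel 1 (x - y) :=
    (contDiff_radialKernel 1).continuous.comp (continuous_const.sub continuous_id)
  have hki : Integrable fun y : Eucl d => radialKernel 1 (x - y) :=
    ((contDiff_radialKernel 1).continuous.integrable_of_hasCompactSupport
      (hasCompactSupport_radialKernel one_pos)).comp_sub_left x
  refine tendsto_integral_of_dominated_convergence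
    (fun y => max |a| |b| * radialKernel 1 (x - y)) (fun n => ?_) (hki.const_mul _)
    (fun n => Eventually.of_forall fun y => ?_)
    (Eventually.of_forall fun y => (h.tendsto y).mul_const _)
  · exact ((h.lipschitz n).choose_spec.continuous.mul hk).aestronglyMeasurable
  · rw [norm_mul, Real.norm_of_nonneg (radialKernel_nonneg zero_le_one _), Real.norm_eq_abs]
    have := radialKernel_nonneg zero_le_one (x - y)
    gcongr
    exact abs_le_max_abs_abs (h.ge n y) ((h.le n y).trans (hb y))

theorem IsApproximation.radialAverage_le (h : IsApproximation K C a w f) (hC : 0 ≤ C)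
    (hb : ∀ x, w x ≤ b) (x : Eucl d) :
    radialAverage w 1 x - (C + 1) * (‖x‖ + 2) * potentialMass d / 2 ≤ radialMass d * w x :=
  le_of_tendsto_of_tendsto' ((h.tendsto_radialAverage hb x).sub_const _)
    ((h.tendsto x).const_mul _) fun n =>
      (h.laplacian n).radialAverage_le (h.lipschitz n).choose_spec.continuous (by linarith) x

/-- The kernel at scale 1 is at most 1 and lives in the unit ball about x, where the weight is at
least e^{-S}. -/
theorem neg_le_radialAverage (hV : Continuous V) (hw : Integrable w (weightMeasure V))
    {m S r : ℝ} (hm : ∫ x, |w x| ∂(weightMeasure V) ≤ m)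
    (hS : ∀ y, ‖y‖ ≤ r + 1 → V y ≤ S) {x : Eucl d} (hx : ‖x‖ ≤ r) :
    -(Real.exp S * m) ≤ radialAverage w 1 x := by
  have hi : Integrable fun y => Real.exp (-V y) • |w y| := (integrable_weightMeasure_iff hV _).1 hw.abs
  rw [integral_weightMeasure hV] at hm
  have hpt : ∀ y, |w y * radialKernel 1 (x - y)| ≤ Real.exp S * (Real.exp (-V y) • |w y|) := by
    intro y
    rw [abs_mul, abs_of_nonneg (radialKernel_nonneg zero_le_one _), smul_eq_mul, ← mul_assoc,
      ← Real.exp_add, mul_comm]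
    gcongr
    rcases le_total 1 ‖x - y‖ with h1 | h1
    · rw [radialKernel_eq_zero (by rwa [one_mul])]
      positivity
    · have h2 : ‖y‖ ≤ r + 1 := by
        have := norm_sub_norm_le y x
        rw [norm_sub_rev] at this
        linarith
      have h3 : radialKernel 1 (x - y) ≤ 1 := by
        rw [radialKernel, one_pow, one_mul]
        exact bumpProfile_le_one _
      exact h3.trans (Real.one_le_exp (by linarith [hS y h2]))
  have h1 : |radialAverage w 1 x| ≤ Real.exp S * m := by
    calc |radialAverage w 1 x| ≤ ∫ y, Real.exp S * (Real.exp (-V y) • |w y|) :=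
          norm_integral_le_of_norm_le (f := fun y => w y * radialKernel 1 (x - y))
            (hi.const_mul _) (Eventually.of_forall hpt)
      _ ≤ Real.exp S * m := by
          rw [integral_const_mul]
          gcongr
  exact (abs_le.1 h1).1

/-- A paraboloid barrier extends a lower bound from a ball to the whole space. -/
theorem IsRealViscositySupersolution.quadratic_lower_bound (hv : IsRealViscositySupersolution K w)
    (hw : IsBoundedLSC w a b) (hK : IsLinearHamiltonian K R lam Lam C) {m : ℝ}
    (hm : ∀ x, ‖x‖ ≤ 1 + d / lam → -m ≤ w x) (x : Eucl d) : -m - C / lam * ‖x‖ ^ 2 ≤ w x := by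
  have hC := hK.C_pos
  have hl := hK.lam_pos
  -- At a minimum y of w + A|·|² the paraboloid touches from below, and the inequality reads -dA +
  -- K(y, -2Ay) ≤ 0. For this A the coercive term is 2C‖y‖, which beats the C‖y‖ lost and confines y
  -- to ‖y‖ ≤ 1 + d/λ, where the bound is assumed.
  set A := C / lam with hA
  have hA0 : 0 < A := by positivity
  -- This parameter makes the inf-convolution penalty at the origin equal to A‖y‖², so a minimizer
  -- is available.
  have hε : 0 < 1 / (2 * A) := by positivity
  have hq : ∀ y : Eucl d, ‖(0 : Eucl d) - y‖ ^ 2 / (2 * (1 / (2 * A))) = A * ‖y‖ ^ 2 := fun y => by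
    rw [zero_sub, norm_neg]
    field_simp
  obtain ⟨y, hy⟩ := hw.exists_infConvolution_eq hε 0
  have hle : ∀ z, w y + A * ‖y‖ ^ 2 ≤ w z + A * ‖z‖ ^ 2 := fun z => by
    have := hw.infConvolution_le hε 0 z
    rwa [hy, hq, hq] at this
  have hyr : ‖y‖ ≤ 1 + d / lam := by
    set φ : Eucl d → ℝ := fun z => (w y + A * ‖y‖ ^ 2) - A * ‖z‖ ^ 2 with hφ
    have hn : ContDiff ℝ 2 fun z : Eucl d => ‖z‖ ^ 2 := contDiff_norm_sq ℝ
    have h1 := hv y φ (contDiff_const.sub (contDiff_const.mul hn)) (by simp [hφ])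
      (fun z => by simp only [hφ]; linarith [hle z])
    have h2 : Laplacian.laplacian φ y = -(2 * d * A) := by
      have e : φ = (fun _ => w y + A * ‖y‖ ^ 2) + (-A) • fun z : Eucl d => ‖z‖ ^ 2 := by
        funext z
        simp only [hφ, Pi.add_apply, Pi.smul_apply, smul_eq_mul]
        ring
      have hn' : ContDiff ℝ 2 ((-A) • fun z : Eucl d => ‖z‖ ^ 2) := contDiff_const.smul hn
      rw [e, ContDiffAt.laplacian_add contDiff_const.contDiffAt hn'.contDiffAt,
        InnerProductSpace.laplacian_smul _ hn.contDiffAt, laplacian_norm_sq,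
        InnerProductSpace.laplacian_const]
      simp only [Pi.zero_apply, smul_eq_mul]
      ring
    have h3 : gradient φ y = -(2 * A) • y := by
      have h4 : HasFDerivAt φ (-(A • (2 • innerSL ℝ y))) y :=
        ((hasStrictFDerivAt_norm_sq y).hasFDerivAt.const_mul A).const_sub _
      refine ext_inner_left ℝ fun v => ?_
      rw [inner_gradient_eq_fderiv, h4.fderiv, inner_smul_right, real_inner_comm]
      simp only [neg_apply, smul_apply, innerSL_apply_apply, smul_eq_mul, nsmul_eq_mul,
        Nat.cast_ofNat]
      ring
    have h4 := hK.lower y (gradient φ y)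
    rw [h3, norm_smul, norm_neg, Real.norm_of_nonneg (by positivity)] at h4
    have h5 : lam * (2 * A * ‖y‖) = 2 * C * ‖y‖ := by
      rw [hA]
      field_simp
    have h6 : d * A + C = C * (1 + d / lam) := by
      rw [hA]
      field_simp
      ring
    rw [h2, h3] at h1
    refine le_of_mul_le_mul_left (a := C) ?_ hC
    linarith
  have h1 := hle x
  have h2 := hm y hyr
  have h3 : 0 ≤ A * ‖y‖ ^ 2 := by positivity
  linarith

end LowerBound

/-! ### The weak gradient of ψ and the estimates for its truncations -/

section Gradient

variable {d : ℕ} {V : Eucl d → ℝ} {K : Eucl d → Eucl d → ℝ} {R lam Lam C : ℝ}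

theorem tendsto_eLpNorm_one_sub_of_dominated {α F : Type*} [MeasurableSpace α] {μ : Measure α}
    [NormedAddCommGroup F] {u : ℕ → α → F} {w : α → F} (hu : ∀ n, AEStronglyMeasurable (u n) μ)
    (hw : MemLp w 1 μ) (hle : ∀ᵐ x ∂μ, ∀ n, ‖u n x‖ ≤ ‖w x‖)
    (hlim : ∀ᵐ x ∂μ, Tendsto (fun n => u n x) atTop (𝓝 (w x))) :
    Tendsto (fun n => eLpNorm (u n - w) 1 μ) atTop (𝓝 0) := by
  have h := tendsto_lintegral_norm_of_dominated_convergence (bound := fun x => ‖w x‖) hu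
    (memLp_one_iff_integrable.1 hw).norm.2 (fun n => hle.mono fun x hx => hx n) hlim
  refine h.congr fun n => ?_
  rw [eLpNorm_one_eq_lintegral_enorm]
  exact lintegral_congr fun x => ofReal_norm _

theorem HasWeakGradient.of_dominated (hV : Continuous V) {u : ℕ → Eucl d → ℝ}
    {G : ℕ → Eucl d → Eucl d} {w : Eucl d → ℝ} {g : Eucl d → Eucl d}
    (h : ∀ n, HasWeakGradient (u n) (G n)) (hw : MemLp w 1 (weightMeasure V))
    (hg : MemLp g 1 (weightMeasure V)) (hule : ∀ᵐ x, ∀ n, ‖u n x‖ ≤ ‖w x‖)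
    (hulim : ∀ᵐ x, Tendsto (fun n => u n x) atTop (𝓝 (w x)))
    (hgle : ∀ᵐ x, ∀ n, ‖G n x‖ ≤ ‖g x‖)
    (hglim : ∀ᵐ x, Tendsto (fun n => G n x) atTop (𝓝 (g x))) : HasWeakGradient w g := by
  have hac := weightMeasure_absolutelyContinuous (V := V) |>.ae_le
  have hlw := MemLp.locallyIntegrable_of_weightMeasure le_rfl hw hV
  have hlg := MemLp.locallyIntegrable_of_weightMeasure le_rfl hg hV
  refine HasWeakGradient.of_tendsto h hlw hlg ?_ ?_
  · refine tendsto_setIntegral_norm_of_eLpNorm hV (u := fun n => u n - w) (fun n => ?_) ?_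
    · exact (h n).locallyIntegrable.aestronglyMeasurable.sub hlw.aestronglyMeasurable
    · exact tendsto_eLpNorm_one_sub_of_dominated (fun n => aestronglyMeasurable_weightMeasure
        (h n).locallyIntegrable.aestronglyMeasurable) hw (hac hule) (hac hulim)
  · refine tendsto_setIntegral_norm_of_eLpNorm hV (u := fun n => G n - g) (fun n => ?_) ?_
    · exact (h n).locallyIntegrable_grad.aestronglyMeasurable.sub hlg.aestronglyMeasurable
    · exact tendsto_eLpNorm_one_sub_of_dominated (fun n => aestronglyMeasurable_weightMeasure
        (h n).locallyIntegrable_grad.aestronglyMeasurable) hg (hac hgle) (hac hglim)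

theorem abs_min_natCast_le (t : ℝ) (k : ℕ) : |min t k| ≤ |t| := by
  have hk : (0 : ℝ) ≤ k := k.cast_nonneg
  rcases le_total t k with h | h
  · rw [min_eq_left h]
  · rw [min_eq_right h, abs_of_nonneg hk, abs_of_nonneg (hk.trans h)]
    exact h

variable {ψ : Eucl d → EReal} {b : ℝ}

/-- The gradient of a lower truncation is that of a higher one restricted to a sublevel set, so the
gradients are consistent and can be glued. Their L¹ bound is uniform in the height and passes to the
glued field by Fatou's lemma. -/
theorem IsViscositySupersolution.exists_hasWeakGradient (hψ : IsViscositySupersolution K ψ)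
    (hK : IsLinearHamiltonian K R lam Lam C) (hV : IsWeight V lam)
    (hl : LowerSemicontinuous ψ) (hb : ∀ x, (b : EReal) ≤ ψ x) (hfin : ∀ᵐ x, ψ x ≠ ⊤)
    (hi : Integrable (fun x => (ψ x).toReal) (weightMeasure V)) {b₀ : ℝ}
    (hb₀ : ∀ x, -b₀ ≤ V x) :
    ∃ g, HasWeakGradient (fun x => (ψ x).toReal) g ∧
      eLpNorm g 1 (weightMeasure V) ≤
        ENNReal.ofReal (Real.exp (b₀ / 2) * gradientBound V lam C) := by
  have h0 := fun x => ne_bot_of_coe_le (hb x)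
  have hex : ∀ k : ℕ, ∃ f g, IsApproximation K C (min b k) (_root_.truncation ψ k) f ∧
      MemLp g 2 (weightMeasure V) ∧
      Tendsto (fun n => eLpNorm (gradient (f n) - g) 2 (weightMeasure V)) atTop (𝓝 0) := by
    intro k
    obtain ⟨f, hf⟩ := (isBoundedLSC_truncation hl hb k).exists_isApproximation hK
      (hψ.truncation hK h0 k)
    obtain ⟨g, hg, hlim⟩ := hf.exists_tendsto_gradient hK hV fun x => truncation_le (h0 x) k
    exact ⟨f, g, hf, hg, hlim⟩
  choose f g hf hg hlim using hex
  have hw : ∀ k : ℕ, HasWeakGradient (_root_.truncation ψ k) (g k) := fun k =>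
    (hf k).hasWeakGradient hV (fun x => truncation_le (h0 x) k) (hg k) (hlim k)
  have hind : ∀ᵐ x, ∀ k l : ℕ, k ≤ l →
      g k x = {x | _root_.truncation ψ l x ≤ k}.indicator (g l) x := by
    refine ae_all_iff.2 fun k => ae_all_iff.2 fun l => ?_
    by_cases hkl : k ≤ l
    · have h1 := (hf l).hasWeakGradient_min hV (fun x => truncation_le (h0 x) l) (hg l) (hlim l) k
      have e : (fun x => min (_root_.truncation ψ l x) (k : ℝ)) = _root_.truncation ψ k :=
        funext fun x => min_truncation (h0 x) (Nat.cast_le.2 hkl)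
      rw [e] at h1
      filter_upwards [(hw k).ae_eq h1] with x hx _
      exact hx
    · exact Eventually.of_forall fun x h => absurd h hkl
  -- Once the height exceeds ψ(x) the value of the gradient at x no longer changes, for almost every
  -- x; the ceiling is a height from which on this holds.
  set G : Eucl d → Eucl d := fun x => g ⌈(ψ x).toReal⌉₊ x with hG
  have hGl : ∀ᵐ x, ∀ l, ⌈(ψ x).toReal⌉₊ ≤ l → g l x = G x := by
    filter_upwards [hind, hfin] with x hx hx' l hle
    rw [hG]
    simp only
    rw [hx _ _ hle, Set.indicator_of_mem]
    change _root_.truncation ψ l x ≤ _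
    rw [truncation_eq_min_toReal (h0 x) hx']
    exact (min_le_left _ _).trans (Nat.le_ceil _)
  have hGlim : ∀ᵐ x, Tendsto (fun l => g l x) atTop (𝓝 (G x)) := by
    filter_upwards [hGl] with x hx
    refine tendsto_const_nhds.congr' ?_
    filter_upwards [eventually_ge_atTop ⌈(ψ x).toReal⌉₊] with l h
    exact (hx l h).symm
  have hGle : ∀ᵐ x, ∀ k, ‖g k x‖ ≤ ‖G x‖ := by
    filter_upwards [hind, hGl] with x hx hx' k
    rw [hx k _ (le_max_left k ⌈(ψ x).toReal⌉₊), ← hx' _ (le_max_right k ⌈(ψ x).toReal⌉₊)]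
    exact norm_indicator_le_norm_self _ _
  have hac := weightMeasure_absolutelyContinuous (V := V) |>.ae_le
  have hGn : eLpNorm G 1 (weightMeasure V) ≤
      ENNReal.ofReal (Real.exp (b₀ / 2) * gradientBound V lam C) := by
    refine (Lp.eLpNorm_lim_le_liminf_eLpNorm (fun k => (hg k).1) G (hac hGlim)).trans ?_
    refine (liminf_le_liminf (Eventually.of_forall fun k =>
      (hf k).eLpNorm_one_le hK hV hb₀ (hg k) (hlim k))).trans_eq (by simp)
  have hG1 : MemLp G 1 (weightMeasure V) :=
    ⟨aestronglyMeasurable_of_tendsto_ae _ (fun k => (hg k).1) (hac hGlim),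
      hGn.trans_lt ENNReal.ofReal_lt_top⟩
  refine ⟨G, HasWeakGradient.of_dominated hV.continuous hw (memLp_one_iff_integrable.2 hi) hG1 ?_
    ?_ hGle hGlim, hGn⟩
  · filter_upwards [hfin] with x hx k
    rw [truncation_eq_min_toReal (h0 x) hx]
    exact abs_min_natCast_le _ _
  · filter_upwards [hfin] with x hx
    exact tendsto_truncation_natCast (h0 x) hx

theorem memLp_two_add_quadratic (hV : IsWeight V lam) (hlam : 0 < lam) {B c : ℝ} (hB : 0 ≤ B)
    (hc : 0 ≤ c) : MemLp (fun x : Eucl d => B + c * (1 + ‖x‖ ^ 2)) 2 (weightMeasure V) := by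
  have hct : Continuous fun x : Eucl d => B + c * (1 + ‖x‖ ^ 2) := by fun_prop
  refine (memLp_two_iff_integrable_sq
    (aestronglyMeasurable_weightMeasure hct.aestronglyMeasurable)).2 ?_
  refine hV.integrable_of_abs_le hlam (hct.pow 2).aestronglyMeasurable (B := (B + c) ^ 2) 4
    fun x => ?_
  have hx := norm_nonneg x
  have h1 : B + c * (1 + ‖x‖ ^ 2) ≤ (B + c) * (1 + ‖x‖) ^ 2 := by
    nlinarith [mul_nonneg hB hx, mul_nonneg hc hx, mul_nonneg hB (sq_nonneg ‖x‖)]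
  rw [abs_of_nonneg (by positivity)]
  calc (B + c * (1 + ‖x‖ ^ 2)) ^ 2 ≤ ((B + c) * (1 + ‖x‖) ^ 2) ^ 2 := by gcongr
    _ = _ := by ring

/-- The `H¹` bound for truncations at height `M` of supersolutions above `-c (1 + |x|²)`. -/
noncomputable def truncationBound (V : Eucl d → ℝ) (C c M : ℝ) : ℝ :=
  (eLpNorm (fun x : Eucl d => M + c * (1 + ‖x‖ ^ 2)) 2 (weightMeasure V)).toReal +
    √(2 * ∫ x, (C * (‖x‖ + 1) + 1) * (M + c * (1 + ‖x‖ ^ 2)) ∂(weightMeasure V))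

/-- The constant b depends on ψ and serves only to construct the approximations. The norm bounds use
the quadratic lower bound instead, so they depend on ψ only through c. -/
theorem IsViscositySupersolution.truncation_estimates (hψ : IsViscositySupersolution K ψ)
    (hK : IsLinearHamiltonian K R lam Lam C) (hV : IsWeight V lam)
    (hl : LowerSemicontinuous ψ) (hb : ∀ x, (b : EReal) ≤ ψ x) {c M : ℝ} (hc : 0 ≤ c)
    (hM : 0 ≤ M) (hlow : ∀ x, ((-(c * (1 + ‖x‖ ^ 2)) : ℝ) : EReal) ≤ ψ x) :
    MemSobolevV V 2 (_root_.truncation ψ M) ∧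
      sobolevNormV V 2 (_root_.truncation ψ M) ≤ ENNReal.ofReal (truncationBound V C c M) ∧
      IsWeakSupersolution V K (_root_.truncation ψ M) := by
  have h0 := fun x => ne_bot_of_coe_le (hb x)
  have hlam := hK.lam_pos
  have hC := hK.C_pos
  have hleM := fun x => truncation_le (h0 x) M
  obtain ⟨f, hf⟩ := (isBoundedLSC_truncation hl hb M).exists_isApproximation hK
    (hψ.truncation hK h0 M)
  obtain ⟨g, hg, hlim⟩ := hf.exists_tendsto_gradient hK hV hleM
  have hw := hf.hasWeakGradient hV hleM hg hlim
  have hge : ∀ x, -(c * (1 + ‖x‖ ^ 2)) ≤ _root_.truncation ψ M x := fun x => by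
    rw [← EReal.coe_le_coe_iff, coe_truncation (h0 x)]
    refine le_min (hlow x) (EReal.coe_le_coe_iff.2 ?_)
    have : 0 ≤ c * (1 + ‖x‖ ^ 2) := by positivity
    linarith
  have hq := memLp_two_add_quadratic hV hlam hM hc
  have hle : ∀ x, ‖_root_.truncation ψ M x‖ ≤ ‖M + c * (1 + ‖x‖ ^ 2)‖ := fun x => by
    have : 0 ≤ c * (1 + ‖x‖ ^ 2) := by positivity
    rw [Real.norm_eq_abs, Real.norm_of_nonneg (by positivity)]
    exact abs_le.2 ⟨by linarith [hge x], by linarith [hleM x]⟩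
  have hm : MemLp (_root_.truncation ψ M) 2 (weightMeasure V) :=
    hq.mono hf.measurable.aestronglyMeasurable (Eventually.of_forall hle)
  refine ⟨hw.memSobolevV hm hg, ?_, hf.isWeakSupersolution hK hV hleM hg hlim⟩
  rw [hw.sobolevNormV_eq, truncationBound, ENNReal.ofReal_add ENNReal.toReal_nonneg
    (Real.sqrt_nonneg _), ENNReal.ofReal_toReal hq.2.ne]
  refine add_le_add (eLpNorm_mono hle) ((hf.eLpNorm_two_le hK hV hleM hg hlim).trans
    (ENNReal.ofReal_le_ofReal (Real.sqrt_le_sqrt ?_)))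
  have := hV.isProbabilityMeasure
  have hlin : MemLp (fun x : Eucl d => C * (‖x‖ + 1) + 1) 2 (weightMeasure V) := by
    refine (memLp_two_add_quadratic hV hlam zero_le_one (mul_nonneg two_pos.le hC.le)).mono
      (Continuous.aestronglyMeasurable (by fun_prop)) (Eventually.of_forall fun x => ?_)
    rw [Real.norm_of_nonneg (by positivity), Real.norm_of_nonneg (by positivity)]
    nlinarith [mul_nonneg hC.le (sq_nonneg (‖x‖ - 1)), mul_nonneg hC.le (sq_nonneg ‖x‖)]
  refine mul_le_mul_of_nonneg_left ?_ two_pos.le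
  have i1 : Integrable (fun x : Eucl d => (C * (‖x‖ + 1) + 1) * (M - _root_.truncation ψ M x))
      (weightMeasure V) := hlin.integrable_mul ((memLp_const M).sub hm)
  have i2 : Integrable (fun x : Eucl d => (C * (‖x‖ + 1) + 1) * (M + c * (1 + ‖x‖ ^ 2)))
      (weightMeasure V) := hlin.integrable_mul hq
  refine integral_mono i1 i2 fun x => ?_
  have h1 := hge x
  simp only
  gcongr
  linarith

end Gradient

/-! ### The converse: weak supersolutions have lower semicontinuous versions -/

section Regularity

variable {d : ℕ} {V : Eucl d → ℝ} {K : Eucl d → Eucl d → ℝ} {R lam Lam C : ℝ}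

/-- Coercivity enters only through K ≥ -C(‖x‖ + 1); the gradient part has a favourable sign and is
dropped. -/
theorem IsWeakSupersolution.hasLaplacianBound {w : Eucl d → ℝ} (hw : IsWeakSupersolution V K w)
    (hV : Continuous V) (hK : IsLinearHamiltonian K R lam Lam C) (hs : MemSobolevV V 2 w) :
    HasLaplacianBound w C := by
  intro h hh hc h0
  obtain ⟨L, hL⟩ := (hh.of_le (by norm_num)).lipschitzWith_of_hasCompactSupport hc (n := 1)
    (by norm_num)
  have hg := hasWeakGradient_weakGradient hs.exists_grad
  have h1 := hw h (hL.memSobolevV_of_hasCompactSupport hV hc) hc h0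
  have hae : ∀ᵐ x, -(1 / 2 : ℝ) * inner ℝ (weakGradient w x) (weakGradient h x)
      + K x (weakGradient w x) * h x =
      -(1 / 2 : ℝ) * inner ℝ (weakGradient w x) (gradient h x) + K x (weakGradient w x) * h x := by
    filter_upwards [hL.hasWeakGradient.weakGradient_ae_eq] with x hx
    rw [hx]
  obtain ⟨i1, i2⟩ := hK.integrable_weakForm hg.locallyIntegrable_grad hh hc
  have h2 := h1.2
  rw [integral_congr_ae hae, integral_add i1 i2, integral_const_mul,
    hg.integral_inner_gradient hh hc] at h2
  have i3 : Integrable fun x => -(C * (‖x‖ + 1) * h x) := by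
    refine Integrable.neg (Continuous.integrable_of_hasCompactSupport ?_ hc.mul_left)
    have := hh.continuous
    fun_prop
  have h3 : ∫ x, -(C * (‖x‖ + 1) * h x) ≤ ∫ x, K x (weakGradient w x) * h x := by
    refine integral_mono i3 i2 fun x => ?_
    have h4 := hK.lower x (weakGradient w x)
    have h5 := mul_nonneg hK.lam_pos.le (norm_nonneg (weakGradient w x))
    have h6 := h0 x
    simp only
    rw [← neg_mul]
    gcongr
    linarith
  rw [integral_neg] at h3
  linarith

theorem iSup_truncation_natCast {ψ : Eucl d → EReal} {x : Eucl d} (h : ψ x ≠ ⊥) :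
    ⨆ k : ℕ, ((truncation ψ k x : ℝ) : EReal) = ψ x := by
  simp only [coe_truncation h]
  refine le_antisymm (iSup_le fun k => min_le_left _ _) (le_of_forall_lt fun r hr => ?_)
  obtain ⟨q, hq, hq'⟩ := EReal.exists_between_coe_real hr
  obtain ⟨k, hk⟩ := exists_nat_gt q
  refine hq.trans (lt_of_lt_of_le (lt_min hq' ?_) (le_iSup (fun k : ℕ => min (ψ x) ((k : ℝ) : EReal)) k))
  exact_mod_cast hk

/-- Countably many heights suffice, so the exceptional null sets can be united before the supremum
of the representatives is taken. -/
theorem exists_lowerSemicontinuous_of_truncations {ψ : Eucl d → EReal} (h0 : ∀ x, ψ x ≠ ⊥)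
    (hV : Continuous V) (hK : IsLinearHamiltonian K R lam Lam C)
    (h : ∀ M : ℝ, 0 ≤ M → MemSobolevV V 2 (truncation ψ M) ∧
      IsWeakSupersolution V K (truncation ψ M)) :
    ∃ ψ' : Eucl d → EReal, LowerSemicontinuous ψ' ∧ ψ' =ᵐ[volume] ψ := by
  have hex : ∀ k : ℕ, ∃ f' : Eucl d → EReal, LowerSemicontinuous f' ∧
      ∀ᵐ x, f' x = (truncation ψ k x : EReal) := fun k => by
    obtain ⟨h1, h2⟩ := h k k.cast_nonneg
    exact (h2.hasLaplacianBound hV hK h1).exists_lowerSemicontinuous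
      (MemLp.locallyIntegrable_of_weightMeasure one_le_two h1.memLp hV) hK.C_pos.le
  choose f' hf' he using hex
  refine ⟨fun x => ⨆ k, f' k x, lowerSemicontinuous_iSup hf', ?_⟩
  filter_upwards [ae_all_iff.2 he] with x hx
  simp only [hx]
  exact iSup_truncation_natCast (h0 x)

end Regularity

/-! ### A quadratic lower bound depending only on the L¹ norm -/

section Bounds

variable {d : ℕ} {V : Eucl d → ℝ} {K : Eucl d → Eucl d → ℝ} {R lam Lam C : ℝ}

/-- A lower bound, depending only on the `L¹_V` norm, for truncated supersolutions on the ball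
outside of which the paraboloid barrier takes over. -/
noncomputable def ballBound (V : Eucl d → ℝ) (lam C m : ℝ) : ℝ :=
  (Real.exp (V 0 + 2 * lam * (1 + d / lam + 1)) * m +
    (C + 1) * (1 + d / lam + 2) * potentialMass d / 2) / radialMass d

/-- Truncation at height 0 supplies the boundedness that both ingredients require, without
increasing the L¹ norm. The mean value inequality bounds it below on the ball of radius 1 + d/λ, and
the barrier does the rest. -/
theorem IsViscositySupersolution.quadratic_lower_bound {ψ : Eucl d → EReal} {b : ℝ}
    (hψ : IsViscositySupersolution K ψ) (hK : IsLinearHamiltonian K R lam Lam C)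
    (hV : IsWeight V lam) (hl : LowerSemicontinuous ψ) (hb : ∀ x, (b : EReal) ≤ ψ x)
    (hm : HasZeroMean V ψ) {m : ℝ} (hm0 : 0 ≤ m)
    (hle : ∫⁻ x, ‖(ψ x).toReal‖ₑ ∂(weightMeasure V) ≤ ENNReal.ofReal m) (x : Eucl d) :
    ((-ballBound V lam C m - C / lam * ‖x‖ ^ 2 : ℝ) : EReal) ≤ ψ x := by
  have h0 := fun x => ne_bot_of_coe_le (hb x)
  have hlam := hK.lam_pos
  have hC := hK.C_pos
  have hw := isBoundedLSC_truncation hl hb 0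
  have hv := hψ.truncation hK h0 0
  obtain ⟨f, hf⟩ := hw.exists_isApproximation hK hv
  have habs : ∀ᵐ x ∂(weightMeasure V), ‖_root_.truncation ψ 0 x‖ ≤ ‖(ψ x).toReal‖ := by
    filter_upwards [weightMeasure_absolutelyContinuous.ae_le hm.finite_ae] with x hx
    have := abs_min_natCast_le (ψ x).toReal 0
    rw [truncation_eq_min_toReal hx.2 hx.1]
    rwa [Nat.cast_zero] at this
  have hwi : Integrable (_root_.truncation ψ 0) (weightMeasure V) :=
    hm.integrable.mono hf.measurable.aestronglyMeasurable habs
  have hwm : ∫ x, |_root_.truncation ψ 0 x| ∂(weightMeasure V) ≤ m := by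
    rw [← ENNReal.ofReal_le_ofReal_iff hm0]
    refine le_trans ?_ ((lintegral_mono_ae (habs.mono fun x hx => enorm_le_iff_norm_le.2 hx)).trans
      hle)
    exact (ofReal_integral_norm_eq_lintegral_enorm hwi).le
  have hS : ∀ y : Eucl d, ‖y‖ ≤ 1 + d / lam + 1 →
      V y ≤ V 0 + 2 * lam * (1 + d / lam + 1) := fun y hy => by
    have h1 := (abs_le.1 (hV.lipschitz y 0)).2
    rw [sub_zero] at h1
    have h2 : 2 * lam * ‖y‖ ≤ 2 * lam * (1 + d / lam + 1) := by gcongr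
    linarith
  have hball : ∀ x : Eucl d, ‖x‖ ≤ 1 + d / lam →
      -ballBound V lam C m ≤ _root_.truncation ψ 0 x := fun x hx => by
    have h1 := hf.radialAverage_le hC.le hw.le x
    have h2 := neg_le_radialAverage hV.continuous hwi hwm hS hx
    have h3 : (C + 1) * (‖x‖ + 2) * potentialMass d / 2 ≤
        (C + 1) * (1 + d / lam + 2) * potentialMass d / 2 := by
      have := potentialMass_nonneg (d := d)
      gcongr
    have h4 := radialMass_pos (d := d)
    rw [ballBound, ← neg_div, div_le_iff₀ h4]
    linarith
  have h1 := hv.quadratic_lower_bound hw hK hball x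
  refine (EReal.coe_le_coe_iff.2 h1).trans ?_
  rw [coe_truncation (h0 x)]
  exact min_le_left _ _

end Bounds

/-! ### Assembly of the two halves -/

theorem proposition5p5 {d : ℕ} (U : Set (Eucl d)) (L : ℝ≥0 → Eucl d → Eucl d → ℝ)
    (lam Lam c C : ℝ) (V : Eucl d → ℝ)
    (hL : IsBoundedDriftLagrangian U L)
    (hgrowth : HasLinearGrowth U L lam Lam c C)
    (hunif : UniformlyContinuousInSpace (hamiltonianBar U L))
    (hV : IsWeight V lam) :
    (∃ (Cbar : ℝ) (CM : ℝ → ℝ), ∀ ψ : Eucl d → EReal,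
      LowerSemicontinuous ψ →
      (∃ b : ℝ, ∀ x, (b : EReal) ≤ ψ x) →
      IsViscositySupersolution (hamiltonianBar U L) ψ →
      HasZeroMean V ψ →
        (MemSobolevV V 1 (fun x => (ψ x).toReal) ∧
          sobolevNormV V 1 (fun x => (ψ x).toReal) ≤ ENNReal.ofReal Cbar) ∧
        (∀ x, ((-(Cbar * (1 + ‖x‖ ^ 2)) : ℝ) : EReal) ≤ ψ x) ∧
        (∀ M : ℝ, 0 ≤ M →
          MemSobolevV V 2 (truncation ψ M) ∧
          sobolevNormV V 2 (truncation ψ M) ≤ ENNReal.ofReal (CM M) ∧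
          IsWeakSupersolution V (hamiltonianBar U L) (truncation ψ M))) ∧
    (∀ ψ : Eucl d → EReal, (∀ x, ψ x ≠ ⊥) →
      (∀ M : ℝ, 0 ≤ M →
        MemSobolevV V 2 (truncation ψ M) ∧
        IsWeakSupersolution V (hamiltonianBar U L) (truncation ψ M)) →
      ∃ ψ' : Eucl d → EReal, LowerSemicontinuous ψ' ∧ ψ' =ᵐ[volume] ψ) := by
  obtain ⟨R, hK⟩ := hamiltonianBar_isLinearHamiltonian hL hgrowth hunif
  have hlam := hK.lam_pos
  have hC := hK.C_pos
  refine ⟨?_, fun ψ h0 h => exists_lowerSemicontinuous_of_truncations h0 hV.continuous hK h⟩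
  obtain ⟨c₁, hc₁, hp⟩ := hV.exists_poincare hlam
  obtain ⟨a, ha, b₀, hb₀⟩ := hV.exists_linear_lower hlam
  have hb₀' : ∀ x, -b₀ ≤ V x := fun x => by
    have := mul_nonneg ha.le (norm_nonneg x)
    linarith [hb₀ x]
  have hgb : 0 ≤ gradientBound V lam C :=
    mul_nonneg (by positivity) (integral_nonneg fun x => by positivity)
  set m := c₁ * gradientBound V lam C with hm
  have hm0 : 0 ≤ m := mul_nonneg hc₁ hgb
  -- One constant dominating both coefficients of the quadratic bound. It depends on V, λ, C and the
  -- dimension only, so it can be fixed before ψ.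
  set Q := max (ballBound V lam C m) (C / lam) with hQ
  have hQ0 : 0 ≤ Q := le_max_of_le_right (by positivity)
  -- The L¹ bound for ψ plus the one for its gradient. The exponential converts the weight e^{-V/2}
  -- of the a priori estimate to e^{-V}, using V ≥ -b₀.
  set N := m + Real.exp (b₀ / 2) * gradientBound V lam C with hN
  refine ⟨max Q N, truncationBound V C Q, fun ψ hl ⟨b, hb⟩ hψ hmean => ?_⟩
  have hone := hψ.lintegral_enorm_le hK hV hl hb hmean hc₁ hp
  have hlow : ∀ x, ((-(Q * (1 + ‖x‖ ^ 2)) : ℝ) : EReal) ≤ ψ x := fun x => by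
    refine le_trans (EReal.coe_le_coe_iff.2 ?_)
      (hψ.quadratic_lower_bound hK hV hl hb hmean hm0 hone x)
    have h1 : C / lam * ‖x‖ ^ 2 ≤ Q * ‖x‖ ^ 2 := by
      gcongr
      exact le_max_right _ _
    have h2 : ballBound V lam C m ≤ Q := le_max_left _ _
    linarith
  refine ⟨?_, fun x => (EReal.coe_le_coe_iff.2 ?_).trans (hlow x),
    fun M hM => hψ.truncation_estimates hK hV hl hb hQ0 hM hlow⟩
  · obtain ⟨g, hg, hgn⟩ := hψ.exists_hasWeakGradient hK hV hl hb
      (hmean.finite_ae.mono fun x hx => hx.1) hmean.integrable hb₀'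
    have hi := memLp_one_iff_integrable.2 hmean.integrable
    refine ⟨hg.memSobolevV hi ⟨aestronglyMeasurable_weightMeasure
      hg.locallyIntegrable_grad.aestronglyMeasurable, hgn.trans_lt ENNReal.ofReal_lt_top⟩, ?_⟩
    rw [hg.sobolevNormV_eq, eLpNorm_one_eq_lintegral_enorm]
    refine (add_le_add hone hgn).trans ?_
    rw [← ENNReal.ofReal_add hm0 (mul_nonneg (Real.exp_pos _).le hgb)]
    exact ENNReal.ofReal_le_ofReal (le_max_right _ _)
  · have : Q ≤ max Q N := le_max_left _ _
    rw [neg_le_neg_iff]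
    gcongr
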